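/- Fix $\lambda\in(0,\infty)$ and $\kappa\in\mathbb N=\{1,2,\dots\}$, and put $\Sigma=\mathbb N\times(0,\infty)$. Messages arrive at the points $0<T_1<T_2<\dots$ of a Poisson point process with intensity $\lambda$ (the times $T_j-T_{j-1}$, with $T_0=0$, are i.i.d. exponential with parameter $\lambda$). There are $\kappa$ channels; at time $0$ an arbitrary deterministic initial state is given: channel $c$ is busy up to time $r_c$, where $r_c\le 1$ (idle if $r_c\le 0$; the system is initially empty if all $r_c\le0$; $r_c=1$ means that a message was admitted to channel $c$ at time $0$). Every admitted message keeps one channel busy for exactly one time unit. * CSMA: an arriving message is admitted iff fewer than $\kappa$ channels are busy. * ALOHA: each arriving message picks one of the $\kappa$ channels uniformly at random, independently of all other choices and of the arrival times, and it is admitted iff this channel is idle. (A message that picks a busy channel does not occupy it; the admitted message with which it collides keeps the channel busy until the end of its time unit.) Let $\widetilde T_1<\widetilde T_2<\dots$ be the times $T_j$ at which a message is admitted, $\widetilde T_0=0$, and for $i\in\mathbb N$ $$\sigma_i=\widetilde T_i-\widetilde T_{i-1},\qquad A_i=\#\{j\colon T_j\in(\widetilde T_{i-1},\widetilde T_i]\}.$$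 For $(a,t)=((a_1,t_1),\dots,(a_{\kappa-1},t_{\kappa-1}))\in\Sigma^{\kappa-1}$, $k\in\mathbb N$, $s>0$ let $\gamma=[1-\sum_{i=1}^{\kappa-1}t_i]_+$, $$\beta(s)=\mathbf 1_{[\gamma,\infty)}(s)\,\max\Big\{m\in\{1,\dots,\kappa\}\colon s+\sum_{j=0}^{m-2}t_{\kappa-1-j}\le 1\Big\}\quad(\max\emptyset=0),\qquad B(s)=\int_0^s\beta(r)\,\mathrm dr,$$ $$W_{\rm CSMA}\big((a,t),(k,\mathrm ds)\big)=\frac{\gamma^{k-1}}{(k-1)!}\lambda^k\mathrm e^{-\lambda s}\mathbf 1_{[\gamma,\infty)}(s)\,\mathrm ds,$$ $$W_{\rm ALOHA}\big((a,t),(k,\mathrm ds)\big)=\frac{\big(\gamma+\frac{B(s)}\kappa\big)^{k-1}}{(k-1)!}\Big(1-\frac{\beta(s)}\kappa\Big)\lambda^k\mathrm e^{-\lambda s}\mathbf 1_{[\gamma,\infty)}(s)\,\mathrm ds .$$ Then, for $*\in\{\mathrm{CSMA},\mathrm{ALOHA}\}$ and the respective model: 1. $W_*$ is a probability kernel from $\Sigma^{\kappa-1}$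 to $\Sigma$. 2. Almost surely $0<T_1<T_2<\dots$, infinitely many messages are admitted, and all $(A_i,\sigma_i)$ lie in $\Sigma$. The sequence $(A_i,\sigma_i)_{i\in\mathbb N}$ is a time-homogeneous $(\kappa-1)$-Markov chain with kernel $W_*$: for every $i\ge\kappa$, the conditional distribution of $(A_{i+1},\sigma_{i+1})$ given $(A_j,\sigma_j)_{1\le j\le i}$ is $W_*\big(((A_{i-\kappa+2},\sigma_{i-\kappa+2}),\dots,(A_i,\sigma_i)),\cdot\big)$. If some message was admitted at time $0$ ($r_c=1$ for some $c$, so that $\widetilde T_0=0$ is an admission time), then this holds also for $i=\kappa-1$. 3. The chain satisfies Condition (U): let $P_*$ be the transition kernel on $\Sigma^{\kappa-1}$ under which $(x_1,\dots,x_{\kappa-1})$ moves to $(x_2,\dots,x_{\kappa-1},y)$ with $y$ distributed according to $W_*((x_1,\dots,x_{\kappa-1}),\cdot)$. Then there are $\ell,N\in\mathbb N$ with $\ell\le N$ and $M\in[1,\infty)$ such that $$P_*^\ell(x,\cdot)\le\frac MN\sum_{i=1}^N P_*^i(\widetilde x,\cdot)\qquad\text{for all }x,\widetilde x\in\Sigma^{\kappa-1}.$$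 -/

import Mathlib

open MeasureTheory ProbabilityTheory Set
open scoped ENNReal

noncomputable section

namespace MultiChannel

/-! ### State space and finite-memory chains -/

/-- The positive integers `{1, 2, 3, …}`. -/
abbrev PosNat : Type := {k : ℕ // 1 ≤ k}

/-- The state space `Σ = ℕ × (0, ∞)` (with `ℕ = {1, 2, …}`) of the pairs `(A_i, σ_i)`. -/
abbrev State : Type := PosNat × Ioi (0 : ℝ)

/-- The reference measure `dk ⊗ ds` on `Σ`: counting measure times Lebesgue measure. -/
def refMeasure : Measure State :=
  (Measure.count : Measure PosNat).prod ((volume : Measure ℝ).comap Subtype.val)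

instance : SFinite ((volume : Measure ℝ).comap (Subtype.val : Ioi (0 : ℝ) → ℝ)) :=
  have h : SigmaFinite (((volume : Measure ℝ).comap (Subtype.val : Ioi (0 : ℝ) → ℝ)).map
      Subtype.val) := by
    rw [(MeasurableEmbedding.subtype_coe measurableSet_Ioi).map_comap]
    infer_instance
  have h' := SigmaFinite.of_map _ measurable_subtype_coe.aemeasurable h
  inferInstance

instance : SFinite refMeasure := by
  unfold refMeasure
  infer_instance

/-- The sequence `(X i)_{i ≥ 0}` evolves, from the transition to `X (m₀ + n)` on, as a
time-homogeneous `n`-step Markov chain with kernel `W`: for every `m ≥ m₀`, the conditional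
distribution of `X (m + n)` given the whole past `X 0, …, X (m + n - 1)` is
`W ((X m, …, X (m + n - 1)), ·)` (oldest entry first). -/
def IsMultistepMarkovFrom {Ω S : Type*} [MeasurableSpace Ω] [MeasurableSpace S] (n m₀ : ℕ)
    (X : ℕ → Ω → S) (W : Kernel (Fin n → S) S) (P : Measure Ω) : Prop :=
  ∀ m, m₀ ≤ m →
    HasCondDistrib (X (m + n)) (fun ω (j : Fin (m + n)) => X j ω)
      (W.comap (fun (h : Fin (m + n) → S) (k : Fin n) => h (Fin.natAdd m k)) (by fun_prop)) P

/-- Append a new entry at the end of an `n`-vector and drop the first (oldest) one. -/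
def shiftAppend {S : Type*} (n : ℕ) (p : (Fin n → S) × S) : Fin n → S :=
  Fin.tail (Fin.snoc p.1 p.2 : Fin (n + 1) → S)

lemma measurable_shiftAppend {S : Type*} [MeasurableSpace S] (n : ℕ) :
    Measurable (shiftAppend (S := S) n) := by
  refine measurable_pi_lambda _ fun i => ?_
  unfold shiftAppend Fin.tail
  refine Fin.lastCases (motive := fun j : Fin (n + 1) =>
    Measurable fun p : (Fin n → S) × S => (Fin.snoc p.1 p.2 : Fin (n + 1) → S) j) ?_ ?_ i.succ
  · simpa using measurable_snd
  · intro j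
    simp only [Fin.snoc_castSucc]
    fun_prop

/-- The transition kernel on `Sⁿ` of the chain of `n`-vectors `(X i, …, X (i + n - 1))` that
belongs to an `n`-step Markov chain with kernel `W`: the vector `(x₁, …, xₙ)` moves to
`(x₂, …, xₙ, y)` where `y` has law `W (x, ·)`. -/
def vectorKernel {S : Type*} [MeasurableSpace S] {n : ℕ} (W : Kernel (Fin n → S) S) :
    Kernel (Fin n → S) (Fin n → S) :=
  (Kernel.id ×ₖ W).map (shiftAppend n)

/-- Condition (U) for a transition kernel `Q`: there are `1 ≤ ℓ ≤ N` and `M ∈ [1, ∞)` such that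
`Q^ℓ (x, ·) ≤ (M / N) ∑_{i=1}^N Q^i (y, ·)` for all states `x, y`. -/
def ConditionU {E : Type*} [MeasurableSpace E] (Q : Kernel E E) : Prop :=
  ∃ ℓ N : ℕ, 1 ≤ ℓ ∧ ℓ ≤ N ∧ ∃ M : ℝ, 1 ≤ M ∧
    ∀ x y : E, (Q ^ ℓ) x ≤ ENNReal.ofReal (M / N) • ∑ i ∈ Finset.Icc 1 N, (Q ^ i) y

/-! ### The kernels -/

/-- `γ = [1 - ∑_{i=1}^{κ-1} t_i]_+`. -/
def gap (κ : ℕ) (x : Fin (κ - 1) → State) : ℝ := max (1 - ∑ i, ((x i).2 : ℝ)) 0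

/-- `t_{κ-1-j}`, the `j`-th latest inter-admission time (`j = 0` is the latest). -/
def recentLag (κ : ℕ) (x : Fin (κ - 1) → State) (j : ℕ) : ℝ :=
  if h : j < κ - 1 then ((x (Fin.rev ⟨j, h⟩)).2 : ℝ) else 0

open Classical in
/-- `β(s) = 1_{[γ,∞)}(s) · max {m ∈ {1, …, κ} : s + ∑_{j=0}^{m-2} t_{κ-1-j} ≤ 1}`, where the
maximum of the empty set is `0`. -/
def busyCount (κ : ℕ) (x : Fin (κ - 1) → State) (s : ℝ) : ℕ :=
  if gap κ x ≤ s then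
    (Finset.Icc 1 κ).sup fun m =>
      if s + ∑ j ∈ Finset.range (m - 1), recentLag κ x j ≤ 1 then m else 0
  else 0

/-- `B(s) = ∫_0^s β(r) dr`. -/
def busyIntegral (κ : ℕ) (x : Fin (κ - 1) → State) (s : ℝ) : ℝ :=
  ∫ r in (0 : ℝ)..s, (busyCount κ x r : ℝ)

open Classical in
/-- The density of `W_CSMA (x, ·)` at `(k, s)`. -/
def csmaDensity (κ : ℕ) (lam : ℝ) (x : Fin (κ - 1) → State) (y : State) : ℝ≥0∞ :=
  ENNReal.ofReal
    (gap κ x ^ ((y.1 : ℕ) - 1) / (((y.1 : ℕ) - 1).factorial : ℝ)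
      * lam ^ (y.1 : ℕ) * Real.exp (-lam * (y.2 : ℝ))
      * (if gap κ x ≤ (y.2 : ℝ) then 1 else 0))

open Classical in
/-- The density of `W_ALOHA (x, ·)` at `(k, s)`. -/
def alohaDensity (κ : ℕ) (lam : ℝ) (x : Fin (κ - 1) → State) (y : State) : ℝ≥0∞ :=
  ENNReal.ofReal
    ((gap κ x + busyIntegral κ x y.2 / κ) ^ ((y.1 : ℕ) - 1) / (((y.1 : ℕ) - 1).factorial : ℝ)
      * (1 - (busyCount κ x y.2 : ℝ) / κ)
      * lam ^ (y.1 : ℕ) * Real.exp (-lam * (y.2 : ℝ))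
      * (if gap κ x ≤ (y.2 : ℝ) then 1 else 0))

lemma measurable_gap (κ : ℕ) : Measurable (gap κ) := by
  unfold gap
  fun_prop

lemma measurable_recentLag (κ : ℕ) (j : ℕ) : Measurable fun x => recentLag κ x j := by
  unfold recentLag
  split_ifs
  · fun_prop
  · fun_prop

lemma measurable_busyCount (κ : ℕ) :
    Measurable fun p : (Fin (κ - 1) → State) × ℝ => busyCount κ p.1 p.2 := by
  unfold busyCount
  refine Measurable.ite ?_ ?_ measurable_const
  · exact measurableSet_le ((measurable_gap κ).comp measurable_fst) measurable_snd
  · induction Finset.Icc 1 κ using Finset.induction_on with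
    | empty => exact measurable_const
    | insert m u hm ih =>
      simp only [Finset.sup_insert]
      refine (measurable_of_countable fun q : ℕ × ℕ => q.1 ⊔ q.2).comp (Measurable.prodMk ?_ ih)
      refine Measurable.ite ?_ measurable_const measurable_const
      refine measurableSet_le (measurable_snd.add ?_) measurable_const
      exact Finset.measurable_sum _ fun j _ => (measurable_recentLag κ j).comp measurable_fst

lemma measurable_busyIntegral (κ : ℕ) :
    Measurable fun p : (Fin (κ - 1) → State) × Ioi (0 : ℝ) => busyIntegral κ p.1 p.2 := by
  have hm : Measurable fun q : ((Fin (κ - 1) → State) × Ioi (0 : ℝ)) × ℝ =>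
      (busyCount κ q.1.1 q.2 : ℝ) := by
    have h0 : Measurable fun q : ((Fin (κ - 1) → State) × Ioi (0 : ℝ)) × ℝ => (q.1.1, q.2) :=
      (measurable_fst.comp measurable_fst).prodMk measurable_snd
    have h1 := (measurable_busyCount κ).comp h0
    have h2 := (measurable_of_countable fun k : ℕ => (k : ℝ)).comp h1
    simpa only [Function.comp_def] using h2
  have hs : MeasurableSet {q : ((Fin (κ - 1) → State) × Ioi (0 : ℝ)) × ℝ |
      0 < q.2 ∧ q.2 ≤ (q.1.2 : ℝ)} :=
    (measurableSet_lt measurable_const measurable_snd).inter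
      (measurableSet_le measurable_snd
        (measurable_subtype_coe.comp (measurable_snd.comp measurable_fst)))
  have hF := ((hm.indicator hs).stronglyMeasurable.integral_prod_right'
    (ν := (volume : Measure ℝ))).measurable
  convert hF using 2 with p
  rw [busyIntegral, intervalIntegral.integral_of_le (le_of_lt p.2.2),
    ← integral_indicator measurableSet_Ioc]
  refine integral_congr_ae (Filter.Eventually.of_forall fun r => ?_)
  simp only [indicator_apply, mem_Ioc, mem_ofPred_eq]

lemma measurable_csmaDensity (κ : ℕ) (lam : ℝ) :
    Measurable (Function.uncurry (csmaDensity κ lam)) := by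
  have hk : Measurable fun p : (Fin (κ - 1) → State) × State => p.2.1 :=
    measurable_fst.comp measurable_snd
  have hs : Measurable fun p : (Fin (κ - 1) → State) × State => (p.2.2 : ℝ) :=
    measurable_subtype_coe.comp (measurable_snd.comp measurable_snd)
  have hg : Measurable fun p : (Fin (κ - 1) → State) × State => gap κ p.1 :=
    (measurable_gap κ).comp measurable_fst
  have hN {f : PosNat → ℝ} : Measurable fun p : (Fin (κ - 1) → State) × State => f p.2.1 :=
    (measurable_of_countable f).comp hk
  have hE : Measurable fun p : (Fin (κ - 1) → State) × State => (p.2.1 : ℕ) - 1 :=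
    (measurable_of_countable fun k : PosNat => (k : ℕ) - 1).comp hk
  refine ENNReal.measurable_ofReal.comp ?_
  refine ((((hg.pow hE).div (hN (f := fun k => (((k : ℕ) - 1).factorial : ℝ)))).mul
    (hN (f := fun k => lam ^ (k : ℕ)))).mul (hs.const_mul (-lam)).exp).mul ?_
  exact Measurable.ite (measurableSet_le hg hs) measurable_const measurable_const

lemma measurable_alohaDensity (κ : ℕ) (lam : ℝ) :
    Measurable (Function.uncurry (alohaDensity κ lam)) := by
  have hk : Measurable fun p : (Fin (κ - 1) → State) × State => p.2.1 :=
    measurable_fst.comp measurable_snd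
  have hs : Measurable fun p : (Fin (κ - 1) → State) × State => (p.2.2 : ℝ) :=
    measurable_subtype_coe.comp (measurable_snd.comp measurable_snd)
  have hg : Measurable fun p : (Fin (κ - 1) → State) × State => gap κ p.1 :=
    (measurable_gap κ).comp measurable_fst
  have hN {f : PosNat → ℝ} : Measurable fun p : (Fin (κ - 1) → State) × State => f p.2.1 :=
    (measurable_of_countable f).comp hk
  have hE : Measurable fun p : (Fin (κ - 1) → State) × State => (p.2.1 : ℕ) - 1 :=
    (measurable_of_countable fun k : PosNat => (k : ℕ) - 1).comp hk
  have hB : Measurable fun p : (Fin (κ - 1) → State) × State => busyIntegral κ p.1 p.2.2 := by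
    have h0 : Measurable fun p : (Fin (κ - 1) → State) × State => (p.1, p.2.2) :=
      measurable_fst.prodMk (measurable_snd.comp measurable_snd)
    have h1 := (measurable_busyIntegral κ).comp h0
    simpa only [Function.comp_def] using h1
  have hb : Measurable fun p : (Fin (κ - 1) → State) × State => (busyCount κ p.1 p.2.2 : ℝ) := by
    have h0 : Measurable fun p : (Fin (κ - 1) → State) × State => (p.1, (p.2.2 : ℝ)) :=
      measurable_fst.prodMk hs
    have h1 := (measurable_busyCount κ).comp h0
    have h2 := (measurable_of_countable fun k : ℕ => (k : ℝ)).comp h1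
    simpa only [Function.comp_def] using h2
  have hP : Measurable fun p : (Fin (κ - 1) → State) × State =>
      (gap κ p.1 + busyIntegral κ p.1 p.2.2 / κ) ^ ((p.2.1 : ℕ) - 1) :=
    (hg.add (hB.div_const _)).pow hE
  refine ENNReal.measurable_ofReal.comp ?_
  refine ((((hP.div (hN (f := fun k => (((k : ℕ) - 1).factorial : ℝ)))).mul
    ((hb.div_const _).const_sub 1)).mul
    (hN (f := fun k => lam ^ (k : ℕ)))).mul (hs.const_mul (-lam)).exp).mul ?_
  exact Measurable.ite (measurableSet_le hg hs) measurable_const measurable_const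

/-- The kernel `W_CSMA`. -/
def csmaKernel (κ : ℕ) (lam : ℝ) : Kernel (Fin (κ - 1) → State) State :=
  (Kernel.const _ refMeasure).withDensity (csmaDensity κ lam)

/-- The kernel `W_ALOHA`. -/
def alohaKernel (κ : ℕ) (lam : ℝ) : Kernel (Fin (κ - 1) → State) State :=
  (Kernel.const _ refMeasure).withDensity (alohaDensity κ lam)

lemma csmaKernel_apply (κ : ℕ) (lam : ℝ) (x : Fin (κ - 1) → State) :
    csmaKernel κ lam x = refMeasure.withDensity (csmaDensity κ lam x) := by
  rw [csmaKernel, Kernel.withDensity_apply _ (measurable_csmaDensity κ lam), Kernel.const_apply]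

lemma alohaKernel_apply (κ : ℕ) (lam : ℝ) (x : Fin (κ - 1) → State) :
    alohaKernel κ lam x = refMeasure.withDensity (alohaDensity κ lam x) := by
  rw [alohaKernel, Kernel.withDensity_apply _ (measurable_alohaDensity κ lam), Kernel.const_apply]

/-! ### The two protocols -/

/-- Arrival times from interarrival times: `arrival τ j = τ 0 + ⋯ + τ j` is the time `T_{j+1}`
of the `(j+1)`-st message. -/
def arrival (τ : ℕ → ℝ) (j : ℕ) : ℝ := ∑ i ∈ Finset.range (j + 1), τ i

/-- CSMA: the message arriving at time `T j` is admitted iff fewer than `κ` channels are busy at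
that time. Channel `c` is busy before time `r c` because of the initial condition, and each
admitted message occupies one channel for one time unit. -/
def csmaAdmitted (κ : ℕ) (r : Fin κ → ℝ) (T : ℕ → ℝ) (j : ℕ) : Prop :=
  {c : Fin κ | T j < r c}.ncard
    + {i : Fin j | csmaAdmitted κ r T i ∧ T j < T i + 1}.ncard < κ
termination_by j
decreasing_by exact i.2

/-- ALOHA: the message arriving at time `T j` picks channel `C j` and is admitted iff this channel
is idle at that time, i.e. it is neither busy because of the initial condition `r` nor
because of an earlier admitted message. An admitted message keeps its channel busy for one time
unit, also if it is destroyed by a collision in the meantime; a message which picks a busy channel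
does not occupy it. -/
def alohaAdmitted (κ : ℕ) (r : Fin κ → ℝ) (T : ℕ → ℝ) (C : ℕ → Fin κ) (j : ℕ) : Prop :=
  r (C j) ≤ T j ∧
    ∀ i : Fin j, alohaAdmitted κ r T C i → C i = C j → T i + 1 ≤ T j
termination_by j
decreasing_by exact i.2

/-- `admissionTime T adm i` is the time of the `i`-th admission, `i ≥ 1`, for arrival times `T`
and the set `adm` of indices of admitted messages; the `0`-th one is time `0`. -/
def admissionTime (T : ℕ → ℝ) (adm : ℕ → Prop) : ℕ → ℝ
  | 0 => 0
  | i + 1 => T (Nat.nth adm i)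

/-- `lag T adm i` is the time lag between the `i`-th and the `(i+1)`-st admission. -/
def lag (T : ℕ → ℝ) (adm : ℕ → Prop) (i : ℕ) : ℝ :=
  admissionTime T adm (i + 1) - admissionTime T adm i

/-- `attempts T adm i` is the number of arrivals after the `i`-th and up to (and including) the
`(i+1)`-st admission. -/
def attempts (T : ℕ → ℝ) (adm : ℕ → Prop) (i : ℕ) : ℕ :=
  {j : ℕ | T j ∈ Ioc (admissionTime T adm i) (admissionTime T adm (i + 1))}.ncard

/-- `τ` is the sequence of interarrival times of a Poisson point process on `(0, ∞)` with
intensity `lam`: independent and exponentially distributed with parameter `lam`. -/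
structure IsPoissonInterarrival {Ω : Type*} [MeasurableSpace Ω] (P : Measure Ω) (lam : ℝ)
    (τ : ℕ → Ω → ℝ) : Prop where
  measurable : ∀ j, Measurable (τ j)
  hasLaw : ∀ j, HasLaw (τ j) (expMeasure lam) P
  indep : iIndepFun τ P

/-- `C` is a sequence of independent uniformly distributed channel choices, independent of the
interarrival times `τ`. -/
structure IsUniformChoice {Ω : Type*} [MeasurableSpace Ω] (P : Measure Ω) {κ : ℕ}
    (τ : ℕ → Ω → ℝ) (C : ℕ → Ω → Fin κ) : Prop where
  measurable : ∀ j, Measurable (C j)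
  uniform : ∀ j c, P (C j ⁻¹' {c}) = (κ : ℝ≥0∞)⁻¹
  indep : iIndepFun C P
  indep_arrivals : IndepFun (fun ω j => τ j ω) (fun ω j => C j ω) P

/-- For random arrival times `T` and the random set `adm` of indices of admitted messages:
almost surely, there are infinitely many arrivals `0 < T 0 < T 1 < ⋯`, infinitely many of which are
admitted, and the sequence of pairs `(A_i, σ_i)` takes values in `Σ` (i.e. is almost surely
equal to a sequence `X` of `Σ`-valued random variables) and evolves as an `n`-step Markov chain with
kernel `W` from the transition to its `(m₀ + n + 1)`-st element on. -/
def AdmissionChain {Ω : Type*} [MeasurableSpace Ω] (P : Measure Ω) (T : Ω → ℕ → ℝ)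
    (adm : Ω → ℕ → Prop) (n m₀ : ℕ) (W : Kernel (Fin n → State) State) : Prop :=
  (∀ᵐ ω ∂P, 0 < T ω 0 ∧ StrictMono (T ω) ∧ {j | adm ω j}.Infinite) ∧
  ∃ X : ℕ → Ω → State, (∀ i, Measurable (X i)) ∧
    (∀ᵐ ω ∂P, ∀ i, ((X i ω).1 : ℕ) = attempts (T ω) (adm ω) i ∧
      ((X i ω).2 : ℝ) = lag (T ω) (adm ω) i) ∧
    IsMultistepMarkovFrom n m₀ X W P

end MultiChannel

end

/-! Both protocols fit one scheme: an arrival at time s after an admission is rejected with a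
probability b(s) that depends only on the last κ - 1 lags. An admission needs an idle channel, so at
most κ messages are ever present. Once κ messages have been admitted, a channel still busy from the
initial state would coexist with all of them, which is one too many. Hence the busy channels belong
to those of the κ latest admitted messages whose age is below 1. With a message admitted at time 0,
that message plays the κ-th one and κ - 1 admissions suffice. This is `busyAt_eq_busyNum`. Under
CSMA b is 0 or 1, under ALOHA it is the busy fraction of channels.

Put F(s) = ∫_0^s b. The event that k arrivals are rejected and the next one comes at time s has
density F(s)^k / k! · λ^(k+1) · e^(-λs) (`lintegral_rejected`, by induction through
`lintegral_stageDensity_succ`); acceptance contributes the factor 1 - b(s). For s ≥ γ, F(s) is γ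
under CSMA and γ + B(s)/κ under ALOHA, so these are the densities of the two kernels
(`isBlocking_csma`, `isBlocking_aloha`). Summed over k they give the derivative of -e^(-λ(s -
F(s))), and b = 0 on [1, ∞) makes the total mass 1 (`lintegral_tsum_stageDensity`).

For the Markov property, split according to the number q of arrivals up to the i-th admission. On
each piece the past is a function of the first q arrivals, and the later arrivals are independent of
them; summing over q and over the number k of subsequent rejections gives
`hasCondDistrib_chainState`.

For Condition (U) put n = κ - 1. The kernel sees only lags, so n steps erase the attempt numbers of
the starting vector. The density of a new lag is at most e^λ times the exponential density, and at
least c times it if some lag in memory is at least 1, because then a channel is idle (c = 1 for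
CSMA, c = 1/κ for ALOHA). Lags of at least 1 have at least their exponential probability q from
every state. So the (2n+1)-step law from any x is at most e^(λn) K, and the (3n+1)-step law from any
y is at least c^n q^n K, with the same K (`IsBlocking.conditionU`). -/

noncomputable section

namespace MultiChannel

/-! ### Primitives of bounded measurable functions -/

section Primitive

variable {b : ℝ → ℝ}

lemma intervalIntegrable_of_mem_unit (hb : Measurable b) (h : ∀ s, b s ∈ Icc (0 : ℝ) 1) (u v : ℝ) :
    IntervalIntegrable b volume u v := by
  refine (intervalIntegrable_const (c := (1 : ℝ))).mono_fun hb.aestronglyMeasurable ?_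
  refine Filter.Eventually.of_forall fun s => ?_
  simp [abs_of_nonneg (h s).1, (h s).2]

lemma lipschitzWith_primitive (hb : Measurable b) (h : ∀ s, b s ∈ Icc (0 : ℝ) 1) :
    LipschitzWith 1 fun u => ∫ r in (0 : ℝ)..u, b r := by
  refine LipschitzWith.of_dist_le_mul fun u v => ?_
  rw [Real.dist_eq, Real.dist_eq, intervalIntegral.integral_interval_sub_left
    (intervalIntegrable_of_mem_unit hb h _ _) (intervalIntegrable_of_mem_unit hb h _ _)]
  have := intervalIntegral.norm_integral_le_of_norm_le_const (a := v) (b := u) (C := 1) (f := b)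
    fun s _ => by simp [abs_of_nonneg (h s).1, (h s).2]
  simpa using this

lemma primitive_nonneg (h : ∀ s, b s ∈ Icc (0 : ℝ) 1) {u : ℝ} (hu : 0 ≤ u) :
    0 ≤ ∫ r in (0 : ℝ)..u, b r :=
  intervalIntegral.integral_nonneg hu fun s _ => (h s).1

/-- The chain rule for a primitive of a bounded measurable function. -/
lemma integral_deriv_comp_primitive (hb : Measurable b) (h : ∀ s, b s ∈ Icc (0 : ℝ) 1)
    {φ : ℝ → ℝ} (hφ : ContDiff ℝ 1 φ) (u v : ℝ) :
    ∫ s in u..v, deriv φ (∫ r in (0 : ℝ)..s, b r) * b s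
      = φ (∫ r in (0 : ℝ)..v, b r) - φ (∫ r in (0 : ℝ)..u, b r) := by
  set F : ℝ → ℝ := fun u => ∫ r in (0 : ℝ)..u, b r with hF
  have hLip := lipschitzWith_primitive hb h
  -- As b is only measurable, F need not be differentiable everywhere. But φ is Lipschitz on the
  -- compact image of F, so φ ∘ F is Lipschitz, hence absolutely continuous and the integral of its
  -- a.e. derivative.
  obtain ⟨K, hK⟩ : ∃ K, LipschitzOnWith K φ (F '' uIcc u v) := by
    refine (hφ.contDiffOn (s := univ)).locallyLipschitzOn convex_univ |>.mono (subset_univ _)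
      |>.exists_lipschitzOnWith_of_compact ?_
    exact isCompact_uIcc.image hLip.continuous
  have hAC : AbsolutelyContinuousOnInterval (φ ∘ F) u v := by
    refine LipschitzOnWith.absolutelyContinuousOnInterval (K := K * 1) ?_
    exact hK.comp (hLip.lipschitzOnWith) (mapsTo_image F (uIcc u v))
  have key := hAC.integral_deriv_eq_sub
  simp only [Function.comp] at key
  rw [← key]
  refine intervalIntegral.integral_congr_ae ?_
  have hloc : LocallyIntegrable b volume := by
    refine (locallyIntegrable_const (1 : ℝ)).mono hb.aestronglyMeasurable ?_
    refine Filter.Eventually.of_forall fun s => ?_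
    simp [abs_of_nonneg (h s).1, (h s).2]
  filter_upwards [LocallyIntegrable.ae_hasDerivAt_integral hloc] with s hs _
  exact (((hφ.differentiable one_ne_zero).differentiableAt.hasDerivAt).comp s (hs 0)).deriv.symm

/-- The chain rule for x^(k+1)/(k+1)!; it is what raises the stage by one in
`lintegral_stageDensity_succ`. -/
lemma integral_primitive_pow (hb : Measurable b) (h : ∀ s, b s ∈ Icc (0 : ℝ) 1) (k : ℕ) (u : ℝ) :
    ∫ s in (0 : ℝ)..u, (∫ r in (0 : ℝ)..s, b r) ^ k / k.factorial * b s
      = (∫ r in (0 : ℝ)..u, b r) ^ (k + 1) / (k + 1).factorial := by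
  have := integral_deriv_comp_primitive hb h
    (φ := fun x => x ^ (k + 1) / (k + 1).factorial) (by fun_prop) 0 u
  simp only [intervalIntegral.integral_same, ne_eq, Nat.add_eq_zero_iff, one_ne_zero, and_false,
    not_false_eq_true, zero_pow, zero_div, sub_zero] at this
  rw [← this]
  refine intervalIntegral.integral_congr fun s _ => ?_
  simp only [deriv_div_const, differentiableAt_fun_id, deriv_fun_pow, Nat.factorial_succ]
  push_cast
  have : (k.factorial : ℝ) ≠ 0 := by positivity
  have : (k : ℝ) + 1 ≠ 0 := by positivity
  simp only [deriv_id'', mul_one]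
  field_simp

end Primitive

/-- The sub-probability density of the time of the `(k+1)`-st arrival on the event that the first
`k` arrivals are rejected, if an arrival at time `s` is rejected with probability `b s`. -/
def stageDensity (lam : ℝ) (b : ℝ → ℝ) (k : ℕ) (s : ℝ) : ℝ≥0∞ :=
  ENNReal.ofReal ((∫ r in (0 : ℝ)..s, b r) ^ k / k.factorial * lam ^ (k + 1) * Real.exp (-lam * s))

section Stage

variable {b : ℝ → ℝ} {lam : ℝ}

lemma measurable_stageDensity (hb : Measurable b) (h : ∀ s, b s ∈ Icc (0 : ℝ) 1) (lam : ℝ)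
    (k : ℕ) : Measurable (stageDensity lam b k) := by
  have := (lipschitzWith_primitive hb h).continuous.measurable
  unfold stageDensity
  fun_prop

/-- A further arrival after a rejection: the recursion for the stage densities. -/
lemma lintegral_stageDensity_succ (hb : Measurable b) (h : ∀ s, b s ∈ Icc (0 : ℝ) 1)
    (hlam : 0 < lam) (k : ℕ) {ψ : ℝ → ℝ≥0∞} (hψ : Measurable ψ) :
    ∫⁻ s in Ioi (0 : ℝ), ENNReal.ofReal (b s) *
        (∫⁻ t in Ioi (0 : ℝ), ψ (s + t) * ENNReal.ofReal (lam * Real.exp (-lam * t)))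
          * stageDensity lam b k s
      = ∫⁻ u in Ioi (0 : ℝ), ψ u * stageDensity lam b (k + 1) u := by
  have hst := measurable_stageDensity hb h lam k
  -- Substitute u = s + t, the time of the next arrival. Writing the range u > s as an indicator
  -- prepares Tonelli on the region 0 < s < u.
  have h1 : ∀ s, ∫⁻ t in Ioi (0 : ℝ), ψ (s + t) * ENNReal.ofReal (lam * Real.exp (-lam * t))
      = ∫⁻ u, (Ioi s).indicator
        (fun u => ψ u * ENNReal.ofReal (lam * Real.exp (-lam * (u - s)))) u := by
    intro s
    rw [← lintegral_indicator measurableSet_Ioi, ← lintegral_add_left_eq_self (fun u => (Ioi s).indicator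
        (fun u => ψ u * ENNReal.ofReal (lam * Real.exp (-lam * (u - s)))) u) s]
    refine lintegral_congr fun t => ?_
    simp [indicator_apply]
  simp_rw [h1]
  have h2 : ∀ s, ENNReal.ofReal (b s) * (∫⁻ u, (Ioi s).indicator
        (fun u => ψ u * ENNReal.ofReal (lam * Real.exp (-lam * (u - s)))) u) * stageDensity lam b k s
      = ∫⁻ u, (Ioi s).indicator (fun u => ENNReal.ofReal (b s) *
        (ψ u * ENNReal.ofReal (lam * Real.exp (-lam * (u - s)))) * stageDensity lam b k s) u := by
    intro s
    rw [← lintegral_const_mul, ← lintegral_mul_const]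
    · refine lintegral_congr fun u => ?_
      simp only [indicator_apply]
      split_ifs <;> simp
    · refine Measurable.const_mul (Measurable.indicator ?_ measurableSet_Ioi) _
      fun_prop
    · refine Measurable.indicator ?_ measurableSet_Ioi
      fun_prop
  simp_rw [h2]
  rw [← lintegral_indicator measurableSet_Ioi, ← lintegral_indicator measurableSet_Ioi]
  have h3 : ∀ s, (Ioi (0 : ℝ)).indicator (fun s => ∫⁻ u, (Ioi s).indicator
      (fun u => ENNReal.ofReal (b s) *
        (ψ u * ENNReal.ofReal (lam * Real.exp (-lam * (u - s)))) * stageDensity lam b k s) u) s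
      = ∫⁻ u, {p : ℝ × ℝ | 0 < p.1 ∧ p.1 < p.2}.indicator (fun p => ENNReal.ofReal (b p.1) *
        (ψ p.2 * ENNReal.ofReal (lam * Real.exp (-lam * (p.2 - p.1)))) * stageDensity lam b k p.1)
          (s, u) := by
    intro s
    by_cases hs : 0 < s <;> simp [indicator_apply, hs]
  simp_rw [h3]
  have hm : MeasurableSet {p : ℝ × ℝ | 0 < p.1 ∧ p.1 < p.2} :=
    (measurableSet_lt measurable_const measurable_fst).inter
      (measurableSet_lt measurable_fst measurable_snd)
  rw [lintegral_lintegral_swap]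
  · refine lintegral_congr fun u => ?_
    by_cases hu : 0 < u
    swap
    · rw [indicator_of_notMem (by simpa using hu)]
      convert lintegral_zero with s
      rw [indicator_of_notMem]
      rintro ⟨h1, h2⟩
      exact hu (h1.trans h2)
    rw [indicator_of_mem (by simpa using hu)]
    -- The two exponentials merge into e^(-λu), which is free of s; only F^k/k! · b remains to be
    -- integrated over (0, u).
    have h4 : ∀ s, {p : ℝ × ℝ | 0 < p.1 ∧ p.1 < p.2}.indicator (fun p => ENNReal.ofReal (b p.1) *
        (ψ p.2 * ENNReal.ofReal (lam * Real.exp (-lam * (p.2 - p.1)))) * stageDensity lam b k p.1)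
          (s, u) = ψ u * (Ioo 0 u).indicator (fun s => ENNReal.ofReal
            ((∫ r in (0 : ℝ)..s, b r) ^ k / k.factorial * b s
              * (lam ^ (k + 1 + 1) * Real.exp (-lam * u)))) s := by
      intro s
      simp only [indicator_apply, mem_ofPred_eq, mem_Ioo]
      split_ifs with hs
      · have hF := primitive_nonneg h hs.1.le
        rw [stageDensity, mul_left_comm, mul_assoc, ← ENNReal.ofReal_mul (h s).1,
          ← ENNReal.ofReal_mul (mul_nonneg (h s).1 (by positivity))]
        congr 2
        rw [show Real.exp (-lam * u) = Real.exp (-lam * (u - s)) * Real.exp (-lam * s) by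
          rw [← Real.exp_add]; ring_nf]
        ring
      · simp
    simp_rw [h4]
    have hFm := (lipschitzWith_primitive hb h).continuous
    rw [lintegral_const_mul]
    · congr 1
      rw [lintegral_indicator measurableSet_Ioo, ← ofReal_integral_eq_lintegral_ofReal]
      · rw [integral_mul_const, ← integral_Ioc_eq_integral_Ioo,
          ← intervalIntegral.integral_of_le hu.le, integral_primitive_pow hb h, stageDensity,
          ← mul_assoc]
      · refine Integrable.mul_const ?_ _
        have := (intervalIntegrable_of_mem_unit hb h 0 u).continuousOn_mul
          (g := fun s => (∫ r in (0 : ℝ)..s, b r) ^ k / k.factorial)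
          ((hFm.pow k).div_const _).continuousOn
        rw [intervalIntegrable_iff_integrableOn_Ioo_of_le hu.le] at this
        exact this
      · refine (ae_restrict_iff' measurableSet_Ioo).2 (Filter.Eventually.of_forall fun s hs => ?_)
        have := primitive_nonneg h hs.1.le
        have := (h s).1
        simp only [Pi.zero_apply]
        positivity
    · refine Measurable.indicator ?_ measurableSet_Ioo
      have := hFm.measurable
      fun_prop
  · refine Measurable.aemeasurable ?_
    refine Measurable.indicator ?_ hm
    fun_prop

/-- The exponential series in λF(s). -/
lemma tsum_stageDensity (h : ∀ s, b s ∈ Icc (0 : ℝ) 1) (hlam : 0 < lam) {s : ℝ} (hs : 0 ≤ s) :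
    ∑' k, stageDensity lam b k s
      = ENNReal.ofReal (lam * Real.exp (-lam * (s - ∫ r in (0 : ℝ)..s, b r))) := by
  have hF := primitive_nonneg h hs
  have hsum : HasSum (fun k : ℕ => (∫ r in (0 : ℝ)..s, b r) ^ k / k.factorial * lam ^ (k + 1)
      * Real.exp (-lam * s)) (lam * Real.exp (-lam * (s - ∫ r in (0 : ℝ)..s, b r))) := by
    have := (NormedSpace.expSeries_div_hasSum_exp (𝔸 := ℝ)
      (lam * ∫ r in (0 : ℝ)..s, b r)).mul_left (lam * Real.exp (-lam * s))
    rw [← Real.exp_eq_exp_ℝ, mul_assoc, ← Real.exp_add] at this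
    convert! this using 2
    · ring
    · ring_nf
  unfold stageDensity
  rw [← hsum.tsum_eq, ENNReal.ofReal_tsum_of_nonneg _ hsum.summable]
  intro k
  positivity

/-- The rejection probabilities `b` vanish from time `1` on: some arrival is accepted, almost
surely. -/
lemma lintegral_tsum_stageDensity (hb : Measurable b) (h : ∀ s, b s ∈ Icc (0 : ℝ) 1)
    (h1 : ∀ s, 1 ≤ s → b s = 0) (hlam : 0 < lam) :
    ∫⁻ s in Ioi (0 : ℝ), ENNReal.ofReal (1 - b s) * ∑' k, stageDensity lam b k s = 1 := by
  have hF := lipschitzWith_primitive hb h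
  have h' : ∀ s, (fun r => 1 - b r) s ∈ Icc (0 : ℝ) 1 := fun s =>
    ⟨by linarith [(h s).2], by linarith [(h s).1]⟩
  have hb' : Measurable fun r => 1 - b r := by fun_prop
  have hG : ∀ s, ∫ r in (0 : ℝ)..s, (1 - b r) = s - ∫ r in (0 : ℝ)..s, b r := by
    intro s
    rw [intervalIntegral.integral_sub intervalIntegrable_const
      (intervalIntegrable_of_mem_unit hb h _ _)]
    simp
  set c := ∫ r in (0 : ℝ)..1, b r with hc
  have hF1 : ∀ s, 1 < s → ∫ r in (0 : ℝ)..s, b r = c := by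
    intro s hs
    rw [← intervalIntegral.integral_add_adjacent_intervals (b := 1)
      (intervalIntegrable_of_mem_unit hb h _ _) (intervalIntegrable_of_mem_unit hb h _ _)]
    rw [intervalIntegral.integral_congr_ae (a := 1) (b := s) (g := fun _ => 0)]
    · simp [hc]
    · refine Filter.Eventually.of_forall fun r hr => h1 r ?_
      rw [uIoc_of_le hs.le] at hr
      exact hr.1.le
  -- Up to time 1 the integrand is the derivative of -e^(-λ(s - F(s))), contributing 1 -
  -- e^(-λ(1-c)). Beyond 1, F is the constant c and the exponential tail contributes e^(-λ(1-c)).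
  rw [← Ioc_union_Ioi_eq_Ioi (zero_le_one (α := ℝ)),
    lintegral_union measurableSet_Ioi (Ioc_disjoint_Ioi le_rfl)]
  have hd : deriv (fun x => - Real.exp (-lam * x)) = fun x => lam * Real.exp (-lam * x) := by
    funext x
    have : HasDerivAt (fun x => - Real.exp (-lam * x)) (-(Real.exp (-lam * x) * (-lam * 1))) x :=
      (((hasDerivAt_id x).const_mul (-lam)).exp).neg
    rw [this.deriv]
    ring
  have e1 : ∫⁻ s in Ioc (0 : ℝ) 1, ENNReal.ofReal (1 - b s) * ∑' k, stageDensity lam b k s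
      = ENNReal.ofReal (1 - Real.exp (-lam * (1 - c))) := by
    have key := integral_deriv_comp_primitive hb' h' (φ := fun x => - Real.exp (-lam * x))
      (by fun_prop) 0 1
    simp only [hG, hd, intervalIntegral.integral_same, ← hc] at key
    have : (1 - Real.exp (-lam * (1 - c)))
        = -Real.exp (-lam * (1 - c)) - -Real.exp (-lam * (0 - 0)) := by simp; ring
    rw [this, ← key, intervalIntegral.integral_of_le zero_le_one,
      ofReal_integral_eq_lintegral_ofReal]
    · refine setLIntegral_congr_fun measurableSet_Ioc fun s hs => ?_
      rw [tsum_stageDensity h hlam hs.1.le, mul_comm, ← ENNReal.ofReal_mul (by positivity)]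
    · have := (intervalIntegrable_of_mem_unit hb' h' 0 1).continuousOn_mul
          (g := fun s => lam * Real.exp (-lam * (s - ∫ r in (0 : ℝ)..s, b r)))
          (by have := hF.continuous; fun_prop)
      rwa [intervalIntegrable_iff_integrableOn_Ioc_of_le zero_le_one] at this
    · refine Filter.Eventually.of_forall fun s => ?_
      have := (h' s).1
      simp only [Pi.zero_apply] at this ⊢
      positivity
  have e2 : ∫⁻ s in Ioi (1 : ℝ), ENNReal.ofReal (1 - b s) * ∑' k, stageDensity lam b k s
      = ENNReal.ofReal (Real.exp (-lam * (1 - c))) := by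
    have hi := integral_exp_mul_Ioi (a := -lam) (by linarith) 1
    have : Real.exp (-lam * (1 - c)) = ∫ s in Ioi (1 : ℝ), lam * Real.exp (lam * c)
        * Real.exp (-lam * s) := by
      rw [integral_const_mul, hi, show -lam * (1 - c) = lam * c + -lam * 1 by ring, Real.exp_add]
      field_simp
    rw [this, ofReal_integral_eq_lintegral_ofReal]
    · refine setLIntegral_congr_fun measurableSet_Ioi fun s hs => ?_
      have hs' : 1 < s := hs
      rw [tsum_stageDensity h hlam (by linarith), h1 s hs'.le, hF1 s hs', mul_assoc, ← Real.exp_add]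
      simp
      ring_nf
    · exact (integrableOn_exp_mul_Ioi (by linarith) 1).const_mul _
    · exact Filter.Eventually.of_forall fun s => by simp; positivity
  rw [e1, e2, ← ENNReal.ofReal_add _ (by positivity)]
  · simp
  · have : c ≤ 1 := by
      have := primitive_nonneg h' zero_le_one
      rw [hG] at this
      linarith
    rw [sub_nonneg, Real.exp_le_one_iff]
    nlinarith

end Stage

/-! ### Rejection probabilities and the transition kernels -/

/-- A downward closed predicate selects an initial segment, whose size is its maximum. This
reconciles the count of busy channels with the maximum that defines `busyCount`. -/
lemma card_filter_Icc_eq_sup {κ : ℕ} (p : ℕ → Prop) [DecidablePred p]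
    (hp : ∀ m n, m ≤ n → p n → p m) :
    ((Finset.Icc 1 κ).filter p).card = (Finset.Icc 1 κ).sup fun m => if p m then m else 0 := by
  refine le_antisymm ?_ (Finset.sup_le fun m hm => ?_)
  · have : (Finset.Icc 1 κ).filter p ⊆
        Finset.Icc 1 ((Finset.Icc 1 κ).sup fun m => if p m then m else 0) := by
      intro m hm
      simp only [Finset.mem_filter] at hm
      have := Finset.le_sup (f := fun m => if p m then m else 0) hm.1
      simp only [hm.2, if_true] at this
      exact Finset.mem_Icc.2 ⟨(Finset.mem_Icc.1 hm.1).1, this⟩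
    simpa using Finset.card_le_card this
  · split_ifs with h
    · have : Finset.Icc 1 m ⊆ (Finset.Icc 1 κ).filter p := by
        intro j hj
        simp only [Finset.mem_filter, Finset.mem_Icc] at hj hm ⊢
        exact ⟨⟨hj.1, hj.2.trans hm.2⟩, hp _ _ hj.2 h⟩
      simpa using Finset.card_le_card this
    · exact Nat.zero_le _

lemma recentLag_nonneg (κ : ℕ) (x : Fin (κ - 1) → State) (j : ℕ) : 0 ≤ recentLag κ x j := by
  unfold recentLag
  split_ifs
  · exact (x _).2.2.le
  · exact le_rfl

/-- The time between the `m`-th latest and the latest admission. -/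
def ageSum (κ : ℕ) (x : Fin (κ - 1) → State) (m : ℕ) : ℝ :=
  ∑ j ∈ Finset.range (m - 1), recentLag κ x j

lemma ageSum_nonneg (κ : ℕ) (x : Fin (κ - 1) → State) (m : ℕ) : 0 ≤ ageSum κ x m :=
  Finset.sum_nonneg fun j _ => recentLag_nonneg κ x j

lemma ageSum_mono (κ : ℕ) (x : Fin (κ - 1) → State) : Monotone (ageSum κ x) := fun m n h =>
  Finset.sum_le_sum_of_subset_of_nonneg (Finset.range_mono (by omega))
    fun j _ _ => recentLag_nonneg κ x j

lemma ageSum_self (κ : ℕ) (x : Fin (κ - 1) → State) : ageSum κ x κ = ∑ i, ((x i).2 : ℝ) := by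
  rw [ageSum, Finset.sum_range, ← Equiv.sum_comp Fin.revPerm]
  refine Finset.sum_congr rfl fun i _ => ?_
  rw [recentLag, dif_pos (Fin.revPerm i).2]
  simp only [Fin.eta, Fin.revPerm_apply, Fin.rev_rev]

lemma measurable_ageSum (κ m : ℕ) : Measurable fun x => ageSum κ x m := by
  unfold ageSum
  exact Finset.measurable_sum _ fun j _ => measurable_recentLag κ j

lemma gap_eq (κ : ℕ) (x : Fin (κ - 1) → State) : gap κ x = max (1 - ageSum κ x κ) 0 := by
  rw [gap, ageSum_self]

lemma gap_nonneg (κ : ℕ) (x : Fin (κ - 1) → State) : 0 ≤ gap κ x := le_max_right _ _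

open Classical in
/-- The number of busy channels at time `s` after an admission, if the time lags between the
latest `κ` admissions are given by `x`. -/
def busyNum (κ : ℕ) (x : Fin (κ - 1) → State) (s : ℝ) : ℕ :=
  ((Finset.Icc 1 κ).filter fun m => s + ageSum κ x m < 1).card

lemma busyNum_le (κ : ℕ) (x : Fin (κ - 1) → State) (s : ℝ) : busyNum κ x s ≤ κ := by
  classical
  exact (Finset.card_filter_le _ _).trans (by simp)

lemma busyNum_eq_zero (κ : ℕ) (x : Fin (κ - 1) → State) {s : ℝ} (hs : 1 ≤ s) :
    busyNum κ x s = 0 := by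
  rw [busyNum, Finset.card_eq_zero, Finset.filter_eq_empty_iff]
  intro m _
  linarith [ageSum_nonneg κ x m]

lemma measurable_busyNum (κ : ℕ) :
    Measurable fun p : (Fin (κ - 1) → State) × ℝ => busyNum κ p.1 p.2 := by
  simp only [busyNum, Finset.card_filter]
  refine Finset.measurable_sum _ fun m _ => Measurable.ite ?_ measurable_const measurable_const
  exact measurableSet_lt (measurable_snd.add ((measurable_ageSum κ m).comp measurable_fst))
    measurable_const

/-- Ages increase with m, so all κ messages are present iff the oldest is, i.e. iff s plus the sum
of all lags is below 1. As s ≥ 0, the positive part in `gap` makes no difference. -/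
lemma busyNum_lt_iff {κ : ℕ} (hκ : 1 ≤ κ) (x : Fin (κ - 1) → State) {s : ℝ} (hs : 0 ≤ s) :
    busyNum κ x s < κ ↔ gap κ x ≤ s := by
  classical
  have h1 : gap κ x ≤ s ↔ ¬ s + ageSum κ x κ < 1 := by
    rw [gap_eq, max_le_iff, and_iff_left hs, not_lt]
    constructor <;> intro h <;> linarith
  rw [h1]
  constructor
  · intro h h2
    refine h.ne ?_
    have : (Finset.Icc 1 κ).filter (fun m => s + ageSum κ x m < 1) = Finset.Icc 1 κ := by
      refine Finset.filter_true_of_mem fun m hm => ?_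
      linarith [ageSum_mono κ x (Finset.mem_Icc.1 hm).2]
    rw [busyNum, this]
    simp
  · intro h
    have : (Finset.Icc 1 κ).filter (fun m => s + ageSum κ x m < 1) ⊂ Finset.Icc 1 κ :=
      Finset.filter_ssubset.2 ⟨κ, Finset.mem_Icc.2 ⟨hκ, le_rfl⟩, h⟩
    simpa [busyNum] using Finset.card_lt_card this

/-- The times after an admission at which a channel is released. -/
def releaseTimes (κ : ℕ) (x : Fin (κ - 1) → State) : Set ℝ :=
  (fun m => 1 - ageSum κ x m) '' (Finset.Icc 1 κ : Set ℕ)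

lemma finite_releaseTimes (κ : ℕ) (x : Fin (κ - 1) → State) : (releaseTimes κ x).Finite :=
  (Finset.finite_toSet _).image _

/-- The two counts differ by ≤ against <, which matters only at the finitely many release instants,
a null set. -/
lemma busyCount_eq {κ : ℕ} {x : Fin (κ - 1) → State} {s : ℝ} (hg : gap κ x ≤ s)
    (hs : s ∉ releaseTimes κ x) : busyCount κ x s = busyNum κ x s := by
  classical
  rw [busyCount, if_pos hg, busyNum, card_filter_Icc_eq_sup]
  · refine Finset.sup_congr rfl fun m hm => ?_
    have h1 : 1 - ageSum κ x m ≠ s := fun h => hs ⟨m, hm, h⟩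
    have h2 : s + ageSum κ x m ≤ 1 ↔ s + ageSum κ x m < 1 :=
      ⟨fun h => lt_of_le_of_ne h fun h => h1 (by linarith), le_of_lt⟩
    simp only [← h2]
    rfl
  · intro m n hmn h
    linarith [ageSum_mono κ x hmn]

open Classical in
/-- The probability that an arrival at time `s` after an admission is rejected under CSMA. -/
def csmaBlock (κ : ℕ) (x : Fin (κ - 1) → State) (s : ℝ) : ℝ := if busyNum κ x s < κ then 0 else 1

/-- The probability that an arrival at time `s` after an admission is rejected under ALOHA. -/
def alohaBlock (κ : ℕ) (x : Fin (κ - 1) → State) (s : ℝ) : ℝ := busyNum κ x s / κ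

lemma integral_ite_lt {g s : ℝ} (h0 : 0 ≤ g) (hs : g ≤ s) :
    ∫ r in (0 : ℝ)..s, (if r < g then (1 : ℝ) else 0) = g := by
  rw [intervalIntegral.integral_of_le (h0.trans hs), integral_Ioc_eq_integral_Ioo]
  have : (fun r : ℝ => if r < g then (1 : ℝ) else 0) = (Iio g).indicator 1 := by
    funext r; simp [indicator_apply]
  rw [this, setIntegral_indicator measurableSet_Iio]
  have h : Ioo 0 s ∩ Iio g = Ioo 0 g := by
    ext r
    simp only [mem_inter_iff, mem_Ioo, mem_Iio]
    constructor
    · rintro ⟨⟨h1, h2⟩, h3⟩; exact ⟨h1, h3⟩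
    · rintro ⟨h1, h2⟩; exact ⟨⟨h1, by linarith⟩, h2⟩
  rw [h]
  simp [h0]

/-- Lebesgue measure on the time lags. -/
def lagMeasure : Measure (Ioi (0 : ℝ)) := (volume : Measure ℝ).comap Subtype.val

instance : SFinite lagMeasure :=
  inferInstanceAs (SFinite ((volume : Measure ℝ).comap (Subtype.val : Ioi (0 : ℝ) → ℝ)))

lemma lintegral_lagMeasure (f : ℝ → ℝ≥0∞) :
    ∫⁻ s : Ioi (0 : ℝ), f s ∂lagMeasure = ∫⁻ s in Ioi (0 : ℝ), f s :=
  lintegral_subtype_comap measurableSet_Ioi f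

lemma ae_refMeasure_notMem {S : Set ℝ} (hS : S.Finite) : ∀ᵐ y ∂refMeasure, (y.2 : ℝ) ∉ S := by
  have h : lagMeasure (Subtype.val ⁻¹' S) = 0 := by
    rw [lagMeasure, (MeasurableEmbedding.subtype_coe measurableSet_Ioi).comap_apply]
    exact (hS.subset (image_preimage_subset _ _)).measure_zero _
  have h2 : refMeasure (univ ×ˢ (Subtype.val ⁻¹' S)) = 0 := by
    rw [refMeasure, Measure.prod_prod]
    exact mul_eq_zero_of_right _ h
  rw [ae_iff]
  convert h2 using 2
  ext y
  simp

lemma lintegral_refMeasure {f : State → ℝ≥0∞} (hf : Measurable f) :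
    ∫⁻ y, f y ∂refMeasure = ∫⁻ s, ∑' k : ℕ, f (⟨k + 1, by omega⟩, s) ∂lagMeasure := by
  have h : ∫⁻ y, f y ∂refMeasure = ∫⁻ s, ∫⁻ k, f (k, s) ∂Measure.count ∂lagMeasure := by
    rw [refMeasure, lintegral_prod_symm' _ hf]
    rfl
  rw [h]
  refine lintegral_congr fun s => ?_
  rw [lintegral_count]
  let e : ℕ ≃ PosNat :=
    ⟨fun k => ⟨k + 1, by omega⟩, fun k => k.1 - 1, fun k => by simp,
      fun k => Subtype.ext (by have := k.2; simp only; omega)⟩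
  exact (e.tsum_eq fun k => f (k, s)).symm

/-- The kernel `W` is the law of the number of attempts and the time until the next admission, if
an arrival at time `s` after an admission is rejected with probability `b x s`. -/
structure IsBlocking (lam : ℝ) {n : ℕ} (b : (Fin n → State) → ℝ → ℝ)
    (W : Kernel (Fin n → State) State) : Prop where
  measurable : Measurable (Function.uncurry b)
  mem_Icc : ∀ x s, b x s ∈ Icc (0 : ℝ) 1
  eq_zero : ∀ x s, 1 ≤ s → b x s = 0
  congr_lag : ∀ x x' : Fin n → State, (∀ i, (x i).2 = (x' i).2) → b x = b x'
  withDensity : ∀ x, W x = refMeasure.withDensity fun y =>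
    ENNReal.ofReal (1 - b x y.2) * stageDensity lam (b x) (y.1 - 1) y.2

namespace IsBlocking

variable {lam : ℝ} {n : ℕ} {b : (Fin n → State) → ℝ → ℝ} {W : Kernel (Fin n → State) State}

lemma measurable_right (hW : IsBlocking lam b W) (x : Fin n → State) : Measurable (b x) :=
  hW.measurable.comp measurable_prodMk_left

lemma measurable_density (hW : IsBlocking lam b W) (x : Fin n → State) :
    Measurable fun y : State =>
      ENNReal.ofReal (1 - b x y.2) * stageDensity lam (b x) (y.1 - 1) y.2 := by
  have hb := hW.measurable_right x
  have h : ∀ k : PosNat, Measurable fun s : Ioi (0 : ℝ) =>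
      ENNReal.ofReal (1 - b x s) * stageDensity lam (b x) (k - 1) s := fun k =>
    ((hb.const_sub 1).ennreal_ofReal.mul
      (measurable_stageDensity hb (hW.mem_Icc x) lam _)).comp measurable_subtype_coe
  exact measurable_from_prod_countable_right h

lemma lintegral_eq (hW : IsBlocking lam b W) (x : Fin n → State) {f : State → ℝ≥0∞}
    (hf : Measurable f) :
    ∫⁻ y, f y ∂(W x) = ∫⁻ s, ENNReal.ofReal (1 - b x s) *
      ∑' k : ℕ, stageDensity lam (b x) k s * f (⟨k + 1, by omega⟩, s) ∂lagMeasure := by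
  rw [hW.withDensity, lintegral_withDensity_eq_lintegral_mul _ (hW.measurable_density x) hf,
    lintegral_refMeasure ((hW.measurable_density x).mul hf)]
  refine lintegral_congr fun s => ?_
  rw [← ENNReal.tsum_mul_left]
  refine tsum_congr fun k => ?_
  simp [mul_assoc]

lemma isMarkovKernel (hW : IsBlocking lam b W) (hlam : 0 < lam) : IsMarkovKernel W := by
  refine ⟨fun x => ⟨?_⟩⟩
  have h := hW.lintegral_eq x (f := 1) measurable_one
  simp only [Pi.one_apply, lintegral_const, one_mul, mul_one] at h
  rw [h, lintegral_lagMeasure fun s => ENNReal.ofReal (1 - b x s) *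
      ∑' k : ℕ, stageDensity lam (b x) k s]
  exact lintegral_tsum_stageDensity (hW.measurable_right x) (hW.mem_Icc x) (hW.eq_zero x) hlam

end IsBlocking

/-- An admission at the k-th attempt is preceded by k - 1 rejections, hence the stage k - 1. -/
lemma stageDensity_eq {lam : ℝ} (b : ℝ → ℝ) {k : ℕ} (hk : 1 ≤ k) {s c : ℝ} (hc : 0 ≤ c) :
    ENNReal.ofReal c * stageDensity lam b (k - 1) s
      = ENNReal.ofReal ((∫ r in (0 : ℝ)..s, b r) ^ (k - 1) / (k - 1).factorial
        * c * lam ^ k * Real.exp (-lam * s)) := by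
  rw [stageDensity, ← ENNReal.ofReal_mul hc, Nat.sub_add_cancel hk]
  congr 1
  ring

lemma measurable_csmaBlock (κ : ℕ) : Measurable (Function.uncurry (csmaBlock κ)) :=
  Measurable.ite (measurableSet_lt (measurable_busyNum κ) measurable_const) measurable_const
    measurable_const

lemma measurable_alohaBlock (κ : ℕ) : Measurable (Function.uncurry (alohaBlock κ)) :=
  ((measurable_of_countable fun k : ℕ => (k : ℝ)).comp (measurable_busyNum κ)).div_const _

lemma csmaBlock_mem_Icc (κ : ℕ) (x : Fin (κ - 1) → State) (s : ℝ) :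
    csmaBlock κ x s ∈ Icc (0 : ℝ) 1 := by
  unfold csmaBlock; split_ifs <;> simp

lemma alohaBlock_mem_Icc (κ : ℕ) (x : Fin (κ - 1) → State) (s : ℝ) :
    alohaBlock κ x s ∈ Icc (0 : ℝ) 1 :=
  ⟨by unfold alohaBlock; positivity,
    div_le_one_of_le₀ (by exact_mod_cast busyNum_le κ x s) (by positivity)⟩

lemma busyNum_congr_lag {κ : ℕ} {x x' : Fin (κ - 1) → State} (h : ∀ i, (x i).2 = (x' i).2) :
    busyNum κ x = busyNum κ x' := by
  have : recentLag κ x = recentLag κ x' := by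
    funext j
    unfold recentLag
    split_ifs
    · rw [h]
    · rfl
  have h2 : ageSum κ x = ageSum κ x' := by
    funext m
    rw [ageSum, ageSum, this]
  funext s
  rw [busyNum, busyNum, h2]

lemma csmaBlock_eq_ite {κ : ℕ} (hκ : 1 ≤ κ) (x : Fin (κ - 1) → State) {s : ℝ} (hs : 0 ≤ s) :
    csmaBlock κ x s = if s < gap κ x then 1 else 0 := by
  unfold csmaBlock
  simp only [busyNum_lt_iff hκ x hs]
  split_ifs <;> first | rfl | linarith

/-- The rejection probability is the indicator of s < γ. For s ≥ γ its primitive equals γ and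
acceptance is certain; for s < γ both densities vanish. -/
lemma isBlocking_csma {κ : ℕ} (hκ : 1 ≤ κ) (lam : ℝ) :
    IsBlocking lam (csmaBlock κ) (csmaKernel κ lam) where
  measurable := measurable_csmaBlock κ
  mem_Icc := csmaBlock_mem_Icc κ
  eq_zero x s hs := by
    rw [csmaBlock, busyNum_eq_zero κ x hs, if_pos (by omega)]
  congr_lag x x' h := by
    funext s
    simp only [csmaBlock, busyNum_congr_lag h]
  withDensity x := by
    rw [csmaKernel_apply]
    congr 1
    funext y
    have hs := y.2.2.out.le
    have hg := gap_nonneg κ x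
    rw [stageDensity_eq _ y.1.2 (sub_nonneg.2 (csmaBlock_mem_Icc κ x _).2), csmaDensity,
      csmaBlock_eq_ite hκ x hs]
    congr 1
    by_cases h : gap κ x ≤ y.2
    · have : ∫ r in (0 : ℝ)..y.2, csmaBlock κ x r = gap κ x := by
        rw [← integral_ite_lt hg h]
        refine intervalIntegral.integral_congr fun r hr => csmaBlock_eq_ite hκ x ?_
        rw [uIcc_of_le hs] at hr
        exact hr.1
      rw [this, if_pos h, if_neg (not_lt.2 h)]
      ring
    · rw [if_neg h, if_pos (not_le.1 h)]
      ring

lemma alohaBlock_eq_of_gap_le {κ : ℕ} {x : Fin (κ - 1) → State} {s : ℝ} (hg : gap κ x ≤ s)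
    (hs : s ∉ releaseTimes κ x) : alohaBlock κ x s = busyCount κ x s / κ := by
  rw [busyCount_eq hg hs, alohaBlock]

lemma alohaBlock_of_lt_gap {κ : ℕ} (hκ : 1 ≤ κ) {x : Fin (κ - 1) → State} {s : ℝ} (hs : 0 ≤ s)
    (hg : s < gap κ x) : alohaBlock κ x s = 1 := by
  have h := (busyNum_lt_iff hκ x hs).not.2 (not_le.2 hg)
  have : busyNum κ x s = κ := le_antisymm (busyNum_le κ x s) (not_lt.1 h)
  rw [alohaBlock, this, div_self]
  positivity

/-- Before γ every channel is busy, which contributes γ. From γ on the rejection probability is β/κ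
off the release times. As β vanishes below γ, the two parts can be added over all of [0, s]. -/
lemma integral_alohaBlock {κ : ℕ} (hκ : 1 ≤ κ) {x : Fin (κ - 1) → State} {s : ℝ}
    (hg : gap κ x ≤ s) :
    ∫ r in (0 : ℝ)..s, alohaBlock κ x r = gap κ x + busyIntegral κ x s / κ := by
  have h0 := gap_nonneg κ x
  have hm := ((measurable_busyCount κ).comp (measurable_prodMk_left (x := x)))
  have hm' : Measurable fun r => (busyCount κ x r : ℝ) :=
    (measurable_of_countable fun k : ℕ => (k : ℝ)).comp hm
  have hle : ∀ r, busyCount κ x r ≤ κ := by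
    intro r
    unfold busyCount
    split_ifs
    · refine Finset.sup_le fun m hm => ?_
      split_ifs
      · exact (Finset.mem_Icc.1 hm).2
      · omega
    · omega
  rw [busyIntegral, ← intervalIntegral.integral_div]
  conv_rhs => rw [← integral_ite_lt h0 hg]
  rw [← intervalIntegral.integral_add]
  · refine intervalIntegral.integral_congr_ae ?_
    have := (finite_releaseTimes κ x).countable.ae_notMem volume
    filter_upwards [this] with r hr hr0
    rw [uIoc_of_le (h0.trans hg)] at hr0
    split_ifs with h
    · rw [alohaBlock_of_lt_gap hκ hr0.1.le h, busyCount, if_neg (not_le.2 h)]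
      simp
    · rw [alohaBlock_eq_of_gap_le (not_lt.1 h) hr, zero_add]
  · refine intervalIntegrable_of_mem_unit ?_ (fun r => ?_) _ _
    · exact Measurable.ite measurableSet_Iio measurable_const measurable_const
    · split_ifs <;> simp
  · refine intervalIntegrable_of_mem_unit (hm'.div_const _) (fun r => ⟨by positivity, ?_⟩) _ _
    exact div_le_one_of_le₀ (by exact_mod_cast hle r) (by positivity)

lemma isBlocking_aloha {κ : ℕ} (hκ : 1 ≤ κ) (lam : ℝ) :
    IsBlocking lam (alohaBlock κ) (alohaKernel κ lam) where
  measurable := measurable_alohaBlock κ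
  mem_Icc := alohaBlock_mem_Icc κ
  eq_zero x s hs := by
    rw [alohaBlock, busyNum_eq_zero κ x hs, Nat.cast_zero, zero_div]
  congr_lag x x' h := by
    funext s
    simp only [alohaBlock, busyNum_congr_lag h]
  withDensity x := by
    rw [alohaKernel_apply]
    refine withDensity_congr_ae ?_
    -- The densities need not agree when the lag is a release time, so the kernels are compared
    -- through a.e. equality.
    filter_upwards [ae_refMeasure_notMem (finite_releaseTimes κ x)] with y hy
    have hs := y.2.2.out.le
    rw [stageDensity_eq _ y.1.2 (sub_nonneg.2 (alohaBlock_mem_Icc κ x _).2), alohaDensity]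
    congr 1
    by_cases h : gap κ x ≤ y.2
    · rw [if_pos h, integral_alohaBlock hκ h, alohaBlock_eq_of_gap_le h hy]
      ring
    · rw [if_neg h, alohaBlock_of_lt_gap hκ hs (not_le.1 h)]
      ring

/-! ### Condition (U) -/

lemma shiftAppend_apply {S : Type*} {n : ℕ} (p : (Fin n → S) × S) (i : Fin n) :
    shiftAppend n p i = if h : (i : ℕ) + 1 < n then p.1 ⟨i + 1, h⟩ else p.2 := by
  unfold shiftAppend Fin.tail
  split_ifs with h
  · have : i.succ = Fin.castSucc ⟨i + 1, h⟩ := rfl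
    rw [this, Fin.snoc_castSucc]
  · have : i.succ = Fin.last n := Fin.ext (by have := i.2; simp only [Fin.val_succ, Fin.val_last]; omega)
    rw [this, Fin.snoc_last]

/-- The transition operator of the vector chain with kernel `W`. -/
def stepOp {S : Type*} [MeasurableSpace S] {n : ℕ} (W : Kernel (Fin n → S) S)
    (f : (Fin n → S) → ℝ≥0∞) (z : Fin n → S) : ℝ≥0∞ :=
  ∫⁻ y, f (shiftAppend n (z, y)) ∂(W z)

section StepOp

variable {S : Type*} [MeasurableSpace S] {n : ℕ} {W : Kernel (Fin n → S) S}

lemma measurable_stepOp [IsSFiniteKernel W] {f : (Fin n → S) → ℝ≥0∞} (hf : Measurable f) :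
    Measurable (stepOp W f) :=
  Measurable.lintegral_kernel_prod_right (κ := W) (hf.comp (measurable_shiftAppend n))

lemma measurable_iterate_stepOp [IsSFiniteKernel W] {f : (Fin n → S) → ℝ≥0∞} (hf : Measurable f)
    (k : ℕ) : Measurable ((stepOp W)^[k] f) := by
  induction k with
  | zero => exact hf
  | succ k ih =>
    rw [Function.iterate_succ_apply']
    exact measurable_stepOp ih

lemma stepOp_mono {f g : (Fin n → S) → ℝ≥0∞} (h : f ≤ g) : stepOp W f ≤ stepOp W g :=
  fun _ => lintegral_mono fun _ => h _

lemma iterate_stepOp_mono {f g : (Fin n → S) → ℝ≥0∞} (h : f ≤ g) (k : ℕ) :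
    (stepOp W)^[k] f ≤ (stepOp W)^[k] g := by
  induction k with
  | zero => exact h
  | succ k ih =>
    rw [Function.iterate_succ_apply', Function.iterate_succ_apply']
    exact stepOp_mono ih

lemma stepOp_const_mul {c : ℝ≥0∞} (hc : c ≠ ∞) (f : (Fin n → S) → ℝ≥0∞) :
    stepOp W (fun z => c * f z) = fun z => c * stepOp W f z :=
  funext fun _ => lintegral_const_mul' _ _ hc

/-- Superadditivity of the lower integral gives this inequality for every c and f, with no
finiteness or measurability to check. -/
lemma const_mul_iterate_stepOp_le (c : ℝ≥0∞) (f : (Fin n → S) → ℝ≥0∞) (k : ℕ) (z : Fin n → S) :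
    c * (stepOp W)^[k] f z ≤ (stepOp W)^[k] (fun z => c * f z) z := by
  induction k generalizing z with
  | zero => exact le_rfl
  | succ k ih =>
    rw [Function.iterate_succ_apply', Function.iterate_succ_apply']
    exact (lintegral_const_mul_le _ _).trans (stepOp_mono ih z)

/-- Passes from powers of the kernel to iterates of an operator on functions, where Condition (U)
becomes a pair of pointwise estimates. The outermost application of the operator is the first step
of the chain. -/
lemma vectorKernel_pow_apply [IsSFiniteKernel W] (k : ℕ) (z : Fin n → S) {B : Set (Fin n → S)}
    (hB : MeasurableSet B) :
    (vectorKernel W ^ k) z B = (stepOp W)^[k] (B.indicator 1) z := by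
  induction k generalizing z with
  | zero =>
    rw [pow_zero, Function.iterate_zero, id]
    exact Measure.dirac_apply' z hB
  | succ k ih =>
    rw [add_comm k 1, Kernel.pow_add_apply_eq_lintegral _ _ _ _ hB, pow_one, add_comm 1 k,
      Function.iterate_succ_apply', stepOp]
    simp_rw [ih]
    have hm := measurable_iterate_stepOp (W := W) (measurable_one.indicator hB) k
    rw [vectorKernel, Kernel.lintegral_map _ (measurable_shiftAppend n) _ hm,
      Kernel.lintegral_id_prod (f := fun p => (stepOp W)^[k] (B.indicator 1) (shiftAppend n p))
        (hm.comp (measurable_shiftAppend n))]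

end StepOp

/-- `f` depends only on the time lags and on the numbers of attempts in the coordinates from `k`
on. -/
def LagDependent {n : ℕ} (k : ℕ) (f : (Fin n → State) → ℝ≥0∞) : Prop :=
  ∀ z z' : Fin n → State, (∀ i, (z i).2 = (z' i).2) → (∀ i : Fin n, k ≤ (i : ℕ) → z i = z' i) → f z = f z'

section LagDependent

variable {n : ℕ} {W : Kernel (Fin n → State) State}

lemma lagDependent_zero (f : (Fin n → State) → ℝ≥0∞) : LagDependent 0 f :=
  fun _ _ _ h => congrArg f (funext fun i => h i (Nat.zero_le _))

/-- A step moves coordinate i + 1 to place i, so a further attempt number drops out of view, while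
the law of the new entry involves lags only. After n steps no attempt number of the starting vector
matters. -/
lemma LagDependent.stepOp (hW : ∀ z z' : Fin n → State, (∀ i, (z i).2 = (z' i).2) → W z = W z')
    {k : ℕ} {f : (Fin n → State) → ℝ≥0∞} (hf : LagDependent k f) :
    LagDependent (k + 1) (stepOp W f) := by
  intro z z' h1 h2
  rw [MultiChannel.stepOp, MultiChannel.stepOp, hW z z' h1]
  refine lintegral_congr fun y => hf _ _ (fun i => ?_) fun i hi => ?_
  · simp only [shiftAppend_apply]
    split_ifs
    · exact h1 _
    · rfl
  · simp only [shiftAppend_apply]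
    split_ifs
    · exact h2 _ (Nat.succ_le_succ hi)
    · rfl

lemma LagDependent.iterate (hW : ∀ z z' : Fin n → State, (∀ i, (z i).2 = (z' i).2) → W z = W z')
    {k : ℕ} {f : (Fin n → State) → ℝ≥0∞} (hf : LagDependent k f) (j : ℕ) :
    LagDependent (k + j) ((MultiChannel.stepOp W)^[j] f) := by
  induction j with
  | zero => exact hf
  | succ j ih =>
    rw [Function.iterate_succ_apply']
    exact ih.stepOp hW

lemma LagDependent.congr_lag {k : ℕ} {f : (Fin n → State) → ℝ≥0∞} (hf : LagDependent k f)
    (hk : n ≤ k) {z z' : Fin n → State} (h : ∀ i, (z i).2 = (z' i).2) : f z = f z' :=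
  hf z z' h fun i hi => absurd i.2 (by omega)

/-- New entries ignore the current vector and old ones are shifted out; for k = n the value does not
depend on the start at all. -/
lemma iterate_stepOp_const_congr (π : Measure State) (f : (Fin n → State) → ℝ≥0∞) (k : ℕ)
    {z z' : Fin n → State} (h : ∀ i : Fin n, k ≤ (i : ℕ) → z i = z' i) :
    (MultiChannel.stepOp (Kernel.const _ π))^[k] f z
      = (MultiChannel.stepOp (Kernel.const _ π))^[k] f z' := by
  induction k generalizing z z' with
  | zero => exact congrArg f (funext fun i => h i (Nat.zero_le _))
  | succ k ih =>
    rw [Function.iterate_succ_apply', MultiChannel.stepOp, MultiChannel.stepOp,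
      Kernel.const_apply, Kernel.const_apply]
    refine lintegral_congr fun y => ih fun i hi => ?_
    simp only [shiftAppend_apply]
    split_ifs
    · exact h _ (Nat.succ_le_succ hi)
    · rfl

end LagDependent

/-- The exponential distribution, as a measure on the time lags. -/
def expLag (lam : ℝ) : Measure (Ioi (0 : ℝ)) :=
  lagMeasure.withDensity fun s => ENNReal.ofReal (lam * Real.exp (-lam * s))

/-- The law of a state with a single attempt and an exponentially distributed time lag. -/
def expState (lam : ℝ) : Measure State := (expLag lam).map fun s => (⟨1, le_rfl⟩, s)

instance (lam : ℝ) : SFinite (expLag lam) := by unfold expLag; infer_instance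

instance (lam : ℝ) : SFinite (expState lam) := by unfold expState; infer_instance

lemma lintegral_expLag (lam : ℝ) {ψ : Ioi (0 : ℝ) → ℝ≥0∞} (hψ : Measurable ψ) :
    ∫⁻ s, ψ s ∂expLag lam
      = ∫⁻ s, ENNReal.ofReal (lam * Real.exp (-lam * s)) * ψ s ∂lagMeasure := by
  rw [expLag, lintegral_withDensity_eq_lintegral_mul _ (by fun_prop) hψ]
  rfl

lemma lintegral_expState (lam : ℝ) {f : State → ℝ≥0∞} (hf : Measurable f) :
    ∫⁻ y, f y ∂expState lam = ∫⁻ s, f (⟨1, le_rfl⟩, s) ∂expLag lam :=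
  lintegral_map hf (by fun_prop)

lemma primitive_le_one {b : ℝ → ℝ} (hb : Measurable b) (h : ∀ s, b s ∈ Icc (0 : ℝ) 1)
    (h1 : ∀ s, 1 ≤ s → b s = 0) {s : ℝ} (hs : 0 ≤ s) : ∫ r in (0 : ℝ)..s, b r ≤ 1 := by
  have hle : ∀ u : ℝ, 0 ≤ u → u ≤ 1 → ∫ r in (0 : ℝ)..u, b r ≤ 1 := by
    intro u h0 hu
    have := intervalIntegral.integral_mono_on h0 (intervalIntegrable_of_mem_unit hb h _ _)
      (intervalIntegrable_const (c := (1 : ℝ))) fun r _ => (h r).2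
    simp at this
    linarith
  rcases le_total s 1 with h2 | h2
  · exact hle s hs h2
  · rw [← intervalIntegral.integral_add_adjacent_intervals (b := 1)
      (intervalIntegrable_of_mem_unit hb h _ _) (intervalIntegrable_of_mem_unit hb h _ _),
      intervalIntegral.integral_congr (a := 1) (b := s) (g := fun _ => 0)]
    · simpa using hle 1 zero_le_one le_rfl
    · intro r hr
      rw [uIcc_of_le h2] at hr
      exact h1 r hr.1

/-! ### Comparison with independent exponential lags -/

namespace IsBlocking

variable {lam : ℝ} {n : ℕ} {b : (Fin n → State) → ℝ → ℝ} {W : Kernel (Fin n → State) State}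

lemma kernel_congr_lag (hW : IsBlocking lam b W) (z z' : Fin n → State)
    (h : ∀ i, (z i).2 = (z' i).2) : W z = W z' := by
  rw [hW.withDensity, hW.withDensity, hW.congr_lag z z' h]

lemma lintegral_lag (hW : IsBlocking lam b W) (hlam : 0 < lam) (x : Fin n → State)
    {ψ : Ioi (0 : ℝ) → ℝ≥0∞} (hψ : Measurable ψ) :
    ∫⁻ y, ψ y.2 ∂(W x) = ∫⁻ s, ENNReal.ofReal (1 - b x s) * ENNReal.ofReal (lam *
      Real.exp (-lam * (s - ∫ r in (0 : ℝ)..s, b x r))) * ψ s ∂lagMeasure := by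
  rw [hW.lintegral_eq x (f := fun y => ψ y.2) (hψ.comp measurable_snd)]
  refine lintegral_congr fun s => ?_
  simp only
  rw [ENNReal.tsum_mul_right, tsum_stageDensity (hW.mem_Icc x) hlam s.2.out.le, mul_assoc]

/-- The lag has density (1 - b) λ e^(-λ(s - F)), where 1 - b ≤ 1 and F ≤ 1. -/
lemma lintegral_lag_le (hW : IsBlocking lam b W) (hlam : 0 < lam) (x : Fin n → State)
    {ψ : Ioi (0 : ℝ) → ℝ≥0∞} (hψ : Measurable ψ) :
    ∫⁻ y, ψ y.2 ∂(W x) ≤ ENNReal.ofReal (Real.exp lam) * ∫⁻ s, ψ s ∂expLag lam := by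
  rw [hW.lintegral_lag hlam x hψ, lintegral_expLag lam hψ,
    ← lintegral_const_mul' _ _ ENNReal.ofReal_ne_top]
  refine lintegral_mono fun s => ?_
  rw [← mul_assoc, ← ENNReal.ofReal_mul (sub_nonneg.2 (hW.mem_Icc x s).2),
    ← ENNReal.ofReal_mul (by positivity)]
  gcongr ENNReal.ofReal ?_ * _
  have h1 := primitive_le_one (hW.measurable_right x) (hW.mem_Icc x) (hW.eq_zero x) s.2.out.le
  have h2 := (hW.mem_Icc x s).1
  calc _ ≤ 1 * (lam * Real.exp (-lam * (s - ∫ r in (0 : ℝ)..s, b x r))) := by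
        gcongr; linarith
    _ ≤ 1 * (lam * Real.exp (lam + -lam * s)) := by
        gcongr; nlinarith
    _ = _ := by rw [Real.exp_add]; ring

/-- Here F ≥ 0 is used. The lower bound on 1 - b is demanded only on the support of ψ, which serves
two cases: ψ supported on lags of at least 1, where b vanishes, and arbitrary ψ after a vector
containing such a lag. -/
lemma le_lintegral_lag (hW : IsBlocking lam b W) (hlam : 0 < lam) {c : ℝ}
    (x : Fin n → State) {ψ : Ioi (0 : ℝ) → ℝ≥0∞} (hψ : Measurable ψ)
    (hc : ∀ s, ψ s ≠ 0 → c ≤ 1 - b x s) :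
    ENNReal.ofReal c * ∫⁻ s, ψ s ∂expLag lam ≤ ∫⁻ y, ψ y.2 ∂(W x) := by
  rw [hW.lintegral_lag hlam x hψ, lintegral_expLag lam hψ,
    ← lintegral_const_mul' _ _ ENNReal.ofReal_ne_top]
  refine lintegral_mono fun s => ?_
  by_cases h0 : ψ s = 0
  · simp [h0]
  simp only
  rw [← mul_assoc]
  gcongr ?_ * ENNReal.ofReal ?_ * _
  · exact ENNReal.ofReal_le_ofReal (hc s h0)
  · have := primitive_nonneg (hW.mem_Icc x) s.2.out.le
    gcongr lam * Real.exp ?_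
    nlinarith

/-- The set of vectors of states whose last `k` time lags are at least `1`. -/
def bigTail (n k : ℕ) : Set (Fin n → State) :=
  {z | ∀ i : Fin n, n ≤ (i : ℕ) + k → 1 ≤ ((z i).2 : ℝ)}

/-- As f sees lags only, the attempt number of a new entry may be replaced by 1; then only the law
of the lag counts, and each step costs a factor e^λ. -/
lemma iterate_le (hW : IsBlocking lam b W) (hlam : 0 < lam) {f : (Fin n → State) → ℝ≥0∞}
    (hf : Measurable f) (hlag : LagDependent n f) (k : ℕ) (z : Fin n → State) :
    (stepOp W)^[k] f z ≤ ENNReal.ofReal (Real.exp lam) ^ k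
      * (stepOp (Kernel.const _ (expState lam)))^[k] f z := by
  induction k generalizing z with
  | zero => simp
  | succ k ih =>
    set g := (stepOp (Kernel.const _ (expState lam)))^[k] f with hg
    have hgm : Measurable g := measurable_iterate_stepOp hf k
    have hgl : LagDependent (n + k) g := hlag.iterate (fun _ _ _ => rfl) k
    rw [Function.iterate_succ_apply', Function.iterate_succ_apply']
    have hψ : Measurable fun s => g (shiftAppend n (z, (⟨1, le_rfl⟩, s))) :=
      hgm.comp ((measurable_shiftAppend n).comp (by fun_prop))
    calc stepOp W ((stepOp W)^[k] f) z
        ≤ stepOp W (fun z => ENNReal.ofReal (Real.exp lam) ^ k * g z) z := stepOp_mono ih z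
      _ = ENNReal.ofReal (Real.exp lam) ^ k * stepOp W g z := by
          rw [stepOp_const_mul (by finiteness)]
      _ = ENNReal.ofReal (Real.exp lam) ^ k
            * ∫⁻ y, g (shiftAppend n (z, (⟨1, le_rfl⟩, y.2))) ∂(W z) := by
          congr 1
          refine lintegral_congr fun y => hgl.congr_lag (by omega) fun i => ?_
          simp only [shiftAppend_apply]
          split_ifs <;> rfl
      _ ≤ ENNReal.ofReal (Real.exp lam) ^ k * (ENNReal.ofReal (Real.exp lam)
            * ∫⁻ s, g (shiftAppend n (z, (⟨1, le_rfl⟩, s))) ∂expLag lam) := by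
          gcongr
          exact hW.lintegral_lag_le hlam z hψ
      _ = _ := by
          rw [pow_succ, mul_assoc, stepOp, Kernel.const_apply,
            lintegral_expState lam (f := fun y => g (shiftAppend n (z, y)))
              (hgm.comp ((measurable_shiftAppend n).comp (by fun_prop)))]

/-- The first k coordinates of z reach the front one after the other, so at each of the k steps the
oldest lag in memory is at least 1 and the bound c is available. -/
lemma le_iterate (hW : IsBlocking lam b W) (hlam : 0 < lam) {c : ℝ}
    (hc : ∀ (x : Fin n → State) (s : ℝ), 0 < s → (∃ i, 1 ≤ ((x i).2 : ℝ)) → c ≤ 1 - b x s)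
    {f : (Fin n → State) → ℝ≥0∞} (hf : Measurable f) (hlag : LagDependent n f) (k : ℕ)
    (hk : k ≤ n) (z : Fin n → State) (hz : ∀ i : Fin n, (i : ℕ) < k → 1 ≤ ((z i).2 : ℝ)) :
    ENNReal.ofReal c ^ k * (stepOp (Kernel.const _ (expState lam)))^[k] f z
      ≤ (stepOp W)^[k] f z := by
  induction k generalizing z with
  | zero => simp
  | succ k ih =>
    set g := (stepOp (Kernel.const _ (expState lam)))^[k] f with hg
    have hgm : Measurable g := measurable_iterate_stepOp hf k
    have hgl : LagDependent (n + k) g := hlag.iterate (fun _ _ _ => rfl) k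
    rw [Function.iterate_succ_apply', Function.iterate_succ_apply']
    have hψ : Measurable fun s => g (shiftAppend n (z, (⟨1, le_rfl⟩, s))) :=
      hgm.comp ((measurable_shiftAppend n).comp (by fun_prop))
    calc ENNReal.ofReal c ^ (k + 1) * stepOp (Kernel.const _ (expState lam)) g z
        = ENNReal.ofReal c ^ k * (ENNReal.ofReal c
            * ∫⁻ s, g (shiftAppend n (z, (⟨1, le_rfl⟩, s))) ∂expLag lam) := by
          rw [pow_succ, mul_assoc, stepOp, Kernel.const_apply,
            lintegral_expState lam (f := fun y => g (shiftAppend n (z, y)))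
              (hgm.comp ((measurable_shiftAppend n).comp (by fun_prop)))]
      _ ≤ ENNReal.ofReal c ^ k
            * ∫⁻ y, g (shiftAppend n (z, (⟨1, le_rfl⟩, y.2))) ∂(W z) := by
          gcongr
          refine hW.le_lintegral_lag hlam z hψ fun s _ => hc z s s.2 ⟨⟨0, by omega⟩, hz _ ?_⟩
          simp
      _ = ENNReal.ofReal c ^ k * stepOp W g z := by
          congr 1
          refine lintegral_congr fun y => hgl.congr_lag (by omega) fun i => ?_
          simp only [shiftAppend_apply]
          split_ifs <;> rfl
      _ = ∫⁻ y, ENNReal.ofReal c ^ k * g (shiftAppend n (z, y)) ∂(W z) :=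
          (lintegral_const_mul' _ _ (by finiteness)).symm
      _ ≤ stepOp W ((stepOp W)^[k] f) z := by
          refine lintegral_mono fun y => ih (by omega) _ fun i hi => ?_
          have : (i : ℕ) + 1 < n := by omega
          rw [shiftAppend_apply, dif_pos this]
          exact hz _ (by simpa using hi)

/-- Since b vanishes from 1 on, lags of at least 1 have at least the exponential density, whatever
the current vector. Each step thus lengthens the tail of big lags by one at the price of a factor q.
-/
lemma le_iterate_bigTail (hW : IsBlocking lam b W) (hlam : 0 < lam) (k : ℕ) (z : Fin n → State) :
    (expLag lam {s | 1 ≤ (s : ℝ)}) ^ k ≤ (stepOp W)^[k] ((bigTail n k).indicator 1) z := by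
  set q := expLag lam {s | 1 ≤ (s : ℝ)} with hq
  induction k generalizing z with
  | zero =>
    have : bigTail n 0 = univ := eq_univ_of_forall fun z i hi => absurd i.2 (by omega)
    simp [this]
  | succ k ih =>
    have hS : MeasurableSet {s : Ioi (0 : ℝ) | 1 ≤ (s : ℝ)} :=
      measurableSet_le measurable_const measurable_subtype_coe
    have key : (fun z => q * (bigTail n k).indicator 1 z)
        ≤ stepOp W ((bigTail n (k + 1)).indicator 1) := by
      intro z
      by_cases hz : z ∈ bigTail n k
      · simp only [indicator_of_mem hz, Pi.one_apply, mul_one]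
        have := hW.le_lintegral_lag hlam (c := 1) z
          (ψ := {s : Ioi (0 : ℝ) | 1 ≤ (s : ℝ)}.indicator 1) (measurable_one.indicator hS) (by
            intro s hs
            have hs' : 1 ≤ (s : ℝ) := by
              by_contra h
              exact hs (indicator_of_notMem (s := {s : Ioi (0 : ℝ) | 1 ≤ (s : ℝ)}) h _)
            rw [hW.eq_zero z s hs', sub_zero])
        rw [ENNReal.ofReal_one, one_mul, lintegral_indicator_one hS] at this
        refine this.trans (lintegral_mono fun y => ?_)
        by_cases hy : 1 ≤ (y.2 : ℝ)
        · have h1 : shiftAppend n (z, y) ∈ bigTail n (k + 1) := by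
            intro i hi
            rw [shiftAppend_apply]
            split_ifs
            · exact hz _ (by simp only; omega)
            · exact hy
          rw [indicator_of_mem h1]
          exact indicator_apply_le fun _ => le_rfl
        · simp [hy]
      · simp [indicator_of_notMem hz]
    -- The last step of the chain is split off: k steps build a tail of length k, and `key` extends
    -- it by one.
    rw [Function.iterate_succ_apply, pow_succ']
    calc q * q ^ k ≤ q * (stepOp W)^[k] ((bigTail n k).indicator 1) z := by gcongr; exact ih z
      _ ≤ _ := (const_mul_iterate_stepOp_le _ _ _ _).trans (iterate_stepOp_mono key k z)

lemma expLag_pos (hlam : 0 < lam) : expLag lam {s | 1 ≤ (s : ℝ)} ≠ 0 := by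
  have hS : MeasurableSet {s : Ioi (0 : ℝ) | 1 ≤ (s : ℝ)} :=
    measurableSet_le measurable_const measurable_subtype_coe
  intro h
  rw [expLag, withDensity_apply_eq_zero (by fun_prop)] at h
  have h2 : {s : Ioi (0 : ℝ) | ENNReal.ofReal (lam * Real.exp (-lam * s)) ≠ 0}
      ∩ {s : Ioi (0 : ℝ) | 1 ≤ (s : ℝ)} = {s : Ioi (0 : ℝ) | 1 ≤ (s : ℝ)} := by
    refine inter_eq_right.2 fun s _ => ?_
    have : 0 < lam * Real.exp (-lam * s) := by positivity
    simpa using this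
  rw [h2, lagMeasure, (MeasurableEmbedding.subtype_coe measurableSet_Ioi).comap_apply] at h
  have h3 : Subtype.val '' {s : Ioi (0 : ℝ) | 1 ≤ (s : ℝ)} = Ici 1 := by
    ext s
    simp only [mem_image, mem_ofPred_eq, Subtype.exists, mem_Ioi, exists_and_left, exists_prop,
      exists_eq_right_right, mem_Ici]
    constructor
    · rintro ⟨h, _⟩; exact h
    · intro h; exact ⟨h, by linarith⟩
  rw [h3] at h
  simp at h

theorem conditionU (hW : IsBlocking lam b W) (hlam : 0 < lam) {c : ℝ} (hc0 : 0 < c)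
    (hc : ∀ (x : Fin n → State) (s : ℝ), 0 < s → (∃ i, 1 ≤ ((x i).2 : ℝ)) → c ≤ 1 - b x s) :
    ConditionU (vectorKernel W) := by
  have := hW.isMarkovKernel hlam
  set q := expLag lam {s | 1 ≤ (s : ℝ)} with hq
  have hq0 : q ≠ 0 := expLag_pos hlam
  -- Finite because `le_iterate_bigTail` bounds q by a transition probability.
  have hqtop : q ≠ ∞ := by
    have h := hW.le_iterate_bigTail hlam 1 fun _ => (⟨1, le_rfl⟩, ⟨1, mem_Ioi.2 zero_lt_one⟩)
    rw [pow_one, Function.iterate_one] at h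
    refine ne_top_of_le_ne_top ENNReal.one_ne_top (h.trans ?_)
    refine (stepOp_mono (g := fun _ => 1) (fun z => ?_) _).trans (by simp [stepOp])
    exact indicator_apply_le fun _ => le_rfl
  set D : ℝ≥0∞ := ENNReal.ofReal (Real.exp lam) ^ n / (ENNReal.ofReal c ^ n * q ^ n) with hD
  have hcq : ENNReal.ofReal c ^ n * q ^ n ≠ 0 := by
    have : ENNReal.ofReal c ≠ 0 := by simpa using hc0
    positivity
  have hcq' : ENNReal.ofReal c ^ n * q ^ n ≠ ∞ := by finiteness
  have hDtop : D ≠ ∞ := ENNReal.div_ne_top (by finiteness) hcq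
  -- Read backwards in time: n steps erase the attempt numbers, n steps are compared with
  -- independent exponential lags, and, for the lower bound only, n steps produce big lags. The
  -- extra step keeps ℓ ≥ 1 when n = 0. In M, the factor N cancels the averaging and the maximum
  -- ensures M ≥ 1.
  set N := 3 * n + 1 with hN
  refine ⟨2 * n + 1, N, by omega, by omega, max 1 (N * D.toReal), le_max_left _ _, fun x y => ?_⟩
  refine Measure.le_iff.2 fun B hB => ?_
  have hNpos : (0 : ℝ) < N := by positivity
  have hDle : D ≤ ENNReal.ofReal (max 1 (N * D.toReal) / N) := by
    refine (ENNReal.le_ofReal_iff_toReal_le hDtop (by positivity)).2 ?_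
    rw [le_div_iff₀ hNpos, mul_comm]
    exact le_max_right _ _
  set f := (stepOp W)^[n] (B.indicator 1) with hf
  have hfm : Measurable f := measurable_iterate_stepOp (measurable_one.indicator hB) n
  have hfl : LagDependent n f := by
    have := (lagDependent_zero (B.indicator 1)).iterate hW.kernel_congr_lag n
    rwa [zero_add] at this
  set K := (stepOp (Kernel.const _ (expState lam)))^[n] f x with hK
  have hKconst : ∀ z, (stepOp (Kernel.const _ (expState lam)))^[n] f z = K := fun z =>
    iterate_stepOp_const_congr _ _ _ fun i hi => absurd i.2 (by omega)
  have hone : ∀ (a : ℝ≥0∞) z, stepOp W (fun _ => a) z = a := fun a z => by simp [stepOp]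
  have hup : (vectorKernel W ^ (2 * n + 1)) x B ≤ ENNReal.ofReal (Real.exp lam) ^ n * K := by
    rw [vectorKernel_pow_apply _ _ hB, show 2 * n + 1 = 1 + n + n by ring,
      Function.iterate_add_apply, Function.iterate_add_apply, Function.iterate_one, 
      ← hone (_ * K) x]
    refine stepOp_mono (fun z => ?_) x
    rw [← hKconst z]
    exact hW.iterate_le hlam hfm hfl n z
  have hlow : ENNReal.ofReal c ^ n * q ^ n * K ≤ (vectorKernel W ^ N) y B := by
    rw [vectorKernel_pow_apply _ _ hB, hN, show 3 * n + 1 = 1 + n + n + n by ring,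
      Function.iterate_add_apply, Function.iterate_add_apply, Function.iterate_add_apply,
      Function.iterate_one, ← hone (_ * K) y]
    refine stepOp_mono (fun z => ?_) y
    calc ENNReal.ofReal c ^ n * q ^ n * K = ENNReal.ofReal c ^ n * K * q ^ n := by ring
      _ ≤ ENNReal.ofReal c ^ n * K * (stepOp W)^[n] ((bigTail n n).indicator 1) z := by
          gcongr
          exact hW.le_iterate_bigTail hlam n z
      _ ≤ _ := const_mul_iterate_stepOp_le _ _ _ _
      _ ≤ (stepOp W)^[n] ((stepOp W)^[n] f) z := by
          refine iterate_stepOp_mono (fun w => ?_) n z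
          by_cases hw : w ∈ bigTail n n
          · rw [indicator_of_mem hw, Pi.one_apply, mul_one, ← hKconst w]
            exact hW.le_iterate hlam hc hfm hfl n le_rfl w fun i _ => hw i (by omega)
          · simp [indicator_of_notMem hw]
  calc (vectorKernel W ^ (2 * n + 1)) x B ≤ ENNReal.ofReal (Real.exp lam) ^ n * K := hup
    _ = D * (ENNReal.ofReal c ^ n * q ^ n * K) := by
        rw [hD, ← mul_assoc, ENNReal.div_mul_cancel hcq hcq']
    _ ≤ D * (vectorKernel W ^ N) y B := by gcongr
    _ ≤ ENNReal.ofReal (max 1 (N * D.toReal) / N) * ∑ i ∈ Finset.Icc 1 N, (vectorKernel W ^ i) y B := by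
        gcongr
        exact Finset.single_le_sum (f := fun i => (vectorKernel W ^ i) y B)
          (fun _ _ => zero_le) (Finset.mem_Icc.2 ⟨by omega, le_rfl⟩)
    _ = _ := by
        simp

end IsBlocking

/-! ### Marked Poisson arrivals -/

lemma lintegral_expMeasure (lam : ℝ) {f : ℝ → ℝ≥0∞} (hf : Measurable f) :
    ∫⁻ t, f t ∂expMeasure lam
      = ∫⁻ t in Ioi (0 : ℝ), f t * ENNReal.ofReal (lam * Real.exp (-lam * t)) := by
  have hm : Measurable (gammaPDF 1 lam) := (measurable_gammaPDFReal 1 lam).ennreal_ofReal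
  rw [expMeasure, gammaMeasure, lintegral_withDensity_eq_lintegral_mul _ hm hf,
    ← setLIntegral_univ, ← Iio_union_Ici (a := (0 : ℝ)),
    lintegral_union measurableSet_Ici (by simp [disjoint_left]),
    setLIntegral_congr Ioi_ae_eq_Ici.symm, setLIntegral_congr_fun (g := 0) measurableSet_Iio]
  · simp only [Pi.zero_apply, lintegral_zero, zero_add]
    refine setLIntegral_congr_fun measurableSet_Ioi fun t ht => ?_
    have h := exponentialPDF_of_nonneg (r := lam) (le_of_lt ht)
    rw [exponentialPDF] at h
    have h2 : gammaPDF 1 lam t = ENNReal.ofReal (lam * Real.exp (-(lam * t))) := h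
    simp only [Pi.mul_apply]
    rw [h2, mul_comm, neg_mul]
  · intro t ht
    simp [gammaPDF_of_neg (mem_Iio.1 ht)]

/-- `ξ` is the sequence of the pairs of an interarrival time and a mark of a Poisson point process
of intensity `lam` with independent marks of distribution `ν`. -/
structure IsMarkedPoisson {Ω E : Type*} [MeasurableSpace Ω] [MeasurableSpace E] (P : Measure Ω)
    (lam : ℝ) (ν : Measure E) (ξ : ℕ → Ω → ℝ × E) : Prop where
  measurable : ∀ j, Measurable (ξ j)
  map_eq : ∀ j, P.map (ξ j) = (expMeasure lam).prod ν
  indep : iIndepFun ξ P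

section Sequence

variable {E : Type*}

/-- The time which elapses during the interarrival times with the numbers `q, …, q + k - 1`. -/
def elapsed (q k : ℕ) (ζ : ℕ → ℝ × E) : ℝ := ∑ j ∈ Finset.range k, (ζ (q + j)).1

lemma elapsed_succ (q k : ℕ) (ζ : ℕ → ℝ × E) :
    elapsed q (k + 1) ζ = elapsed q k ζ + (ζ (q + k)).1 := Finset.sum_range_succ _ _

lemma measurable_elapsed [MeasurableSpace E] (q k : ℕ) : Measurable (elapsed (E := E) q k) :=
  Finset.measurable_sum _ fun j _ => (measurable_pi_apply (q + j)).fst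

section Truncate

variable [Inhabited E]

/-- Forget the entries of a sequence from the `q`-th one on. -/
def truncate (q : ℕ) (ζ : ℕ → ℝ × E) (j : ℕ) : ℝ × E := if j < q then ζ j else (0, default)

lemma truncate_of_lt {q j : ℕ} (h : j < q) (ζ : ℕ → ℝ × E) : truncate q ζ j = ζ j := if_pos h

lemma truncate_truncate {q p : ℕ} (h : q ≤ p) (ζ : ℕ → ℝ × E) :
    truncate q (truncate p ζ) = truncate q ζ := by
  funext j
  unfold truncate
  split_ifs <;> first | rfl | omega

lemma elapsed_truncate {q k p : ℕ} (h : q + k ≤ p) (ζ : ℕ → ℝ × E) :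
    elapsed q k (truncate p ζ) = elapsed q k ζ := by
  refine Finset.sum_congr rfl fun j hj => ?_
  rw [truncate_of_lt]
  have := Finset.mem_range.1 hj
  omega

/-- The first `k` arrivals from the `q`-th one on are rejected, if the set `G` of histories, elapsed
times and marks determines acceptance. -/
def Rejected (G : Set ((ℕ → ℝ × E) × ℝ × E)) (q k : ℕ) (ζ : ℕ → ℝ × E) : Prop :=
  ∀ l < k, (truncate q ζ, elapsed q (l + 1) ζ, (ζ (q + l)).2) ∉ G

lemma rejected_succ (G : Set ((ℕ → ℝ × E) × ℝ × E)) (q k : ℕ) (ζ : ℕ → ℝ × E) :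
    Rejected G q (k + 1) ζ ↔
      Rejected G q k ζ ∧ (truncate q ζ, elapsed q (k + 1) ζ, (ζ (q + k)).2) ∉ G := by
  constructor
  · exact fun h => ⟨fun l hl => h l (by omega), h k (by omega)⟩
  · rintro ⟨h1, h2⟩ l hl
    rcases Nat.lt_succ_iff_lt_or_eq.1 hl with h | rfl
    · exact h1 l h
    · exact h2

lemma rejected_truncate (G : Set ((ℕ → ℝ × E) × ℝ × E)) {q k p : ℕ} (h : q + k ≤ p)
    (ζ : ℕ → ℝ × E) : Rejected G q k (truncate p ζ) ↔ Rejected G q k ζ := by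
  refine forall₂_congr fun l hl => ?_
  rw [truncate_truncate (by omega), elapsed_truncate (by omega), truncate_of_lt (by omega)]

variable [MeasurableSpace E]

lemma measurable_truncate (q : ℕ) : Measurable (truncate (E := E) q) := by
  refine measurable_pi_lambda _ fun j => ?_
  unfold truncate
  split_ifs
  · exact measurable_pi_apply j
  · exact measurable_const

lemma measurableSet_rejected {G : Set ((ℕ → ℝ × E) × ℝ × E)} (hG : MeasurableSet G) (q k : ℕ) :
    MeasurableSet {ζ | Rejected G q k ζ} := by
  have : {ζ | Rejected G q k ζ} = ⋂ l, ⋂ (_ : l < k),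
      (fun ζ : ℕ → ℝ × E => (truncate q ζ, elapsed q (l + 1) ζ, (ζ (q + l)).2)) ⁻¹' Gᶜ := by
    ext ζ
    simp [Rejected]
  rw [this]
  refine MeasurableSet.iInter fun l => MeasurableSet.iInter fun _ => ?_
  exact ((measurable_truncate q).prodMk ((measurable_elapsed q (l + 1)).prodMk
    (measurable_pi_apply (q + l)).snd)) hG.compl

end Truncate

end Sequence

/-! ### Integration over a run of rejected arrivals -/

namespace IsMarkedPoisson

variable {Ω E : Type*} [MeasurableSpace Ω] [MeasurableSpace E] {P : Measure Ω} {lam : ℝ}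
  {ν : Measure E} {ξ : ℕ → Ω → ℝ × E}

lemma measurable_path (hξ : IsMarkedPoisson P lam ν ξ) : Measurable fun ω j => ξ j ω :=
  measurable_pi_lambda _ hξ.measurable

variable [Inhabited E]

lemma indepFun_truncate (hξ : IsMarkedPoisson P lam ν ξ) (q : ℕ) :
    IndepFun (fun ω => truncate q fun j => ξ j ω) (ξ q) P := by
  have h := hξ.indep.indepFun_finset (Finset.range q) {q} (by simp) hξ.measurable
  have h1 : Measurable fun (v : Finset.range q → ℝ × E) (j : ℕ) =>
      if hj : j < q then v ⟨j, Finset.mem_range.2 hj⟩ else (0, default) := by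
    refine measurable_pi_lambda _ fun j => ?_
    split_ifs
    · exact measurable_pi_apply _
    · exact measurable_const
  have h2 : Measurable fun v : ({q} : Finset ℕ) → ℝ × E => v ⟨q, Finset.mem_singleton_self q⟩ :=
    measurable_pi_apply _
  have h3 := h.comp h1 h2
  convert! h3 using 1

variable [IsProbabilityMeasure P] [IsProbabilityMeasure ν]

lemma lintegral_truncate (hξ : IsMarkedPoisson P lam ν ξ) (q : ℕ)
    {f : (ℕ → ℝ × E) × ℝ × E → ℝ≥0∞} (hf : Measurable f) :
    ∫⁻ ω, f (truncate q fun j => ξ j ω, ξ q ω) ∂P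
      = ∫⁻ ω, (∫⁻ t in Ioi (0 : ℝ), (∫⁻ c, f (truncate q fun j => ξ j ω, t, c) ∂ν)
          * ENNReal.ofReal (lam * Real.exp (-lam * t))) ∂P := by
  have hT : Measurable fun ω => truncate q fun j => ξ j ω :=
    (measurable_truncate q).comp hξ.measurable_path
  have hq := hξ.measurable q
  have : IsProbabilityMeasure ((expMeasure lam).prod ν) := by
    rw [← hξ.map_eq q]
    exact Measure.isProbabilityMeasure_map hq.aemeasurable
  have h := (indepFun_iff_map_prod_eq_prod_map_map hT.aemeasurable hq.aemeasurable).1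
    (hξ.indepFun_truncate q)
  rw [← lintegral_map hf (hT.prodMk hq), h, hξ.map_eq, lintegral_prod _ hf.aemeasurable,
    lintegral_map hf.lintegral_prod_right' hT]
  refine lintegral_congr fun ω => ?_
  have hfω : Measurable fun p : ℝ × E => f (truncate q fun j => ξ j ω, p) :=
    hf.comp measurable_prodMk_left
  rw [lintegral_prod _ hfω.aemeasurable, lintegral_expMeasure lam hfω.lintegral_prod_right']

section Stage

variable {b : (ℕ → ℝ × E) → ℝ → ℝ} {D : Set (ℕ → ℝ × E)} {G : Set ((ℕ → ℝ × E) × ℝ × E)}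

open Classical in
-- Induction on k. The final arrival is independent of everything before it and is integrated out
-- first. The mark of the last rejected arrival then integrates to b(s), and
-- `lintegral_stageDensity_succ` raises the stage. Vanishing of Ψ off D confines everything to
-- histories for which b is the rejection probability.
lemma lintegral_rejected (hξ : IsMarkedPoisson P lam ν ξ) (hlam : 0 < lam)
    (hb : Measurable (Function.uncurry b)) (hb01 : ∀ z s, b z s ∈ Icc (0 : ℝ) 1)
    (hG : MeasurableSet G)
    (hbG : ∀ z ∈ D, ∀ s, 0 < s → ν {c | (z, s, c) ∉ G} = ENNReal.ofReal (b z s)) (q k : ℕ)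
    {Ψ : (ℕ → ℝ × E) × ℝ × E → ℝ≥0∞} (hΨ : Measurable Ψ) (hΨD : ∀ z ∉ D, ∀ p, Ψ (z, p) = 0) :
    ∫⁻ ω, {ζ | Rejected G q k ζ}.indicator (fun ζ => Ψ (truncate q ζ, elapsed q (k + 1) ζ,
        (ζ (q + k)).2)) (fun j => ξ j ω) ∂P
      = ∫⁻ ω, (∫⁻ s in Ioi (0 : ℝ), (∫⁻ c, Ψ (truncate q fun j => ξ j ω, s, c) ∂ν)
          * stageDensity lam (b (truncate q fun j => ξ j ω)) k s) ∂P := by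
  induction k generalizing Ψ with
  | zero =>
    have h := hξ.lintegral_truncate q hΨ
    convert! h using 1
    · refine lintegral_congr fun ω => ?_
      rw [indicator_of_mem (by intro l hl; omega)]
      simp [elapsed]
    · refine lintegral_congr fun ω => ?_
      simp [stageDensity]
  | succ k ih =>
    set R : (ℕ → ℝ × E) × ℝ → ℝ≥0∞ := fun p => ∫⁻ t in Ioi (0 : ℝ),
      (∫⁻ c, Ψ (p.1, p.2 + t, c) ∂ν) * ENNReal.ofReal (lam * Real.exp (-lam * t)) with hR
    have hΨint : Measurable fun p : (ℕ → ℝ × E) × ℝ => ∫⁻ c, Ψ (p.1, p.2, c) ∂ν := by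
      refine Measurable.lintegral_prod_right' (f := fun p : ((ℕ → ℝ × E) × ℝ) × E =>
        Ψ (p.1.1, p.1.2, p.2)) (hΨ.comp ?_)
      fun_prop
    have hRm : Measurable R := by
      refine Measurable.lintegral_prod_right' (f := fun p : ((ℕ → ℝ × E) × ℝ) × ℝ =>
        (∫⁻ c, Ψ (p.1.1, p.1.2 + p.2, c) ∂ν) * ENNReal.ofReal (lam * Real.exp (-lam * p.2)))
        (Measurable.mul ?_ (by fun_prop))
      exact hΨint.comp (f := fun p : ((ℕ → ℝ × E) × ℝ) × ℝ => (p.1.1, p.1.2 + p.2)) (by fun_prop)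
    have hRD : ∀ z ∉ D, ∀ s, R (z, s) = 0 := fun z hz s => by simp [hR, hΨD z hz]
    -- The rejection of arrival q + k moves from the event into the test function, so that the
    -- induction hypothesis for k rejections applies.
    set Ψ' : (ℕ → ℝ × E) × ℝ × E → ℝ≥0∞ := Gᶜ.indicator fun p => R (p.1, p.2.1) with hΨ'
    have hΨ'm : Measurable Ψ' := (hRm.comp (by fun_prop)).indicator hG.compl
    have hΨ'D : ∀ z ∉ D, ∀ p, Ψ' (z, p) = 0 := fun z hz p => by
      simp [hΨ', indicator_apply, hRD z hz]
    set f : (ℕ → ℝ × E) × ℝ × E → ℝ≥0∞ := fun p =>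
      ({ζ | Rejected G q (k + 1) ζ} ×ˢ univ).indicator (fun p : (ℕ → ℝ × E) × ℝ × E =>
        Ψ (truncate q p.1, elapsed q (k + 1) p.1 + p.2.1, p.2.2)) p with hf
    have hfm : Measurable f := by
      refine Measurable.indicator ?_ ((measurableSet_rejected hG q (k + 1)).prod MeasurableSet.univ)
      refine hΨ.comp (((measurable_truncate q).comp measurable_fst).prodMk (Measurable.prodMk ?_ ?_))
      · exact ((measurable_elapsed q (k + 1)).comp measurable_fst).add measurable_snd.fst
      · exact measurable_snd.snd
    have h1 := hξ.lintegral_truncate (q + (k + 1)) hfm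
    have h2 : ∀ ω, f (truncate (q + (k + 1)) fun j => ξ j ω, ξ (q + (k + 1)) ω)
        = {ζ | Rejected G q (k + 1) ζ}.indicator (fun ζ => Ψ (truncate q ζ,
          elapsed q (k + 1 + 1) ζ, (ζ (q + (k + 1))).2)) (fun j => ξ j ω) := by
      intro ω
      simp only [hf, indicator_apply, mem_prod, mem_ofPred_eq, mem_univ, and_true]
      rw [rejected_truncate G le_rfl, truncate_truncate (by omega), elapsed_truncate le_rfl,
        elapsed_succ q (k + 1)]
    have h3 : ∀ ω, ∫⁻ t in Ioi (0 : ℝ), (∫⁻ c, f (truncate (q + (k + 1)) fun j => ξ j ω, t, c) ∂ν)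
          * ENNReal.ofReal (lam * Real.exp (-lam * t))
        = {ζ | Rejected G q k ζ}.indicator (fun ζ => Ψ' (truncate q ζ, elapsed q (k + 1) ζ,
        (ζ (q + k)).2)) (fun j => ξ j ω) := by
      intro ω
      simp only [hf, indicator_apply, mem_prod, mem_ofPred_eq, mem_univ, and_true, hΨ', mem_compl_iff]
      rw [rejected_truncate G le_rfl, truncate_truncate (by omega), elapsed_truncate le_rfl,
        rejected_succ]
      by_cases hr : Rejected G q k fun j => ξ j ω
      · by_cases hg : (truncate q fun j => ξ j ω, elapsed q (k + 1) fun j => ξ j ω,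
          (ξ (q + k) ω).2) ∈ G
        · simp [hg]
        · simp [hr, hg, hR]
      · simp [hr]
    simp_rw [h2, h3] at h1
    rw [h1, ih hΨ'm hΨ'D]
    refine lintegral_congr fun ω => ?_
    set z := truncate q fun j => ξ j ω with hz
    rw [← lintegral_stageDensity_succ (b := b z) (hb.comp measurable_prodMk_left) (hb01 z) hlam k
      (ψ := fun s => ∫⁻ c, Ψ (z, s, c) ∂ν) (hΨint.comp measurable_prodMk_left)]
    refine setLIntegral_congr_fun measurableSet_Ioi fun s hs => ?_
    congr 1
    by_cases hzD : z ∈ D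
    · rw [← hbG z hzD s hs]
      have h4 : ∀ c, Ψ' (z, s, c) = {c | (z, s, c) ∉ G}.indicator (fun _ => R (z, s)) c := by
        intro c
        simp [hΨ', indicator_apply]
      simp_rw [h4]
      rw [lintegral_indicator_const, mul_comm]
      exact (measurable_prodMk_left.comp measurable_prodMk_left :
        Measurable fun c => (z, s, c)) hG.compl
    · simp [hΨ'D z hzD, hΨD z hzD]

open Classical in
/-- The joint law of the history before the `q`-th arrival, and the time until the first
acceptance from then on, on the event that this is the `k`-th subsequent arrival. -/
lemma lintegral_first_accepted (hξ : IsMarkedPoisson P lam ν ξ) (hlam : 0 < lam)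
    (hb : Measurable (Function.uncurry b)) (hb01 : ∀ z s, b z s ∈ Icc (0 : ℝ) 1)
    (hG : MeasurableSet G)
    (hbG : ∀ z ∈ D, ∀ s, 0 < s → ν {c | (z, s, c) ∉ G} = ENNReal.ofReal (b z s)) (q k : ℕ)
    {Φ : (ℕ → ℝ × E) × ℝ → ℝ≥0∞} (hΦ : Measurable Φ) (hΦD : ∀ z ∉ D, ∀ s, Φ (z, s) = 0) :
    ∫⁻ ω, {ζ | Rejected G q k ζ ∧ (truncate q ζ, elapsed q (k + 1) ζ, (ζ (q + k)).2) ∈ G}.indicator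
        (fun ζ => Φ (truncate q ζ, elapsed q (k + 1) ζ)) (fun j => ξ j ω) ∂P
      = ∫⁻ ω, (∫⁻ s in Ioi (0 : ℝ), Φ (truncate q fun j => ξ j ω, s)
          * (ENNReal.ofReal (1 - b (truncate q fun j => ξ j ω) s)
            * stageDensity lam (b (truncate q fun j => ξ j ω)) k s)) ∂P := by
  -- Acceptance constrains only the last arrival, so it can be absorbed into the test function.
  set Ψ : (ℕ → ℝ × E) × ℝ × E → ℝ≥0∞ := G.indicator fun p => Φ (p.1, p.2.1) with hΨ
  have hΨm : Measurable Ψ := (hΦ.comp (by fun_prop)).indicator hG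
  have hΨD : ∀ z ∉ D, ∀ p, Ψ (z, p) = 0 := fun z hz p => by
    simp [hΨ, indicator_apply, hΦD z hz]
  have h := hξ.lintegral_rejected hlam hb hb01 hG hbG q k hΨm hΨD
  convert! h using 1
  · refine lintegral_congr fun ω => ?_
    simp only [indicator_apply, mem_ofPred_eq, hΨ]
    split_ifs <;> first | rfl | tauto
  · refine lintegral_congr fun ω => ?_
    set z := truncate q fun j => ξ j ω with hz
    refine setLIntegral_congr_fun measurableSet_Ioi fun s hs => ?_
    rw [← mul_assoc]
    congr 1
    by_cases hzD : z ∈ D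
    · have hm : MeasurableSet {c | (z, s, c) ∈ G} :=
        (measurable_prodMk_left.comp measurable_prodMk_left : Measurable fun c => (z, s, c)) hG
      have h1 : ν {c | (z, s, c) ∈ G} = ENNReal.ofReal (1 - b z s) := by
        have h2 := hbG z hzD s hs
        rw [show {c | (z, s, c) ∉ G} = {c | (z, s, c) ∈ G}ᶜ from rfl,
          prob_compl_eq_one_sub hm] at h2
        rw [ENNReal.ofReal_sub _ (hb01 z s).1, ← h2, ENNReal.ofReal_one,
          ENNReal.sub_sub_cancel ENNReal.one_ne_top prob_le_one]
      have h4 : ∀ c, Ψ (z, s, c) = {c | (z, s, c) ∈ G}.indicator (fun _ => Φ (z, s)) c := by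
        intro c
        simp [hΨ, indicator_apply]
      simp_rw [h4]
      rw [lintegral_indicator_const hm, h1]
    · simp [hΦD z hzD, hΨD z hzD]

end Stage

end IsMarkedPoisson

/-! ### Admission numbers -/

section Reached

open Classical in
/-- The `i`-th admission happens exactly after `q` arrivals, if `a` is the set of admitted
messages. -/
def Reached (a : ℕ → Prop) (i q : ℕ) : Prop :=
  (∀ n < q, Nat.count a n < i) ∧ i ≤ Nat.count a q

/-- The number of arrivals up to the `i`-th admission. -/
def passed (a : ℕ → Prop) (i : ℕ) : ℕ := sInf {q | Reached a i q}

variable {a a' : ℕ → Prop} {i l q p k : ℕ}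

lemma Reached.unique (h : Reached a i q) (h' : Reached a i p) : q = p := by
  rcases lt_trichotomy q p with hlt | rfl | hlt
  · exact absurd h.2 (not_le.2 (h'.1 q hlt))
  · rfl
  · exact absurd h'.2 (not_le.2 (h.1 p hlt))

lemma Reached.passed_eq (h : Reached a i q) : passed a i = q := by
  have : {q | Reached a i q} = {q} := by
    ext p
    exact ⟨fun h' => h'.unique h, fun h' => by rw [mem_singleton_iff.1 h']; exact h⟩
  rw [passed, this]
  exact csInf_singleton q

open Classical in
lemma Reached.count_eq (h : Reached a i q) : Nat.count a q = i := by
  refine le_antisymm ?_ h.2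
  cases q with
  | zero => simp
  | succ q =>
    have h1 := h.1 q (Nat.lt_succ_self q)
    rw [Nat.count_succ]
    split_ifs <;> omega

lemma reached_zero (a : ℕ → Prop) : Reached a 0 0 := ⟨fun n hn => absurd hn n.not_lt_zero, by simp⟩

lemma reached_zero_iff : Reached a 0 q ↔ q = 0 :=
  ⟨fun h => h.unique (reached_zero a), fun h => by rw [h]; exact reached_zero a⟩

open Classical in
lemma count_congr_of_lt (h : ∀ j < q, (a j ↔ a' j)) : Nat.count a q = Nat.count a' q := by
  induction q with
  | zero => simp
  | succ q ih =>
    rw [Nat.count_succ, Nat.count_succ, ih fun j hj => h j (by omega)]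
    congr 1
    simp only [h q (Nat.lt_succ_self q)]

lemma reached_congr (h : ∀ j < q, (a j ↔ a' j)) : Reached a i q ↔ Reached a' i q := by
  unfold Reached
  rw [count_congr_of_lt h]
  refine and_congr_left' (forall₂_congr fun n hn => ?_)
  rw [count_congr_of_lt fun j hj => h j (hj.trans hn)]

open Classical in
lemma exists_reached_of_le_count (h : i ≤ Nat.count a q) : ∃ p ≤ q, Reached a i p := by
  have hex : ∃ p, i ≤ Nat.count a p := ⟨q, h⟩
  exact ⟨Nat.find hex, Nat.find_min' hex h, fun n hn => not_le.1 (Nat.find_min hex hn),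
    Nat.find_spec hex⟩

lemma Reached.exists_le (h : Reached a i q) (hl : l ≤ i) : ∃ p ≤ q, Reached a l p :=
  exists_reached_of_le_count (hl.trans h.2)

lemma Reached.passed_congr (h : Reached a i q) (hl : l ≤ i) (haa : ∀ j < q, (a j ↔ a' j)) :
    passed a' l = passed a l ∧ passed a l ≤ q := by
  obtain ⟨p, hp, hr⟩ := h.exists_le hl
  rw [hr.passed_eq, ((reached_congr fun j hj => haa j (by omega)).1 hr).passed_eq]
  exact ⟨rfl, hp⟩

open Classical in
lemma count_add_of_not (h : ∀ j < k, ¬ a (q + j)) : Nat.count a (q + k) = Nat.count a q := by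
  induction k with
  | zero => rfl
  | succ k ih =>
    rw [← add_assoc, Nat.count_succ, ih fun j hj => h j (by omega), if_neg (h k (by omega))]
    rfl

/-- The count equals i at q, so the next admission is the first admitted index from q on. If that
index is q + k, then q + k + 1 arrivals have passed. -/
lemma Reached.reached_succ_iff (h : Reached a i q) :
    Reached a (i + 1) (q + k + 1) ↔ (∀ j < k, ¬ a (q + j)) ∧ a (q + k) := by
  classical
  have hq := h.count_eq
  constructor
  · intro h'
    have h1 : ∀ j < k, ¬ a (q + j) := by
      intro j hj ha
      have h2 := h'.1 (q + j + 1) (by omega)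
      rw [Nat.count_succ, if_pos ha] at h2
      have := Nat.count_monotone a (Nat.le_add_right q j)
      omega
    refine ⟨h1, ?_⟩
    by_contra ha
    have h2 := h'.count_eq
    rw [Nat.count_succ, if_neg ha, count_add_of_not h1] at h2
    omega
  · rintro ⟨h1, h2⟩
    have h3 := count_add_of_not h1
    refine ⟨fun n hn => ?_, ?_⟩
    · have := Nat.count_monotone a (Nat.lt_succ_iff.1 hn)
      omega
    · rw [Nat.count_succ, if_pos h2]
      omega

/-- Indices start at 0: the (i+1)-st admission is that of message `Nat.nth a i`. -/
lemma reached_nth (ha : {j | a j}.Infinite) (i : ℕ) : Reached a (i + 1) (Nat.nth a i + 1) := by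
  classical
  have h := Nat.count_nth_succ_of_infinite ha i
  refine ⟨fun n hn => ?_, h.ge⟩
  have h1 := Nat.count_monotone a (Nat.lt_succ_iff.1 hn)
  rw [Nat.count_nth_of_infinite ha] at h1
  omega

lemma exists_reached (ha : {j | a j}.Infinite) (i : ℕ) : ∃ q, Reached a i q := by
  cases i with
  | zero => exact ⟨0, reached_zero a⟩
  | succ i => exact ⟨_, reached_nth ha i⟩

lemma Reached.lt_of_reached_succ (h : Reached a i q) (h' : Reached a (i + 1) p) : q < p := by
  classical
  by_contra hle
  have := Nat.count_monotone a (not_lt.1 hle)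
  have := h.count_eq
  have := h'.count_eq
  omega

lemma exists_first_admitted (ha : {j | a j}.Infinite) (h : Reached a i q) :
    ∃ k, (∀ j < k, ¬ a (q + j)) ∧ a (q + k) := by
  obtain ⟨p, hp⟩ := exists_reached ha (i + 1)
  obtain ⟨k, rfl⟩ := Nat.exists_eq_add_of_lt (h.lt_of_reached_succ hp)
  exact ⟨k, h.reached_succ_iff.1 hp⟩

end Reached

/-! ### Attempts and lags as functions of the sequence of arrivals -/

/-- The state with `k` attempts and time lag `s`, if these numbers are positive. -/
def mkState (k : ℕ) (s : ℝ) : State :=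
  (⟨max k 1, le_max_right _ _⟩, ⟨if 0 < s then s else 1, by
    split_ifs with h
    · exact h
    · exact zero_lt_one (α := ℝ)⟩)

lemma mkState_of_pos {k : ℕ} (hk : 1 ≤ k) {s : ℝ} (hs : 0 < s) :
    mkState k s = (⟨k, hk⟩, ⟨s, hs⟩) := by
  simp [mkState, hs, hk]

lemma measurable_mkState : Measurable fun p : ℕ × ℝ => mkState p.1 p.2 := by
  refine Measurable.prodMk ?_ (Measurable.subtype_mk ?_)
  · exact (measurable_of_countable fun k : ℕ => (⟨max k 1, le_max_right _ _⟩ : PosNat)).comp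
      measurable_fst
  · exact Measurable.ite (measurableSet_lt measurable_const measurable_snd) measurable_snd
      measurable_const

lemma arrival_eq_elapsed {E : Type*} (ζ : ℕ → ℝ × E) (j : ℕ) :
    arrival (fun j => (ζ j).1) j = elapsed 0 (j + 1) ζ := by
  simp [arrival, elapsed]

section States

variable {E : Type*} {adm : (ℕ → ℝ × E) → ℕ → Prop} {ζ : ℕ → ℝ × E}

/-- The number of attempts and the time lag between the `i`-th and the `(i+1)`-st admission. -/
def chainState (adm : (ℕ → ℝ × E) → ℕ → Prop) (i : ℕ) (ζ : ℕ → ℝ × E) : State :=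
  mkState (passed (adm ζ) (i + 1) - passed (adm ζ) i)
    (elapsed (passed (adm ζ) i) (passed (adm ζ) (i + 1) - passed (adm ζ) i) ζ)

lemma elapsed_strictMono (hζ : ∀ j, 0 < (ζ j).1) : StrictMono fun k => elapsed 0 k ζ := by
  refine strictMono_nat_of_lt_succ fun k => ?_
  rw [elapsed_succ]
  linarith [hζ (0 + k)]

lemma elapsed_add (q k l : ℕ) : elapsed q (k + l) ζ = elapsed q k ζ + elapsed (q + k) l ζ := by
  simp [elapsed, Finset.sum_range_add, add_assoc]

lemma elapsed_pos {q k : ℕ} (hk : 0 < k) (hζ : ∀ j < q + k, 0 < (ζ j).1) :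
    0 < elapsed q k ζ := by
  refine Finset.sum_pos (fun j hj => hζ _ ?_) ⟨0, Finset.mem_range.2 hk⟩
  have := Finset.mem_range.1 hj
  omega

lemma admissionTime_eq_elapsed {a : ℕ → Prop} (ha : {j | a j}.Infinite) (i : ℕ) :
    admissionTime (arrival fun j => (ζ j).1) a i = elapsed 0 (passed a i) ζ := by
  cases i with
  | zero => rw [(reached_zero a).passed_eq]; simp [admissionTime, elapsed]
  | succ i => rw [(reached_nth ha i).passed_eq, admissionTime, arrival_eq_elapsed]

lemma passed_lt_passed_succ {a : ℕ → Prop} (ha : {j | a j}.Infinite) (i : ℕ) :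
    passed a i < passed a (i + 1) := by
  obtain ⟨q, hq⟩ := exists_reached ha i
  obtain ⟨p, hp⟩ := exists_reached ha (i + 1)
  rw [hq.passed_eq, hp.passed_eq]
  exact hq.lt_of_reached_succ hp

lemma attempts_eq (hζ : ∀ j, 0 < (ζ j).1) {a : ℕ → Prop} (ha : {j | a j}.Infinite) (i : ℕ) :
    attempts (arrival fun j => (ζ j).1) a i = passed a (i + 1) - passed a i := by
  have hm := elapsed_strictMono hζ
  have : {j : ℕ | arrival (fun j => (ζ j).1) j ∈ Ioc
      (admissionTime (arrival fun j => (ζ j).1) a i)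
      (admissionTime (arrival fun j => (ζ j).1) a (i + 1))}
      = (Finset.Ico (passed a i) (passed a (i + 1)) : Set ℕ) := by
    ext j
    rw [mem_ofPred_eq, admissionTime_eq_elapsed ha, admissionTime_eq_elapsed ha,
      arrival_eq_elapsed, mem_Ioc, hm.lt_iff_lt, hm.le_iff_le]
    simp only [Finset.coe_Ico, mem_Ico]
    omega
  rw [attempts, this, ncard_coe_finset, Nat.card_Ico]

lemma lag_eq {a : ℕ → Prop} (ha : {j | a j}.Infinite) (i : ℕ) :
    lag (arrival fun j => (ζ j).1) a i
      = elapsed (passed a i) (passed a (i + 1) - passed a i) ζ := by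
  rw [lag, admissionTime_eq_elapsed ha, admissionTime_eq_elapsed ha]
  have h := passed_lt_passed_succ ha i
  conv_lhs => rw [show passed a (i + 1) = passed a i + (passed a (i + 1) - passed a i) by omega]
  rw [elapsed_add, zero_add]
  ring

lemma chainState_eq (hζ : ∀ j, 0 < (ζ j).1) (ha : {j | adm ζ j}.Infinite) (i : ℕ) :
    ((chainState adm i ζ).1 : ℕ) = attempts (arrival fun j => (ζ j).1) (adm ζ) i ∧
      ((chainState adm i ζ).2 : ℝ) = lag (arrival fun j => (ζ j).1) (adm ζ) i := by
  have h := passed_lt_passed_succ ha i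
  have h1 : 1 ≤ passed (adm ζ) (i + 1) - passed (adm ζ) i := by omega
  rw [attempts_eq hζ ha, lag_eq ha, chainState, mkState_of_pos h1 (elapsed_pos h1 fun j _ => hζ j)]
  exact ⟨rfl, rfl⟩

lemma chainState_of_reached {i q k : ℕ} (h : Reached (adm ζ) i q)
    (h' : Reached (adm ζ) (i + 1) (q + k + 1)) :
    chainState adm i ζ = mkState (k + 1) (elapsed q (k + 1) ζ) := by
  rw [chainState, h.passed_eq, h'.passed_eq, show q + k + 1 - q = k + 1 by omega]

variable [MeasurableSpace E]

open Classical in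
lemma measurable_count (hadm : ∀ j, MeasurableSet {ζ | adm ζ j}) (q : ℕ) :
    Measurable fun ζ => Nat.count (adm ζ) q := by
  induction q with
  | zero => simp
  | succ q ih =>
    simp only [Nat.count_succ]
    exact ih.add (Measurable.ite (hadm q) measurable_const measurable_const)

open Classical in
lemma measurableSet_reached (hadm : ∀ j, MeasurableSet {ζ | adm ζ j}) (i q : ℕ) :
    MeasurableSet {ζ | Reached (adm ζ) i q} := by
  have : {ζ | Reached (adm ζ) i q} = (⋂ n, ⋂ (_ : n < q), {ζ | Nat.count (adm ζ) n < i}) ∩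
      {ζ | i ≤ Nat.count (adm ζ) q} := by
    ext ζ
    simp [Reached]
  rw [this]
  exact (MeasurableSet.iInter fun n => MeasurableSet.iInter fun _ =>
    measurableSet_lt (measurable_count hadm n) measurable_const).inter
      (measurableSet_le measurable_const (measurable_count hadm q))

lemma measurable_passed (hadm : ∀ j, MeasurableSet {ζ | adm ζ j}) (i : ℕ) :
    Measurable fun ζ => passed (adm ζ) i := by
  refine measurable_to_countable' fun q => ?_
  -- The second set comes from the infimum of the empty set being 0 when the i-th admission never
  -- happens.
  have : (fun ζ => passed (adm ζ) i) ⁻¹' {q} = {ζ | Reached (adm ζ) i q} ∪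
      ({ζ | q = 0} ∩ ⋂ p, {ζ | Reached (adm ζ) i p}ᶜ) := by
    ext ζ
    simp only [mem_preimage, mem_singleton_iff, mem_union, mem_ofPred_eq, mem_inter_iff, mem_iInter,
      mem_compl_iff]
    by_cases h : ∃ p, Reached (adm ζ) i p
    · obtain ⟨p, hp⟩ := h
      rw [hp.passed_eq]
      constructor
      · rintro rfl; exact Or.inl hp
      · rintro (h | ⟨_, h⟩)
        · exact hp.unique h
        · exact absurd hp (h p)
    · push Not at h
      have : {q | Reached (adm ζ) i q} = ∅ := eq_empty_of_forall_notMem h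
      rw [passed, this, Nat.sInf_empty]
      simp [h, eq_comm]
  rw [this]
  exact (measurableSet_reached hadm i q).union ((MeasurableSet.const _).inter
    (MeasurableSet.iInter fun p => (measurableSet_reached hadm i p).compl))

lemma measurable_chainState (hadm : ∀ j, MeasurableSet {ζ | adm ζ j}) (i : ℕ) :
    Measurable (chainState adm i) := by
  have h1 : Measurable fun p : (ℕ × ℕ) × (ℕ → ℝ × E) => elapsed p.1.1 p.1.2 p.2 :=
    measurable_from_prod_countable_right fun p => measurable_elapsed p.1 p.2
  have h2 := measurable_passed hadm i
  have h3 := measurable_passed hadm (i + 1)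
  have h4 : Measurable fun ζ => passed (adm ζ) (i + 1) - passed (adm ζ) i := h3.sub h2
  exact measurable_mkState.comp (h4.prodMk (h1.comp ((h2.prodMk h4).prodMk measurable_id)))

end States

/-! ### The Markov property of admission protocols -/

/-- The upper limit may be negative, so both integrals in the definition of the interval integral
are treated. -/
lemma measurable_primitive {Z : Type*} [MeasurableSpace Z] {b : Z → ℝ → ℝ}
    (hb : Measurable (Function.uncurry b)) :
    Measurable fun p : Z × ℝ => ∫ r in (0 : ℝ)..p.2, b p.1 r := by
  have hm : Measurable fun q : (Z × ℝ) × ℝ => b q.1.1 q.2 :=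
    hb.comp ((measurable_fst.comp measurable_fst).prodMk measurable_snd)
  have h : ∀ u v : Z × ℝ → ℝ, Measurable u → Measurable v →
      Measurable fun p : Z × ℝ => ∫ r in Ioc (u p) (v p), b p.1 r := by
    intro u v hu hv
    have hs : MeasurableSet {q : (Z × ℝ) × ℝ | u q.1 < q.2 ∧ q.2 ≤ v q.1} :=
      (measurableSet_lt (hu.comp measurable_fst) measurable_snd).inter
        (measurableSet_le measurable_snd (hv.comp measurable_fst))
    have hF := ((hm.indicator hs).stronglyMeasurable.integral_prod_right'
      (ν := (volume : Measure ℝ))).measurable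
    convert! hF using 2 with p
    rw [← integral_indicator measurableSet_Ioc]
    rfl
  exact (h (fun _ => 0) Prod.snd measurable_const measurable_snd).sub
    (h Prod.snd (fun _ => 0) measurable_snd measurable_const)

lemma measurable_uncurry_stageDensity {Z : Type*} [MeasurableSpace Z] {b : Z → ℝ → ℝ}
    (hb : Measurable (Function.uncurry b)) (lam : ℝ) (k : ℕ) :
    Measurable fun p : Z × ℝ => stageDensity lam (b p.1) k p.2 := by
  have := measurable_primitive hb
  unfold stageDensity
  fun_prop

/-- The admission of the messages is decided successively: the decision about an arrival depends on
the arrivals before the last admission, the time elapsed since then, and the own mark. -/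
structure IsProtocol {E : Type*} [MeasurableSpace E] [Inhabited E]
    (adm : (ℕ → ℝ × E) → ℕ → Prop) (G : ℕ → Set ((ℕ → ℝ × E) × ℝ × E)) : Prop where
  measurableSet : ∀ j, MeasurableSet {ζ | adm ζ j}
  truncate : ∀ q ζ, ∀ j < q, (adm (truncate q ζ) j ↔ adm ζ j)
  measurableSet_accept : ∀ q, MeasurableSet (G q)
  accept : ∀ q k ζ, (∀ l < k, ¬ adm ζ (q + l)) →
    (adm ζ (q + k) ↔ (MultiChannel.truncate q ζ, elapsed q (k + 1) ζ, (ζ (q + k)).2) ∈ G q)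
  idle : ∀ ζ : ℕ → ℝ × E, (∀ j, 0 < (ζ j).1) → ∀ j, 1 ≤ (ζ j).1 → adm ζ j

/-- The sequences for which the `i`-th admission occurs exactly after `q` arrivals. -/
def historySet {E : Type*} (adm : (ℕ → ℝ × E) → ℕ → Prop) (i q : ℕ) : Set (ℕ → ℝ × E) :=
  {ζ | Reached (adm ζ) i q ∧ ∀ j < q, 0 < (ζ j).1}

namespace IsProtocol

variable {E : Type*} [MeasurableSpace E] [Inhabited E] {adm : (ℕ → ℝ × E) → ℕ → Prop}
  {G : ℕ → Set ((ℕ → ℝ × E) × ℝ × E)}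

lemma measurableSet_historySet (h : IsProtocol adm G) (i q : ℕ) :
    MeasurableSet (historySet adm i q) := by
  have : historySet adm i q = {ζ | Reached (adm ζ) i q} ∩ ⋂ j, ⋂ (_ : j < q), {ζ | 0 < (ζ j).1} := by
    ext ζ
    simp [historySet]
  rw [this]
  exact (measurableSet_reached h.measurableSet i q).inter (MeasurableSet.iInter fun j =>
    MeasurableSet.iInter fun _ => measurableSet_lt measurable_const (measurable_pi_apply j).fst)

/-- `accept` describes a decision only after a run of rejections starting at q, so the equivalence
is built up one arrival at a time. -/
lemma rejected_iff (h : IsProtocol adm G) (q k : ℕ) (ζ : ℕ → ℝ × E) :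
    Rejected (G q) q k ζ ↔ ∀ l < k, ¬ adm ζ (q + l) := by
  induction k with
  | zero => simp [Rejected]
  | succ k ih =>
    rw [rejected_succ, ih]
    constructor
    · rintro ⟨h1, h2⟩ l hl
      rcases Nat.lt_succ_iff_lt_or_eq.1 hl with hl | rfl
      · exact h1 l hl
      · rwa [h.accept q l ζ h1]
    · intro h1
      have h2 : ∀ l < k, ¬ adm ζ (q + l) := fun l hl => h1 l (by omega)
      exact ⟨h2, by rw [← h.accept q k ζ h2]; exact h1 k (by omega)⟩

lemma reached_truncate_iff (h : IsProtocol adm G) {q i : ℕ} (ζ : ℕ → ℝ × E) :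
    Reached (adm (MultiChannel.truncate q ζ)) i q ↔ Reached (adm ζ) i q :=
  reached_congr fun j hj => h.truncate q ζ j hj

/-- For l < i both admissions that delimit the l-th state fall among the first q arrivals. -/
lemma chainState_truncate (h : IsProtocol adm G) {q i l : ℕ} {ζ : ℕ → ℝ × E}
    (hr : Reached (adm ζ) i q) (hl : l < i) :
    chainState adm l (MultiChannel.truncate q ζ) = chainState adm l ζ := by
  have h1 := hr.passed_congr (l := l) (by omega)
    (fun j hj => (h.truncate q ζ j hj).symm)
  have h2 := hr.passed_congr (l := l + 1) (by omega)
    (fun j hj => (h.truncate q ζ j hj).symm)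
  unfold chainState
  rw [h1.1, h2.1]
  -- In the reversed order the truncated difference is 0 and both sums are empty, so no monotonicity
  -- is needed.
  by_cases hle : passed (adm ζ) l ≤ passed (adm ζ) (l + 1)
  · rw [elapsed_truncate (by omega)]
  · rw [show passed (adm ζ) (l + 1) - passed (adm ζ) l = 0 by omega]
    simp [elapsed]

open Classical in
/-- Decomposition of a function of the states up to the `i`-th admission and the next one, according
to the numbers of arrivals. -/
lemma indicator_eq_tsum (h : IsProtocol adm G) {i : ℕ} {ζ : ℕ → ℝ × E} (hζ : ∀ j, 0 < (ζ j).1)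
    (ha : {j | adm ζ j}.Infinite) (S : Set ((Fin i → State) × State)) :
    S.indicator (1 : (Fin i → State) × State → ℝ≥0∞) (fun j => chainState adm j ζ, chainState adm i ζ)
      = ∑' (q) (k), {ζ | Rejected (G q) q k ζ ∧ (MultiChannel.truncate q ζ, elapsed q (k + 1) ζ,
            (ζ (q + k)).2) ∈ G q}.indicator
          (fun ζ => (historySet adm i q).indicator (fun z => S.indicator (1 : (Fin i → State) × State → ℝ≥0∞)
            (fun j => chainState adm j z, mkState (k + 1) (elapsed q (k + 1) ζ)))
              (MultiChannel.truncate q ζ)) ζ := by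
  obtain ⟨q, hq⟩ := exists_reached ha i
  obtain ⟨k, hk⟩ := exists_first_admitted ha hq
  -- Exactly one pair (q, k) contributes to the double sum: the number of arrivals up to the i-th
  -- admission and the number of rejections after it.
  have hmem : ∀ k', (Rejected (G q) q k' ζ ∧ (MultiChannel.truncate q ζ, elapsed q (k' + 1) ζ,
      (ζ (q + k')).2) ∈ G q) ↔ k' = k := by
    intro k'
    rw [h.rejected_iff]
    constructor
    · rintro ⟨h1, h2⟩
      rw [← h.accept q k' ζ h1] at h2
      have := (hq.reached_succ_iff.2 ⟨h1, h2⟩).unique (hq.reached_succ_iff.2 hk)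
      omega
    · rintro rfl
      exact ⟨hk.1, (h.accept q k' ζ hk.1).1 hk.2⟩
  have hD : MultiChannel.truncate q ζ ∈ historySet adm i q := by
    refine ⟨(h.reached_truncate_iff ζ).2 hq, fun j hj => ?_⟩
    rw [truncate_of_lt hj]
    exact hζ j
  set A : ℕ → Set (ℕ → ℝ × E) := fun k => {ζ | Rejected (G q) q k ζ ∧
    (MultiChannel.truncate q ζ, elapsed q (k + 1) ζ, (ζ (q + k)).2) ∈ G q} with hA
  have hA' : ∀ k', ζ ∈ A k' ↔ k' = k := hmem
  rw [tsum_eq_single q, tsum_eq_single k, indicator_of_mem ((hA' k).2 rfl), indicator_of_mem hD,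
    ← chainState_of_reached hq (hq.reached_succ_iff.2 hk)]
  · congr 2
    funext j
    exact (h.chainState_truncate hq j.2).symm
  · intro k' hk'
    exact indicator_of_notMem (mt (hA' k').1 hk') _
  · intro q' hq'
    have : MultiChannel.truncate q' ζ ∉ historySet adm i q' := fun hmem' =>
      hq' (((h.reached_truncate_iff ζ).1 hmem'.1).unique hq)
    simp [indicator_of_notMem this]

end IsProtocol

/-! ### The conditional law of the next state -/

namespace IsMarkedPoisson

variable {Ω E : Type*} [MeasurableSpace Ω] [MeasurableSpace E] {P : Measure Ω}
  {lam : ℝ} {ν : Measure E} {ξ : ℕ → Ω → ℝ × E}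

lemma map_fst [IsProbabilityMeasure ν] (hξ : IsMarkedPoisson P lam ν ξ) (j : ℕ) :
    P.map (fun ω => (ξ j ω).1) = expMeasure lam := by
  have h := congrArg (Measure.map Prod.fst) (hξ.map_eq j)
  rw [Measure.map_map measurable_fst (hξ.measurable j)] at h
  rw [show (fun ω => (ξ j ω).1) = Prod.fst ∘ ξ j from rfl, h, Measure.map_fst_prod]
  simp

variable [IsProbabilityMeasure ν]

lemma ae_pos (hξ : IsMarkedPoisson P lam ν ξ) : ∀ᵐ ω ∂P, ∀ j, 0 < (ξ j ω).1 := by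
  refine ae_all_iff.2 fun j => ?_
  have hm : Measurable fun ω => (ξ j ω).1 := (hξ.measurable j).fst
  have h : expMeasure lam (Iic 0) = 0 := by
    rw [← lintegral_indicator_one measurableSet_Iic,
      lintegral_expMeasure lam (measurable_one.indicator measurableSet_Iic)]
    rw [setLIntegral_congr_fun (g := 0) measurableSet_Ioi]
    · simp
    · intro t ht
      simp [not_le.2 (mem_Ioi.1 ht)]
  rw [← hξ.map_fst j, Measure.map_apply hm measurableSet_Iic] at h
  rw [ae_iff]
  simpa [preimage, not_lt] using h

variable [IsProbabilityMeasure P]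

/-- Second Borel–Cantelli lemma for independent events of equal positive probability. -/
lemma ae_frequently_one_le (hξ : IsMarkedPoisson P lam ν ξ) (hlam : 0 < lam) :
    ∀ᵐ ω ∂P, {j | 1 ≤ (ξ j ω).1}.Infinite := by
  set s : ℕ → Set Ω := fun j => ξ j ⁻¹' (Ici 1 ×ˢ univ) with hs
  have hms : MeasurableSet ((Ici 1 : Set ℝ) ×ˢ (univ : Set E)) :=
    measurableSet_Ici.prod MeasurableSet.univ
  have hsm : ∀ j, MeasurableSet (s j) := fun j => hξ.measurable j hms
  have hp : ∀ j, P (s j) = expMeasure lam (Ici 1) := by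
    intro j
    rw [hs, ← Measure.map_apply (hξ.measurable j) hms, hξ.map_eq, Measure.prod_prod]
    simp
  have hpos : expMeasure lam (Ici 1) ≠ 0 := by
    rw [← lintegral_indicator_one measurableSet_Ici,
      lintegral_expMeasure lam (measurable_one.indicator measurableSet_Ici)]
    have : ∀ t : ℝ, (Ici 1).indicator 1 t * ENNReal.ofReal (lam * Real.exp (-lam * t))
        = (Ici 1).indicator (fun t => ENNReal.ofReal (lam * Real.exp (-lam * t))) t := by
      intro t
      simp [indicator_apply]
    simp_rw [this]
    rw [lintegral_indicator measurableSet_Ici, Measure.restrict_restrict measurableSet_Ici]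
    have h2 : Ici (1 : ℝ) ∩ Ioi 0 = Ici 1 :=
      inter_eq_left.2 fun t ht => lt_of_lt_of_le zero_lt_one (mem_Ici.1 ht)
    rw [h2]
    refine (setLIntegral_pos_iff (by fun_prop)).2 ?_ |>.ne'
    have h3 : (Function.support fun t => ENNReal.ofReal (lam * Real.exp (-lam * t))) = univ := by
      refine eq_univ_of_forall fun t => ?_
      have : 0 < lam * Real.exp (-lam * t) := by positivity
      simpa using this
    rw [h3]
    simp
  have hind : iIndepSet s P := by
    refine (iIndepSet_iff_meas_biInter hsm).2 fun t => ?_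
    exact hξ.indep.measure_inter_preimage_eq_mul t fun j _ => hms
  have h := measure_limsup_eq_one hsm hind (by
    simp_rw [hp]
    exact ENNReal.tsum_const_eq_top_of_ne_zero hpos)
  have h2 : ∀ᵐ ω ∂P, ω ∈ Filter.limsup s Filter.atTop := by
    rw [← prob_compl_eq_zero_iff (MeasurableSet.measurableSet_limsup hsm)] at h
    exact h
  filter_upwards [h2] with ω hω
  rw [Filter.mem_limsup_iff_frequently_mem] at hω
  convert! Nat.frequently_atTop_iff_infinite.1 hω using 2
  simp [hs]

variable [Inhabited E] {adm : (ℕ → ℝ × E) → ℕ → Prop} {G : ℕ → Set ((ℕ → ℝ × E) × ℝ × E)}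

/-- An arrival preceded by a pause of length at least 1 is admitted, and such pauses recur forever.
-/
lemma ae_infinite (hξ : IsMarkedPoisson P lam ν ξ) (hlam : 0 < lam) (hadm : IsProtocol adm G) :
    ∀ᵐ ω ∂P, {j | adm (fun j => ξ j ω) j}.Infinite := by
  filter_upwards [hξ.ae_pos, hξ.ae_frequently_one_le hlam] with ω h1 h2
  exact h2.mono fun j hj => hadm.idle (fun j => ξ j ω) h1 j hj

variable {n : ℕ} {b : (Fin n → State) → ℝ → ℝ} {W : Kernel (Fin n → State) State}

/-- Test the joint law on a set S and split it over (q, k). On each piece the past depends on the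
truncated history and the next state is `mkState (k + 1)` of the elapsed time, so
`lintegral_first_accepted` evaluates it. The sum over k yields the kernel, and the sum over q
restores the whole space. -/
lemma hasCondDistrib_chainState (hξ : IsMarkedPoisson P lam ν ξ) (hlam : 0 < lam)
    (hadm : IsProtocol adm G) (hW : IsBlocking lam b W) {m : ℕ}
    (hG : ∀ q, ∀ z ∈ historySet adm (m + n) q, ∀ s, 0 < s → ν {c | (z, s, c) ∉ G q}
      = ENNReal.ofReal (b (fun k => chainState adm (m + k) z) s)) :
    HasCondDistrib (fun ω => chainState adm (m + n) fun j => ξ j ω)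
      (fun ω (j : Fin (m + n)) => chainState adm j fun j => ξ j ω)
      (W.comap (fun (h : Fin (m + n) → State) (k : Fin n) => h (Fin.natAdd m k)) (by fun_prop))
      P := by
  classical
  have hMarkov := hW.isMarkovKernel hlam
  have hX := measurable_chainState hadm.measurableSet
  have hpath := hξ.measurable_path
  set i := m + n with hi
  set past : (ℕ → ℝ × E) → Fin i → State := fun ζ j => chainState adm j ζ with hpast
  have hpastm : Measurable past := measurable_pi_lambda _ fun j => hX j
  have hpm : Measurable fun ω => past fun j => ξ j ω := hpastm.comp hpath
  have hXm : Measurable fun ω => chainState adm i fun j => ξ j ω := (hX i).comp hpath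
  set b' : (ℕ → ℝ × E) → ℝ → ℝ := fun z => b fun k => chainState adm (m + k) z with hb'
  have hxm : Measurable fun (z : ℕ → ℝ × E) (k : Fin n) => chainState adm (m + k) z :=
    measurable_pi_lambda _ fun k => hX _
  have hb'm : Measurable (Function.uncurry b') :=
    hW.measurable.comp ((hxm.comp measurable_fst).prodMk measurable_snd)
  refine ⟨(hpm.prodMk hXm).aemeasurable, Measure.ext fun S hS => ?_⟩
  -- The indicator of `historySet` makes the test function vanish where `hG` says nothing.
  set Φ : ℕ → ℕ → (ℕ → ℝ × E) × ℝ → ℝ≥0∞ := fun q k p => (historySet adm i q).indicator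
    (fun z => S.indicator (1 : (Fin i → State) × State → ℝ≥0∞) (past z, mkState (k + 1) p.2)) p.1 with hΦ
  have hSm : ∀ k, Measurable fun p : (ℕ → ℝ × E) × ℝ =>
      S.indicator (1 : (Fin i → State) × State → ℝ≥0∞) (past p.1, mkState (k + 1) p.2) := fun k =>
    (measurable_one.indicator hS).comp ((hpastm.comp measurable_fst).prodMk
      (measurable_mkState.comp (measurable_const.prodMk measurable_snd)))
  have hΦm : ∀ q k, Measurable (Φ q k) := fun q k => by
    have : Φ q k = ((historySet adm i q) ×ˢ univ).indicator (fun p : (ℕ → ℝ × E) × ℝ =>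
        S.indicator (1 : (Fin i → State) × State → ℝ≥0∞) (past p.1, mkState (k + 1) p.2)) := by
      funext p
      simp [hΦ, indicator_apply]
    rw [this]
    exact (hSm k).indicator ((hadm.measurableSet_historySet i q).prod MeasurableSet.univ)
  have key : ∀ q k, ∫⁻ ω, {ζ | Rejected (G q) q k ζ ∧ (truncate q ζ, elapsed q (k + 1) ζ,
        (ζ (q + k)).2) ∈ G q}.indicator (fun ζ => Φ q k (truncate q ζ, elapsed q (k + 1) ζ))
          (fun j => ξ j ω) ∂P
      = ∫⁻ ω, (∫⁻ s in Ioi (0 : ℝ), Φ q k (truncate q fun j => ξ j ω, s)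
          * (ENNReal.ofReal (1 - b' (truncate q fun j => ξ j ω) s)
            * stageDensity lam (b' (truncate q fun j => ξ j ω)) k s)) ∂P := fun q k =>
    hξ.lintegral_first_accepted hlam hb'm (fun z s => hW.mem_Icc _ s)
      (hadm.measurableSet_accept q) (hG q) q k (hΦm q k) fun z hz s => indicator_of_notMem hz _
  -- Summing the stages over the number of rejections rebuilds the kernel at the recent states.
  have hinner : ∀ q z, z ∈ historySet adm i q → ∑' k, ∫⁻ s in Ioi (0 : ℝ), Φ q k (z, s)
        * (ENNReal.ofReal (1 - b' z s) * stageDensity lam (b' z) k s)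
      = W (fun k => chainState adm (m + k) z) (Prod.mk (past z) ⁻¹' S) := by
    intro q z hz
    have hSz : MeasurableSet (Prod.mk (past z) ⁻¹' S) := measurable_prodMk_left hS
    have hbz : Measurable (b' z) := hb'm.comp measurable_prodMk_left
    rw [← lintegral_indicator_one hSz, hW.lintegral_eq _ (measurable_one.indicator hSz),
      ← lintegral_tsum]
    · rw [← lintegral_lagMeasure (fun s => ∑' k, Φ q k (z, s)
        * (ENNReal.ofReal (1 - b' z s) * stageDensity lam (b' z) k s))]
      refine lintegral_congr fun s => ?_
      rw [← ENNReal.tsum_mul_left]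
      refine tsum_congr fun k => ?_
      simp only [hΦ, indicator_of_mem hz]
      rw [mkState_of_pos (Nat.le_add_left 1 k) s.2]
      rw [mul_comm, mul_assoc]
      rfl
    · intro k
      have := measurable_stageDensity hbz (hW.mem_Icc _) lam k
      have h2 := (hΦm q k).comp (measurable_prodMk_left (x := z))
      simp only [Function.comp_def] at h2
      exact (h2.mul ((hbz.const_sub 1).ennreal_ofReal.mul this)).aemeasurable
  rw [Measure.map_apply (hpm.prodMk hXm) hS, Measure.compProd_apply hS,
    lintegral_map (Kernel.measurable_kernel_prodMk_left hS) hpm,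
    ← lintegral_indicator_one ((hpm.prodMk hXm) hS)]
  have hleft : ∫⁻ ω, ((fun ω => (past fun j => ξ j ω, chainState adm i fun j => ξ j ω)) ⁻¹' S).indicator
      1 ω ∂P = ∫⁻ ω, ∑' (q) (k), {ζ | Rejected (G q) q k ζ ∧ (truncate q ζ, elapsed q (k + 1) ζ,
        (ζ (q + k)).2) ∈ G q}.indicator (fun ζ => Φ q k (truncate q ζ, elapsed q (k + 1) ζ))
          (fun j => ξ j ω) ∂P := by
    refine lintegral_congr_ae ?_
    filter_upwards [hξ.ae_pos, hξ.ae_infinite hlam hadm] with ω h1 h2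
    exact hadm.indicator_eq_tsum (ζ := fun j => ξ j ω) h1 h2 S
  have htr : ∀ q, Measurable fun ω => truncate q fun j => ξ j ω := fun q =>
    (measurable_truncate q).comp hpath
  have hmeas : ∀ q k, Measurable fun ω => {ζ | Rejected (G q) q k ζ ∧ (truncate q ζ,
      elapsed q (k + 1) ζ, (ζ (q + k)).2) ∈ G q}.indicator
        (fun ζ => Φ q k (truncate q ζ, elapsed q (k + 1) ζ)) (fun j => ξ j ω) := fun q k => by
    have h1 : MeasurableSet {ζ | Rejected (G q) q k ζ ∧
        (truncate q ζ, elapsed q (k + 1) ζ, (ζ (q + k)).2) ∈ G q} :=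
      (measurableSet_rejected (hadm.measurableSet_accept q) q k).inter
        (((measurable_truncate q).prodMk ((measurable_elapsed q (k + 1)).prodMk
          (measurable_pi_apply (q + k)).snd)) (hadm.measurableSet_accept q))
    have h2 : Measurable fun ζ => Φ q k (truncate q ζ, elapsed q (k + 1) ζ) :=
      (hΦm q k).comp ((measurable_truncate q).prodMk (measurable_elapsed q (k + 1)))
    exact (h2.indicator h1).comp hpath
  have hmeas2 : ∀ q k, Measurable fun ω => ∫⁻ s in Ioi (0 : ℝ), Φ q k (truncate q fun j => ξ j ω, s)
          * (ENNReal.ofReal (1 - b' (truncate q fun j => ξ j ω) s)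
            * stageDensity lam (b' (truncate q fun j => ξ j ω)) k s) := by
    intro q k
    have h2 : ∀ q k, Measurable fun p : (ℕ → ℝ × E) × ℝ => Φ q k p
          * (ENNReal.ofReal (1 - b' p.1 p.2) * stageDensity lam (b' p.1) k p.2) := fun q k =>
      (hΦm q k).mul ((hb'm.const_sub 1).ennreal_ofReal.mul
        (measurable_uncurry_stageDensity hb'm lam k))
    have h1 : Measurable fun p : Ω × ℝ => (truncate q fun j => ξ j p.1, p.2) :=
      ((htr q).comp measurable_fst).prodMk measurable_snd
    exact Measurable.lintegral_prod_right' (f := fun p : Ω × ℝ =>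
      Φ q k (truncate q fun j => ξ j p.1, p.2)
          * (ENNReal.ofReal (1 - b' (truncate q fun j => ξ j p.1) p.2)
            * stageDensity lam (b' (truncate q fun j => ξ j p.1)) k p.2))
      ((h2 q k).comp h1)
  rw [hleft, lintegral_tsum fun q => (Measurable.tsum fun k => hmeas q k).aemeasurable]
  simp_rw [lintegral_tsum fun k => (hmeas _ k).aemeasurable, key,
    ← lintegral_tsum fun k => (hmeas2 _ k).aemeasurable]
  rw [← lintegral_tsum fun q => (Measurable.tsum fun k => hmeas2 q k).aemeasurable]
  refine lintegral_congr_ae ?_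
  filter_upwards [hξ.ae_pos, hξ.ae_infinite hlam hadm] with ω h1 h2
  obtain ⟨q, hq⟩ := exists_reached h2 i
  have hD : truncate q (fun j => ξ j ω) ∈ historySet adm i q := by
    refine ⟨(hadm.reached_truncate_iff _).2 hq, fun j hj => ?_⟩
    rw [truncate_of_lt hj]
    exact h1 j
  have hp : past (truncate q fun j => ξ j ω) = past fun j => ξ j ω :=
    funext fun j => hadm.chainState_truncate hq j.2
  rw [tsum_eq_single q, hinner q _ hD, hp]
  · rw [Kernel.comap_apply]
    congr 2
    funext k
    exact hadm.chainState_truncate hq (by omega)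
  · intro q' hq'
    have : truncate q' (fun j => ξ j ω) ∉ historySet adm i q' := fun hmem' =>
      hq' (((hadm.reached_truncate_iff _).1 hmem'.1).unique hq)
    simp [hΦ, indicator_of_notMem this]

theorem admissionChain (hξ : IsMarkedPoisson P lam ν ξ) (hlam : 0 < lam)
    (hadm : IsProtocol adm G) (hW : IsBlocking lam b W) {m₀ : ℕ}
    (hG : ∀ m, m₀ ≤ m → ∀ q, ∀ z ∈ historySet adm (m + n) q, ∀ s, 0 < s → ν {c | (z, s, c) ∉ G q}
      = ENNReal.ofReal (b (fun k => chainState adm (m + k) z) s)) :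
    AdmissionChain P (fun ω => arrival fun j => (ξ j ω).1) (fun ω => adm fun j => ξ j ω) n m₀ W := by
  refine ⟨?_, fun i ω => chainState adm i fun j => ξ j ω, fun i =>
    (measurable_chainState hadm.measurableSet i).comp hξ.measurable_path, ?_,
    fun m hm => hξ.hasCondDistrib_chainState hlam hadm hW (hG m hm)⟩
  · filter_upwards [hξ.ae_pos, hξ.ae_infinite hlam hadm] with ω h1 h2
    have h3 := elapsed_strictMono (ζ := fun j => ξ j ω) h1
    refine ⟨by simpa [arrival] using h1 0, fun j k hjk => ?_, h2⟩
    rw [arrival_eq_elapsed fun j => ξ j ω, arrival_eq_elapsed fun j => ξ j ω]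
    exact h3 (Nat.succ_lt_succ hjk)
  · filter_upwards [hξ.ae_pos, hξ.ae_infinite hlam hadm] with ω h1 h2 i
    exact chainState_eq (ζ := fun j => ξ j ω) h1 h2 i

end IsMarkedPoisson

/-! ### The number of busy channels -/

open Classical in
/-- The number of channels which are busy at time `t` because of the initial condition or one of
the first `q` arrivals. -/
def busyAt {κ : ℕ} (r : Fin κ → ℝ) (T : ℕ → ℝ) (a : ℕ → Prop) (q : ℕ) (t : ℝ) : ℕ :=
  (Finset.univ.filter fun c => t < r c).card
    + ((Finset.range q).filter fun j => a j ∧ t < T j + 1).card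

section BusyAt

variable {κ : ℕ} {r : Fin κ → ℝ} {T T' : ℕ → ℝ} {a a' : ℕ → Prop} {q : ℕ} {t : ℝ}

lemma busyAt_congr (hT : ∀ j < q, T j = T' j) (ha : ∀ j < q, (a j ↔ a' j)) :
    busyAt r T a q t = busyAt r T' a' q t := by
  classical
  unfold busyAt
  congr 2
  refine Finset.filter_congr fun j hj => ?_
  have := Finset.mem_range.1 hj
  rw [hT j this, ha j this]

lemma busyAt_add_of_not {k : ℕ} (h : ∀ l < k, ¬ a (q + l)) :
    busyAt r T a (q + k) t = busyAt r T a q t := by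
  unfold busyAt
  congr 2
  ext j
  simp only [Finset.mem_filter, Finset.mem_range]
  constructor
  · rintro ⟨h1, h2⟩
    refine ⟨?_, h2⟩
    by_contra hq
    have := h (j - q) (by omega)
    rw [show q + (j - q) = j by omega] at this
    exact this h2.1
  · rintro ⟨h1, h2⟩
    exact ⟨by omega, h2⟩

lemma busyAt_antitone {t' : ℝ} (h : t ≤ t') : busyAt r T a q t' ≤ busyAt r T a q t := by
  unfold busyAt
  gcongr

lemma busyAt_succ_le : busyAt r T a (q + 1) t ≤ busyAt r T a q t + 1 := by
  classical
  unfold busyAt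
  rw [add_assoc]
  gcongr
  rw [Finset.range_add_one, Finset.filter_insert]
  split_ifs
  · exact Finset.card_insert_le _ _
  · omega

end BusyAt

section Count

variable {E : Type*} {adm : (ℕ → ℝ × E) → ℕ → Prop} {z : ℕ → ℝ × E} {i q l : ℕ}

/-- The time of the `l`-th admission. -/
def admTime (adm : (ℕ → ℝ × E) → ℕ → Prop) (z : ℕ → ℝ × E) (l : ℕ) : ℝ :=
  elapsed 0 (passed (adm z) l) z

lemma admTime_eq (hr : Reached (adm z) l q) : admTime adm z l = elapsed 0 q z := by
  rw [admTime, hr.passed_eq]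

lemma chainState_snd (hz : z ∈ historySet adm i q) (hl : l < i) :
    ((chainState adm l z).2 : ℝ) = admTime adm z (l + 1) - admTime adm z l := by
  obtain ⟨p, hp, hrp⟩ := hz.1.exists_le hl.le
  obtain ⟨p', hp', hrp'⟩ := hz.1.exists_le (l := l + 1) hl
  obtain ⟨k, rfl⟩ := Nat.exists_eq_add_of_lt (hrp.lt_of_reached_succ hrp')
  rw [chainState_of_reached hrp hrp', admTime_eq hrp, admTime_eq hrp', add_assoc p k 1,
    elapsed_add 0 p, zero_add, mkState_of_pos (by omega) (elapsed_pos (by omega) fun j hj => hz.2 j (by omega))]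
  ring

lemma admTime_lt_succ (hz : z ∈ historySet adm i q) (hl : l < i) :
    admTime adm z l < admTime adm z (l + 1) := by
  have h := chainState_snd hz hl
  have := (chainState adm l z).2.2.out
  linarith

lemma admTime_mono (hz : z ∈ historySet adm i q) {l l' : ℕ} (h : l ≤ l') (hl : l' ≤ i) :
    admTime adm z l ≤ admTime adm z l' := by
  induction l', h using Nat.le_induction with
  | base => exact le_rfl
  | succ k hk ih => exact (ih (by omega)).trans (admTime_lt_succ hz (by omega)).le

/-- The lags telescope to a difference of admission times. -/
lemma ageSum_eq {κ m : ℕ} (hz : z ∈ historySet adm (m + (κ - 1)) q) {k : ℕ} (hk : k ≤ κ) :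
    ageSum κ (fun j : Fin (κ - 1) => chainState adm (m + j) z) k
      = admTime adm z (m + (κ - 1)) - admTime adm z (m + (κ - 1) - (k - 1)) := by
  have h := Finset.sum_range_sub' (fun j => admTime adm z (m + (κ - 1) - j)) (k - 1)
  rw [Nat.sub_zero] at h
  rw [← h, ageSum]
  refine Finset.sum_congr rfl fun j hj => ?_
  have hj' := Finset.mem_range.1 hj
  have hj2 : j < κ - 1 := by omega
  rw [recentLag, dif_pos hj2]
  simp only [Fin.val_rev]
  rw [show m + (κ - 1 - (j + 1)) = m + (κ - 1) - (j + 1) by omega, chainState_snd hz (by omega),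
    show m + (κ - 1) - (j + 1) + 1 = m + (κ - 1) - j by omega]

lemma admTime_zero : admTime adm z 0 = 0 := by
  rw [admTime_eq (reached_zero _)]
  simp [elapsed]

open Classical in
/-- The admitted messages which are still present at time `s` after the last admission, counted by
the number of admissions since they have been admitted. -/
lemma card_present (hz : z ∈ historySet adm i q) (t : ℝ) :
    ((Finset.range q).filter fun j => adm z j ∧ t < arrival (fun j => (z j).1) j + 1).card
      = ((Finset.Icc 1 i).filter fun k => t < admTime adm z (i - (k - 1)) + 1).card := by
  have hi := hz.1.count_eq
  have hreach : ∀ j, adm z j → Reached (adm z) (Nat.count (adm z) j + 1) (j + 1) := by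
    intro j hj
    refine ⟨fun n hn => ?_, ?_⟩
    · exact Nat.lt_succ_iff.2 (Nat.count_monotone _ (Nat.lt_succ_iff.1 hn))
    · rw [Nat.count_succ, if_pos hj]
  -- An admitted message j is admission number `count j + 1`, hence the (i - `count j`)-th latest of
  -- i. Conversely the k-th latest is admission i - (k - 1), whose index is one less than the number
  -- of arrivals passed.
  refine Finset.card_nbij' (fun j => i - Nat.count (adm z) j)
    (fun k => passed (adm z) (i - (k - 1)) - 1) ?_ ?_ ?_ ?_
  · intro j hj
    simp only [Finset.coe_filter, Finset.mem_range, mem_ofPred_eq, Finset.mem_Icc] at hj ⊢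
    obtain ⟨hjq, ha, ht⟩ := hj
    have h1 := (hreach j ha).2
    have h2 : Nat.count (adm z) (j + 1) ≤ Nat.count (adm z) q := Nat.count_monotone _ hjq
    have h3 : i - (i - Nat.count (adm z) j - 1) = Nat.count (adm z) j + 1 := by omega
    refine ⟨by omega, ?_⟩
    rw [h3, admTime_eq (hreach j ha), ← arrival_eq_elapsed]
    exact ht
  · intro k hk
    simp only [Finset.coe_filter, Finset.mem_range, mem_ofPred_eq, Finset.mem_Icc] at hk ⊢
    obtain ⟨hk1, ht⟩ := hk
    obtain ⟨p, hp, hrp⟩ := hz.1.exists_le (l := i - (k - 1)) (by omega)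
    obtain ⟨p', hp', hrp'⟩ := hz.1.exists_le (l := i - k) (by omega)
    rw [show i - (k - 1) = i - k + 1 by omega] at hrp ht ⊢
    obtain ⟨d, rfl⟩ := Nat.exists_eq_add_of_lt (hrp'.lt_of_reached_succ hrp)
    rw [hrp.passed_eq]
    rw [admTime_eq hrp, ← arrival_eq_elapsed] at ht
    exact ⟨by omega, (hrp'.reached_succ_iff.1 hrp).2, ht⟩
  · intro j hj
    simp only [Finset.coe_filter, Finset.mem_range, mem_ofPred_eq] at hj
    have h1 := (hreach j hj.2.1).2
    have h2 : Nat.count (adm z) (j + 1) ≤ Nat.count (adm z) q := Nat.count_monotone _ hj.1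
    simp only
    rw [show i - (i - Nat.count (adm z) j - 1) = Nat.count (adm z) j + 1 by omega,
      (hreach j hj.2.1).passed_eq]
    rfl
  · intro k hk
    simp only [Finset.coe_filter, Finset.mem_Icc, mem_ofPred_eq] at hk
    obtain ⟨hk1, ht⟩ := hk
    obtain ⟨p, hp, hrp⟩ := hz.1.exists_le (l := i - (k - 1)) (by omega)
    obtain ⟨p', hp', hrp'⟩ := hz.1.exists_le (l := i - k) (by omega)
    simp only
    rw [show i - (k - 1) = i - k + 1 by omega] at hrp ⊢
    obtain ⟨d, rfl⟩ := Nat.exists_eq_add_of_lt (hrp'.lt_of_reached_succ hrp)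
    have h3 := (hrp'.reached_succ_iff.1 hrp).1
    rw [hrp.passed_eq, Nat.add_sub_cancel, count_add_of_not h3, hrp'.count_eq]
    omega

variable {κ : ℕ} {r : Fin κ → ℝ}

/-- Just before the last admission fewer than κ channels were busy; that admission adds one, and
since then channels have only been released. -/
lemma busyAt_le (hz : z ∈ historySet adm i q)
    (hinv : ∀ j < q, adm z j → busyAt r (arrival fun j => (z j).1) (adm z) j
      (arrival (fun j => (z j).1) j) < κ) {t : ℝ} (ht : elapsed 0 q z ≤ t) :
    busyAt r (arrival fun j => (z j).1) (adm z) q t ≤ κ := by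
  classical
  rcases Nat.eq_zero_or_pos i with rfl | hi
  · rw [reached_zero_iff.1 hz.1]
    simpa [busyAt] using Finset.card_filter_le Finset.univ fun c => t < r c
  · obtain ⟨p', hp', hrp'⟩ := hz.1.exists_le (l := i - 1) (by omega)
    have hrp := hz.1
    rw [show i = i - 1 + 1 by omega] at hrp
    obtain ⟨d, rfl⟩ := Nat.exists_eq_add_of_lt (hrp'.lt_of_reached_succ hrp)
    have h := hinv (p' + d) (by omega) (hrp'.reached_succ_iff.1 hrp).2
    rw [arrival_eq_elapsed] at h
    have h2 := busyAt_antitone (r := r) (T := arrival fun j => (z j).1) (a := adm z)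
      (q := p' + d) ht
    have h3 := busyAt_succ_le (r := r) (T := arrival fun j => (z j).1) (a := adm z)
      (q := p' + d) (t := t)
    omega

/-- After the `i`-th admission, the number of busy channels is a function of the latest time
lags, if at least `κ` messages have been admitted, or `κ - 1` messages and one at time `0`. -/
lemma busyAt_eq_busyNum (hκ : 1 ≤ κ) (hr : ∀ c, r c ≤ 1) {m : ℕ} (hm : 1 ≤ m ∨ ∃ c, r c = 1)
    (hz : z ∈ historySet adm (m + (κ - 1)) q)
    (hinv : ∀ j < q, adm z j → busyAt r (arrival fun j => (z j).1) (adm z) j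
      (arrival (fun j => (z j).1) j) < κ) {s : ℝ} (hs : 0 < s) :
    busyAt r (arrival fun j => (z j).1) (adm z) q (elapsed 0 q z + s)
      = busyNum κ (fun j : Fin (κ - 1) => chainState adm (m + j) z) s := by
  classical
  set i := m + (κ - 1) with hi
  set x := fun j : Fin (κ - 1) => chainState adm (m + j) z with hx
  have hle := busyAt_le (r := r) hz hinv (t := elapsed 0 q z + s) (by linarith)
  have hti : admTime adm z i = elapsed 0 q z := admTime_eq hz.1
  rw [busyAt, card_present hz, ← hti] at hle ⊢
  set t := admTime adm z i with ht
  have hti0 : 0 ≤ t := by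
    rw [← admTime_zero (adm := adm) (z := z)]
    exact admTime_mono hz (Nat.zero_le _) le_rfl
  have hmono : ∀ k k', k ≤ k' → admTime adm z (i - (k' - 1)) ≤ admTime adm z (i - (k - 1)) :=
    fun k k' h => admTime_mono hz (by omega) (by omega)
  have hage : ∀ k ∈ Finset.Icc 1 κ, s + ageSum κ x k < 1 ↔
      t + s < admTime adm z (i - (k - 1)) + 1 := by
    intro k hk
    rw [ageSum_eq hz (Finset.mem_Icc.1 hk).2]
    constructor <;> intro h <;> linarith
  have hall : t + s < 1 → (Finset.Icc 1 i).filter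
      (fun k => t + s < admTime adm z (i - (k - 1)) + 1) = Finset.Icc 1 i := by
    intro h
    refine Finset.filter_true_of_mem fun k hk => ?_
    have h2 : admTime adm z 0 ≤ admTime adm z (i - (k - 1)) :=
      admTime_mono hz (Nat.zero_le _) (by omega)
    rw [admTime_zero] at h2
    linarith
  rw [busyNum, Finset.filter_congr hage]
  by_cases hm1 : 1 ≤ m
  · have h0 : (Finset.univ.filter fun c => t + s < r c) = ∅ := by
      refine Finset.filter_eq_empty_iff.2 fun c _ hc => ?_
      have h1 : 0 < (Finset.univ.filter fun c => t + s < r c).card :=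
        Finset.card_pos.2 ⟨c, by simpa using hc⟩
      rw [hall (hc.trans_le (hr c)), Nat.card_Icc] at hle
      omega
    rw [h0, Finset.card_empty, zero_add] at hle ⊢
    congr 1
    ext k
    simp only [Finset.mem_filter, Finset.mem_Icc]
    constructor
    · rintro ⟨hk, hk2⟩
      refine ⟨⟨hk.1, ?_⟩, hk2⟩
      -- If the k-th latest message is present, so are all later ones; as at most κ are present, k ≤
      -- κ.
      have h1 : Finset.Icc 1 k ⊆ (Finset.Icc 1 i).filter
          (fun k => t + s < admTime adm z (i - (k - 1)) + 1) := by
        intro j hj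
        simp only [Finset.mem_filter, Finset.mem_Icc] at hj ⊢
        refine ⟨by omega, ?_⟩
        linarith [hmono j k hj.2]
      have h2 := Finset.card_le_card h1
      rw [Nat.card_Icc] at h2
      omega
    · rintro ⟨hk, hk2⟩
      exact ⟨by omega, hk2⟩
  -- The message admitted at time 0 counts as the κ-th latest. While t + s < 1 the κ - 1 later ones
  -- are all present and leave room for just one initially busy channel, namely c₀; afterwards no
  -- initially busy channel remains.
  · obtain rfl : m = 0 := by omega
    obtain ⟨c₀, hc₀⟩ := hm.resolve_left hm1
    have hIcc : Finset.Icc 1 κ = insert κ (Finset.Icc 1 i) := by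
      ext k
      simp only [Finset.mem_Icc, Finset.mem_insert]
      omega
    have hz0 : admTime adm z (i - (κ - 1)) = 0 := by
      rw [show i - (κ - 1) = 0 by omega, admTime_zero]
    rw [hIcc, Finset.filter_insert, hz0, zero_add]
    split_ifs with h1
    · rw [Finset.card_insert_of_notMem (by simp; omega), add_comm]
      congr 1
      rw [hall h1, Nat.card_Icc] at hle
      have : 0 < (Finset.univ.filter fun c => t + s < r c).card :=
        Finset.card_pos.2 ⟨c₀, by simpa [hc₀] using h1⟩
      omega
    · rw [Finset.filter_eq_empty_iff.2 (fun c _ hc => h1 (hc.trans_le (hr c))), Finset.card_empty,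
        zero_add]

end Count

/-! ### The two protocols -/

open Classical in
lemma ncard_fin_eq_card_range (q : ℕ) (p : ℕ → Prop) :
    {i : Fin q | p i}.ncard = ((Finset.range q).filter p).card := by
  rw [← ncard_image_of_injective _ Fin.val_injective, ← ncard_coe_finset]
  congr 1
  ext j
  simp only [mem_image, mem_ofPred_eq, Finset.coe_filter, Finset.mem_range]
  constructor
  · rintro ⟨i, hi, rfl⟩
    exact ⟨i.2, hi⟩
  · rintro ⟨h1, h2⟩
    exact ⟨⟨j, h1⟩, h2, rfl⟩

lemma csmaAdmitted_iff (κ : ℕ) (r : Fin κ → ℝ) (T : ℕ → ℝ) (j : ℕ) :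
    csmaAdmitted κ r T j ↔ busyAt r T (csmaAdmitted κ r T) j (T j) < κ := by
  classical
  rw [csmaAdmitted, ncard_fin_eq_card_range j fun i => csmaAdmitted κ r T i ∧ T j < T i + 1,
    busyAt, ncard_eq_toFinset_card', toFinset_ofPred]
  congr!

lemma alohaAdmitted_iff (κ : ℕ) (r : Fin κ → ℝ) (T : ℕ → ℝ) (C : ℕ → Fin κ) (j : ℕ) :
    alohaAdmitted κ r T C j ↔ r (C j) ≤ T j ∧
      ∀ i < j, alohaAdmitted κ r T C i → C i = C j → T i + 1 ≤ T j := by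
  rw [alohaAdmitted]
  exact and_congr_right' ⟨fun h i hi => h ⟨i, hi⟩, fun h i => h i i.2⟩

/-- The channels which are busy at time `t` because of the initial condition or one of the first `q`
arrivals, if the set of admitted messages is `a`, and these have chosen the channels `C`. -/
def busyChannels {κ : ℕ} (r : Fin κ → ℝ) (T : ℕ → ℝ) (a : ℕ → Prop) (C : ℕ → Fin κ) (q : ℕ)
    (t : ℝ) : Set (Fin κ) :=
  {c | t < r c ∨ ∃ j < q, a j ∧ C j = c ∧ t < T j + 1}

lemma alohaAdmitted_iff_notMem (κ : ℕ) (r : Fin κ → ℝ) (T : ℕ → ℝ) (C : ℕ → Fin κ) (j : ℕ) :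
    alohaAdmitted κ r T C j ↔ C j ∉ busyChannels r T (alohaAdmitted κ r T C) C j (T j) := by
  rw [alohaAdmitted_iff, busyChannels]
  simp only [mem_ofPred_eq, not_or, not_lt, not_exists, not_and]

/-- Messages present at time t sit in distinct channels, none of them initially busy at t; otherwise
the later message would have picked a channel that was busy on its arrival, which lies no later than
t. -/
lemma ncard_busyChannels {κ : ℕ} {r : Fin κ → ℝ} {T : ℕ → ℝ} {C : ℕ → Fin κ} {q : ℕ} {t : ℝ}
    (ht : ∀ j < q, T j ≤ t) :
    (busyChannels r T (alohaAdmitted κ r T C) C q t).ncard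
      = busyAt r T (alohaAdmitted κ r T C) q t := by
  classical
  set S := (Finset.range q).filter fun j => alohaAdmitted κ r T C j ∧ t < T j + 1 with hS
  have hinj : Set.InjOn C S := by
    have key : ∀ i j, i < j → i ∈ S → j ∈ S → C i ≠ C j := by
      intro i j hij hi hj heq
      simp only [hS, Finset.mem_filter, Finset.mem_range] at hi hj
      have h1 := ((alohaAdmitted_iff κ r T C j).1 hj.2.1).2 i hij hi.2.1 heq
      linarith [ht j hj.1, hi.2.2]
    intro i hi j hj heq
    rcases lt_trichotomy i j with h | h | h
    · exact absurd heq (key i j h hi hj)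
    · exact h
    · exact absurd heq.symm (key j i h hj hi)
  have hdisj : Disjoint (Finset.univ.filter fun c => t < r c) (S.image C) := by
    rw [Finset.disjoint_left]
    intro c hc hc'
    simp only [Finset.mem_filter, Finset.mem_univ, true_and, Finset.mem_image] at hc hc'
    obtain ⟨j, hj, rfl⟩ := hc'
    simp only [hS, Finset.mem_filter, Finset.mem_range] at hj
    have h1 := ((alohaAdmitted_iff κ r T C j).1 hj.2.1).1
    linarith [ht j hj.1]
  have : busyChannels r T (alohaAdmitted κ r T C) C q t
      = ((Finset.univ.filter fun c => t < r c) ∪ S.image C : Finset (Fin κ)) := by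
    ext c
    simp only [busyChannels, mem_ofPred_eq, Finset.coe_union, Finset.coe_filter, Finset.mem_univ,
      true_and, Finset.coe_image, mem_union, mem_image, hS, Finset.mem_range]
    refine or_congr_right ?_
    constructor
    · rintro ⟨j, h1, h2, h3, h4⟩; exact ⟨j, ⟨h1, h2, h4⟩, h3⟩
    · rintro ⟨j, ⟨h1, h2, h4⟩, h3⟩; exact ⟨j, h1, h2, h3, h4⟩
  rw [this, ncard_coe_finset, Finset.card_union_of_disjoint hdisj, Finset.card_image_of_injOn hinj,
    busyAt]

section Sequences

variable {E : Type*} {ζ : ℕ → ℝ × E}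

lemma arrival_add (q k : ℕ) (ζ : ℕ → ℝ × E) :
    arrival (fun j => (ζ j).1) (q + k) = elapsed 0 q ζ + elapsed q (k + 1) ζ := by
  rw [arrival_eq_elapsed, add_assoc, elapsed_add, zero_add]

lemma arrival_truncate [Inhabited E] {q j : ℕ} (h : j < q) (ζ : ℕ → ℝ × E) :
    arrival (fun j => (truncate q ζ j).1) j = arrival (fun j => (ζ j).1) j := by
  rw [arrival_eq_elapsed, arrival_eq_elapsed, elapsed_truncate (by omega)]

lemma arrival_add_one_le (hζ : ∀ j, 0 < (ζ j).1) {i j : ℕ} (hij : i < j) (hj : 1 ≤ (ζ j).1) :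
    arrival (fun j => (ζ j).1) i + 1 ≤ arrival (fun j => (ζ j).1) j := by
  have h1 := (elapsed_strictMono hζ).monotone (Nat.succ_le_iff.2 hij)
  simp only [Nat.succ_eq_add_one] at h1
  rw [arrival_eq_elapsed, arrival_eq_elapsed, elapsed_succ 0 j, zero_add]
  linarith

lemma one_le_arrival (hζ : ∀ j, 0 < (ζ j).1) {j : ℕ} (hj : 1 ≤ (ζ j).1) :
    1 ≤ arrival (fun j => (ζ j).1) j := by
  have h1 := (elapsed_strictMono hζ).monotone (Nat.zero_le j)
  rw [arrival_eq_elapsed, elapsed_succ 0 j, zero_add]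
  simp only [elapsed, Finset.range_zero, Finset.sum_empty] at h1 ⊢
  linarith

lemma arrival_le_elapsed {q j : ℕ} (hζ : ∀ j < q, 0 < (ζ j).1) (hj : j < q) :
    arrival (fun j => (ζ j).1) j ≤ elapsed 0 q ζ := by
  obtain ⟨d, rfl⟩ := Nat.exists_eq_add_of_lt hj
  rw [arrival_eq_elapsed, show j + d + 1 = j + 1 + d by omega, elapsed_add 0 (j + 1)]
  have : 0 ≤ elapsed (0 + (j + 1)) d ζ := Finset.sum_nonneg fun l hl => (hζ _ (by
    have := Finset.mem_range.1 hl
    omega)).le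
  linarith

variable [MeasurableSpace E]

lemma measurable_arrival (j : ℕ) :
    Measurable fun ζ : ℕ → ℝ × E => arrival (fun j => (ζ j).1) j := by
  simp only [arrival_eq_elapsed]
  exact measurable_elapsed 0 (j + 1)

open Classical in
lemma measurable_busyAt {κ : ℕ} (r : Fin κ → ℝ) {adm : (ℕ → ℝ × E) → ℕ → Prop} {q : ℕ}
    (hadm : ∀ j < q, MeasurableSet {ζ | adm ζ j}) :
    Measurable fun p : (ℕ → ℝ × E) × ℝ =>
      busyAt r (arrival fun j => (p.1 j).1) (adm p.1) q p.2 := by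
  simp only [busyAt, Finset.card_filter]
  refine (Finset.measurable_sum _ fun c _ => Measurable.ite (measurableSet_lt measurable_snd
    measurable_const) measurable_const measurable_const).add
    (Finset.measurable_sum _ fun j hj => Measurable.ite ?_ measurable_const measurable_const)
  exact (measurable_fst (hadm j (Finset.mem_range.1 hj))).inter (measurableSet_lt measurable_snd
    (((measurable_arrival j).comp measurable_fst).add_const 1))

end Sequences

/-! ### CSMA as an admission protocol -/

section Csma

variable {κ : ℕ} (r : Fin κ → ℝ)

/-- CSMA as a function of the sequence of interarrival times (with trivial marks). -/
def csmaSeq (ζ : ℕ → ℝ × Unit) (j : ℕ) : Prop := csmaAdmitted κ r (arrival fun j => (ζ j).1) j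

/-- The set of histories and elapsed times for which a message is admitted under CSMA. -/
def csmaAccept (q : ℕ) : Set ((ℕ → ℝ × Unit) × ℝ × Unit) :=
  {p | busyAt r (arrival fun j => (p.1 j).1) (csmaSeq r p.1) q (elapsed 0 q p.1 + p.2.1) < κ}

lemma csmaSeq_iff (ζ : ℕ → ℝ × Unit) (j : ℕ) : csmaSeq r ζ j ↔
    busyAt r (arrival fun j => (ζ j).1) (csmaSeq r ζ) j (arrival (fun j => (ζ j).1) j) < κ :=
  csmaAdmitted_iff κ r _ j

lemma measurableSet_csmaSeq (j : ℕ) : MeasurableSet {ζ | csmaSeq r ζ j} := by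
  induction j using Nat.strong_induction_on with
  | _ j ih =>
    have h := (measurable_busyAt r ih).comp
      (measurable_id.prodMk (measurable_arrival (E := Unit) j))
    simp_rw [csmaSeq_iff r _ j]
    exact measurableSet_lt h measurable_const

lemma csmaSeq_truncate (q : ℕ) (ζ : ℕ → ℝ × Unit) (j : ℕ) (hj : j < q) :
    csmaSeq r (truncate q ζ) j ↔ csmaSeq r ζ j := by
  induction j using Nat.strong_induction_on with
  | _ j ih =>
    rw [csmaSeq_iff, csmaSeq_iff, arrival_truncate hj,
      busyAt_congr (fun l hl => arrival_truncate (hl.trans hj) ζ) fun l hl => ih l hl (hl.trans hj)]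

lemma isProtocol_csma (hκ : 1 ≤ κ) (hr : ∀ c, r c ≤ 1) :
    IsProtocol (csmaSeq r) (csmaAccept r) where
  measurableSet := measurableSet_csmaSeq r
  truncate := csmaSeq_truncate r
  measurableSet_accept q := by
    have h := (measurable_busyAt r (q := q) fun j _ => measurableSet_csmaSeq r j).comp
      (measurable_fst.prodMk (((measurable_elapsed 0 q).comp measurable_fst).add
        measurable_snd.fst) : Measurable fun p : (ℕ → ℝ × Unit) × ℝ × Unit =>
          (p.1, elapsed 0 q p.1 + p.2.1))
    exact measurableSet_lt h measurable_const
  -- Rejected messages occupy no channel, so the busy count at arrival q + k is determined by the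
  -- first q arrivals.
  accept q k ζ h := by
    rw [csmaSeq_iff, csmaAccept, mem_ofPred_eq, busyAt_add_of_not h, arrival_add,
      elapsed_truncate (by omega)]
    rw [busyAt_congr (fun j hj => arrival_truncate hj ζ) fun j hj => csmaSeq_truncate r q ζ j hj]
  idle ζ hζ j hj := by
    have h : busyAt r (arrival fun j => (ζ j).1) (csmaSeq r ζ) j (arrival (fun j => (ζ j).1) j)
        = 0 := by
      simp only [busyAt, Nat.add_eq_zero_iff, Finset.card_eq_zero, Finset.filter_eq_empty_iff]
      refine ⟨fun c _ => ?_, fun i hi h => ?_⟩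
      · exact not_lt.2 ((hr c).trans (one_le_arrival hζ hj))
      · exact absurd h.2 (not_lt.2 (arrival_add_one_le hζ (Finset.mem_range.1 hi) hj))
    rw [csmaSeq_iff, h]
    omega

/-- The marks are trivial: given the history and the elapsed time the decision is deterministic. -/
lemma dirac_csmaAccept (hκ : 1 ≤ κ) (hr : ∀ c, r c ≤ 1) {m : ℕ} (hm : 1 ≤ m ∨ ∃ c, r c = 1)
    (q : ℕ) {z : ℕ → ℝ × Unit} (hz : z ∈ historySet (csmaSeq r) (m + (κ - 1)) q) {s : ℝ}
    (hs : 0 < s) :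
    Measure.dirac () {c | (z, s, c) ∉ csmaAccept r q}
      = ENNReal.ofReal (csmaBlock κ (fun k => chainState (csmaSeq r) (m + k) z) s) := by
  have h := busyAt_eq_busyNum hκ hr hm hz (fun j _ hj => (csmaSeq_iff r z j).1 hj) hs
  have h2 : {c | (z, s, c) ∉ csmaAccept r q}
      = {_c : Unit | ¬ busyNum κ (fun k => chainState (csmaSeq r) (m + k) z) s < κ} := by
    ext c
    simp only [csmaAccept, mem_ofPred_eq, h]
  rw [h2, csmaBlock]
  split_ifs with h3 <;> simp [h3]

end Csma

/-! ### ALOHA as an admission protocol -/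

section Aloha

variable {κ : ℕ} (r : Fin κ → ℝ)

/-- ALOHA as a function of the sequence of interarrival times and channel choices. -/
def alohaSeq (ζ : ℕ → ℝ × Fin κ) (j : ℕ) : Prop :=
  alohaAdmitted κ r (arrival fun j => (ζ j).1) (fun j => (ζ j).2) j

/-- The set of histories, elapsed times and channel choices for which a message is admitted under
ALOHA. -/
def alohaAccept (q : ℕ) : Set ((ℕ → ℝ × Fin κ) × ℝ × Fin κ) :=
  {p | p.2.2 ∉ busyChannels r (arrival fun j => (p.1 j).1) (alohaSeq r p.1) (fun j => (p.1 j).2) q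
    (elapsed 0 q p.1 + p.2.1)}

lemma alohaSeq_iff (ζ : ℕ → ℝ × Fin κ) (j : ℕ) : alohaSeq r ζ j ↔ (ζ j).2 ∉
    busyChannels r (arrival fun j => (ζ j).1) (alohaSeq r ζ) (fun j => (ζ j).2) j
      (arrival (fun j => (ζ j).1) j) :=
  alohaAdmitted_iff_notMem κ r _ _ j

lemma measurableSet_notMem_busyChannels {q : ℕ}
    (h : ∀ j < q, MeasurableSet {ζ | alohaSeq r ζ j}) :
    MeasurableSet {p : (ℕ → ℝ × Fin κ) × ℝ × Fin κ | p.2.2 ∉ busyChannels r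
      (arrival fun j => (p.1 j).1) (alohaSeq r p.1) (fun j => (p.1 j).2) q p.2.1} := by
  have heq : {p : (ℕ → ℝ × Fin κ) × ℝ × Fin κ | p.2.2 ∈ busyChannels r
      (arrival fun j => (p.1 j).1) (alohaSeq r p.1) (fun j => (p.1 j).2) q p.2.1}
      = {p | p.2.1 < r p.2.2} ∪ ⋃ j, ⋃ (_ : j < q), ({p | alohaSeq r p.1 j} ∩
        ({p | (p.1 j).2 = p.2.2} ∩ {p | p.2.1 < arrival (fun j => (p.1 j).1) j + 1})) := by
    ext p
    simp only [busyChannels, mem_ofPred_eq, mem_union, mem_iUnion, mem_inter_iff, exists_prop]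
  have h1 : MeasurableSet {p : (ℕ → ℝ × Fin κ) × ℝ × Fin κ | p.2.2 ∈ busyChannels r
      (arrival fun j => (p.1 j).1) (alohaSeq r p.1) (fun j => (p.1 j).2) q p.2.1} := by
    rw [heq]
    refine (measurableSet_lt measurable_snd.fst
      ((measurable_of_countable r).comp measurable_snd.snd)).union
      (MeasurableSet.iUnion fun j => MeasurableSet.iUnion fun hj => ?_)
    exact (measurable_fst (h j hj)).inter ((measurableSet_eq_fun
      ((measurable_pi_apply j).comp measurable_fst).snd measurable_snd.snd).inter
      (measurableSet_lt measurable_snd.fst (((measurable_arrival j).comp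
        measurable_fst).add_const 1)))
  exact h1.compl

lemma measurableSet_alohaSeq (j : ℕ) : MeasurableSet {ζ | alohaSeq r ζ j} := by
  induction j using Nat.strong_induction_on with
  | _ j ih =>
    have h := measurableSet_notMem_busyChannels r ih
    simp_rw [alohaSeq_iff r _ j]
    exact (measurable_id.prodMk ((measurable_arrival j).prodMk (measurable_pi_apply j).snd)) h

lemma busyChannels_add_of_not {T : ℕ → ℝ} {a : ℕ → Prop} {C : ℕ → Fin κ} {q k : ℕ} {t : ℝ}
    (h : ∀ l < k, ¬ a (q + l)) : busyChannels r T a C (q + k) t = busyChannels r T a C q t := by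
  ext c
  refine or_congr_right ⟨?_, ?_⟩
  · rintro ⟨j, h1, h2⟩
    refine ⟨j, ?_, h2⟩
    by_contra hq
    have := h (j - q) (by omega)
    rw [show q + (j - q) = j by omega] at this
    exact this h2.1
  · rintro ⟨j, h1, h2⟩
    exact ⟨j, by omega, h2⟩

/-- The uniform distribution on the channels. -/
def uniformChannel (κ : ℕ) : Measure (Fin κ) := (κ : ℝ≥0∞)⁻¹ • Measure.count

/-- Rejection means that the uniform choice falls into the set of busy channels, so its probability
is the size of that set over κ. -/
lemma uniformChannel_alohaAccept (hκ : 1 ≤ κ) (hr : ∀ c, r c ≤ 1) {m : ℕ}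
    (hm : 1 ≤ m ∨ ∃ c, r c = 1) (q : ℕ) {z : ℕ → ℝ × Fin κ}
    (hz : z ∈ historySet (alohaSeq r) (m + (κ - 1)) q) {s : ℝ} (hs : 0 < s) :
    uniformChannel κ {c | (z, s, c) ∉ alohaAccept r q}
      = ENNReal.ofReal (alohaBlock κ (fun k => chainState (alohaSeq r) (m + k) z) s) := by
  have hT : ∀ j < q, arrival (fun j => (z j).1) j ≤ elapsed 0 q z := fun j hj =>
    arrival_le_elapsed hz.2 hj
  -- An admitted message found its own channel idle, so the busy channels form a proper subset.
  have hinv : ∀ j < q, alohaSeq r z j → busyAt r (arrival fun j => (z j).1) (alohaSeq r z) j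
      (arrival (fun j => (z j).1) j) < κ := by
    intro j hj ha
    have h1 : ∀ i < j, arrival (fun j => (z j).1) i ≤ arrival (fun j => (z j).1) j := by
      intro i hi
      rw [arrival_eq_elapsed z j]
      exact arrival_le_elapsed (fun l hl => hz.2 l (by omega)) (by omega)
    have h2 := ncard_busyChannels (r := r) (C := fun j => (z j).2) h1
    rw [show busyAt r (arrival fun j => (z j).1) (alohaSeq r z) j (arrival (fun j => (z j).1) j)
      = _ from h2.symm]
    have hss : busyChannels r (arrival fun j => (z j).1) (alohaSeq r z) (fun j => (z j).2) j
        (arrival (fun j => (z j).1) j) ⊂ univ :=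
      ssubset_univ_iff.2 fun h => (alohaSeq_iff r z j).1 ha (by rw [h]; exact mem_univ _)
    have h3 := ncard_lt_ncard hss (toFinite _)
    rw [ncard_univ, Nat.card_fin] at h3
    exact h3
  have h := busyAt_eq_busyNum hκ hr hm hz hinv hs
  have hB := ncard_busyChannels (r := r) (T := arrival fun j => (z j).1) (C := fun j => (z j).2)
    (q := q) (t := elapsed 0 q z + s) fun j hj => by linarith [hT j hj]
  have h2 : {c | (z, s, c) ∉ alohaAccept r q} = busyChannels r (arrival fun j => (z j).1)
      (alohaSeq r z) (fun j => (z j).2) q (elapsed 0 q z + s) := by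
    ext c
    simp [alohaAccept]
  rw [h2, uniformChannel, Measure.smul_apply, Measure.count_apply_finite _ (toFinite _),
    ← ncard_eq_toFinset_card, show (busyChannels r (arrival fun j => (z j).1)
      (alohaSeq r z) (fun j => (z j).2) q (elapsed 0 q z + s)).ncard = _ from hB]
  rw [show busyAt r (arrival fun j => (z j).1) (alohaAdmitted κ r (arrival fun j => (z j).1)
    fun j => (z j).2) q (elapsed 0 q z + s) = _ from h, alohaBlock, smul_eq_mul,
    ENNReal.ofReal_div_of_pos (by positivity), ENNReal.ofReal_natCast, ENNReal.ofReal_natCast,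
    mul_comm, div_eq_mul_inv]

variable [Inhabited (Fin κ)]

lemma busyChannels_truncate {q : ℕ} (ζ : ℕ → ℝ × Fin κ) {i : ℕ} (hi : i ≤ q) (t : ℝ)
    (h : ∀ j < i, (alohaSeq r (truncate q ζ) j ↔ alohaSeq r ζ j)) :
    busyChannels r (arrival fun j => (truncate q ζ j).1) (alohaSeq r (truncate q ζ))
        (fun j => (truncate q ζ j).2) i t
      = busyChannels r (arrival fun j => (ζ j).1) (alohaSeq r ζ) (fun j => (ζ j).2) i t := by
  ext c
  refine or_congr_right (exists_congr fun j => and_congr_right fun hj => ?_)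
  simp only [h j hj, arrival_truncate (hj.trans_le hi), truncate_of_lt (hj.trans_le hi)]

lemma alohaSeq_truncate (q : ℕ) (ζ : ℕ → ℝ × Fin κ) (j : ℕ) (hj : j < q) :
    alohaSeq r (truncate q ζ) j ↔ alohaSeq r ζ j := by
  induction j using Nat.strong_induction_on with
  | _ j ih =>
    rw [alohaSeq_iff, alohaSeq_iff, arrival_truncate hj, truncate_of_lt hj,
      busyChannels_truncate r ζ hj.le _ fun l hl => ih l hl (hl.trans hj)]

lemma isProtocol_aloha (hr : ∀ c, r c ≤ 1) : IsProtocol (alohaSeq r) (alohaAccept r) where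
  measurableSet := measurableSet_alohaSeq r
  truncate := alohaSeq_truncate r
  measurableSet_accept q := by
    have h := measurableSet_notMem_busyChannels r (q := q) fun j _ => measurableSet_alohaSeq r j
    exact (measurable_fst.prodMk ((((measurable_elapsed 0 q).comp measurable_fst).add
        measurable_snd.fst).prodMk measurable_snd.snd)) h
  accept q k ζ h := by
    rw [alohaSeq_iff, alohaAccept, mem_ofPred_eq, busyChannels_add_of_not r h, arrival_add,
      elapsed_truncate (by omega),
      busyChannels_truncate r ζ le_rfl _ fun j hj => alohaSeq_truncate r q ζ j hj]
  idle ζ hζ j hj := by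
    rw [alohaSeq, alohaAdmitted_iff]
    exact ⟨(hr _).trans (one_le_arrival hζ hj), fun i hi _ _ => arrival_add_one_le hζ hi hj⟩

end Aloha

/-! ### The processes of the two models -/

/-- Preimages of measurable rectangles form generating π-systems. On them, `hXY` separates the
X-part from the Y-part, and each part factors by its own independence. -/
lemma iIndepFun_prodMk {Ω ι α β : Type*} [MeasurableSpace Ω] [MeasurableSpace α]
    [MeasurableSpace β] {P : Measure Ω} {X : ι → Ω → α} {Y : ι → Ω → β}
    (hXm : ∀ i, Measurable (X i)) (hYm : ∀ i, Measurable (Y i)) (hX : iIndepFun X P)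
    (hY : iIndepFun Y P) (hXY : IndepFun (fun ω i => X i ω) (fun ω i => Y i ω) P) :
    iIndepFun (fun i ω => (X i ω, Y i ω)) P := by
  refine iIndepSets.iIndep (fun i => ((hXm i).prodMk (hYm i)).comap_le)
    (fun i => preimage (fun ω => (X i ω, Y i ω)) ''
      image2 (· ×ˢ ·) {s : Set α | MeasurableSet s} {t : Set β | MeasurableSet t})
    (fun i => ?_) (fun i => ?_) ((iIndepSets_iff _ _).2 fun S f hf => ?_)
  · rintro _ ⟨_, ⟨A, hA, B, hB, rfl⟩, rfl⟩ _ ⟨_, ⟨A', hA', B', hB', rfl⟩, rfl⟩ _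
    exact ⟨_, ⟨A ∩ A', hA.inter hA', B ∩ B', hB.inter hB', rfl⟩, 
      congr_arg _ prod_inter_prod.symm⟩
  · rw [← MeasurableSpace.comap_generateFrom, generateFrom_prod]
  · have h : ∀ i, ∃ (A : Set α) (B : Set β), MeasurableSet A ∧ MeasurableSet B ∧
        (i ∈ S → f i = X i ⁻¹' A ∩ Y i ⁻¹' B) := by
      intro i
      by_cases hi : i ∈ S
      · obtain ⟨_, ⟨A, hA, B, hB, rfl⟩, h⟩ := hf i hi
        exact ⟨A, B, hA, hB, fun _ => h.symm⟩
      · exact ⟨∅, ∅, .empty, .empty, fun h => absurd h hi⟩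
    choose A B hA hB hAB using h
    have hmA : MeasurableSet (⋂ i ∈ S, (fun x : ι → α => x i) ⁻¹' A i) :=
      S.measurableSet_biInter fun i _ => measurable_pi_apply i (hA i)
    have hmB : MeasurableSet (⋂ i ∈ S, (fun x : ι → β => x i) ⁻¹' B i) :=
      S.measurableSet_biInter fun i _ => measurable_pi_apply i (hB i)
    have h1 : ⋂ i ∈ S, f i = (fun ω i => X i ω) ⁻¹' (⋂ i ∈ S, (fun x : ι → α => x i) ⁻¹' A i) ∩
        (fun ω i => Y i ω) ⁻¹' (⋂ i ∈ S, (fun x : ι → β => x i) ⁻¹' B i) := by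
      rw [iInter₂_congr hAB]
      simp only [iInter_inter_distrib, preimage_iInter]
      rfl
    have h2 : ∀ i ∈ S, P (f i) = P (X i ⁻¹' A i) * P (Y i ⁻¹' B i) := fun i hi => by
      rw [hAB i hi]
      exact (hXY.comp (measurable_pi_apply i) (measurable_pi_apply i)).measure_inter_preimage_eq_mul
        _ _ (hA i) (hB i)
    rw [h1, hXY.measure_inter_preimage_eq_mul _ _ hmA hmB, Finset.prod_congr rfl h2,
      Finset.prod_mul_distrib, ← hX.measure_inter_preimage_eq_mul S fun i _ => hA i,
      ← hY.measure_inter_preimage_eq_mul S fun i _ => hB i]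
    simp only [preimage_iInter]
    rfl

/-- A single lag of at least 1 makes γ = 0. -/
lemma busyNum_lt_of_one_le {κ : ℕ} (hκ : 1 ≤ κ) {x : Fin (κ - 1) → State} {s : ℝ} (hs : 0 < s)
    (hx : ∃ i, 1 ≤ ((x i).2 : ℝ)) : busyNum κ x s < κ := by
  rw [busyNum_lt_iff hκ x hs.le, gap, max_eq_right]
  · exact hs.le
  · obtain ⟨i, hi⟩ := hx
    have := Finset.single_le_sum (f := fun i => ((x i).2 : ℝ)) (fun i _ => (x i).2.2.le)
      (Finset.mem_univ i)
    linarith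

lemma conditionU_csma {κ : ℕ} (hκ : 1 ≤ κ) {lam : ℝ} (hlam : 0 < lam) :
    ConditionU (vectorKernel (csmaKernel κ lam)) := by
  refine (isBlocking_csma hκ lam).conditionU hlam one_pos fun x s hs hx => ?_
  rw [csmaBlock, if_pos (busyNum_lt_of_one_le hκ hs hx), sub_zero]

lemma conditionU_aloha {κ : ℕ} (hκ : 1 ≤ κ) {lam : ℝ} (hlam : 0 < lam) :
    ConditionU (vectorKernel (alohaKernel κ lam)) := by
  have hκ0 : (0 : ℝ) < κ := by exact_mod_cast hκ
  -- With at least one idle channel, the uniform choice hits an idle one with probability at least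
  -- 1/κ.
  refine (isBlocking_aloha hκ lam).conditionU hlam (one_div_pos.2 hκ0) fun x s hs hx => ?_
  have h : (busyNum κ x s : ℝ) + 1 ≤ κ := by exact_mod_cast busyNum_lt_of_one_le hκ hs hx
  rw [alohaBlock, le_sub_iff_add_le, ← add_div, div_le_one hκ0]
  linarith

instance isProbabilityMeasure_uniformChannel {κ : ℕ} [NeZero κ] :
    IsProbabilityMeasure (uniformChannel κ) := by
  refine ⟨?_⟩
  rw [uniformChannel, Measure.smul_apply, Measure.count_univ, smul_eq_mul,
    ENat.card_eq_coe_fintype_card, Fintype.card_fin]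
  exact ENNReal.inv_mul_cancel (by simpa using NeZero.ne κ) (ENNReal.natCast_ne_top κ)

lemma IsUniformChoice.map_eq {Ω : Type*} [MeasurableSpace Ω] {P : Measure Ω} {τ : ℕ → Ω → ℝ}
    {κ : ℕ} {C : ℕ → Ω → Fin κ} (hC : IsUniformChoice P τ C) (j : ℕ) :
    P.map (C j) = uniformChannel κ := by
  refine Measure.ext_of_singleton fun c => ?_
  rw [Measure.map_apply (hC.measurable j) (measurableSet_singleton c), hC.uniform, uniformChannel,
    Measure.smul_apply, Measure.count_singleton, smul_eq_mul, mul_one]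

section Processes

variable {Ω : Type*} [MeasurableSpace Ω] {P : Measure Ω} [IsProbabilityMeasure P] {lam : ℝ}
  {τ : ℕ → Ω → ℝ}

lemma IsPoissonInterarrival.isMarkedPoisson_unit (hτ : IsPoissonInterarrival P lam τ) :
    IsMarkedPoisson P lam (Measure.dirac ()) fun j ω => (τ j ω, ()) where
  measurable j := (hτ.measurable j).prodMk measurable_const
  map_eq j := by
    rw [← (hτ.hasLaw j).map_eq, Measure.prod_dirac,
      Measure.map_map measurable_prodMk_right (hτ.measurable j)]
    rfl
  indep := hτ.indep.comp (fun _ t => (t, ())) fun _ => measurable_id.prodMk measurable_const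

lemma IsPoissonInterarrival.isMarkedPoisson_prodMk {κ : ℕ} {C : ℕ → Ω → Fin κ}
    (hτ : IsPoissonInterarrival P lam τ) (hC : IsUniformChoice P τ C) :
    IsMarkedPoisson P lam (uniformChannel κ) fun j ω => (τ j ω, C j ω) where
  measurable j := (hτ.measurable j).prodMk (hC.measurable j)
  map_eq j := by
    rw [← (hτ.hasLaw j).map_eq, ← hC.map_eq j]
    exact (indepFun_iff_map_prod_eq_prod_map_map (hτ.measurable j).aemeasurable
      (hC.measurable j).aemeasurable).1
        (hC.indep_arrivals.comp (measurable_pi_apply j) (measurable_pi_apply j))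
  indep := iIndepFun_prodMk hτ.measurable hC.measurable hτ.indep hC.indep hC.indep_arrivals

lemma IsPoissonInterarrival.admissionChain_csma {κ : ℕ} (hκ : 1 ≤ κ) (hlam : 0 < lam)
    (hτ : IsPoissonInterarrival P lam τ) {r : Fin κ → ℝ} (hr : ∀ c, r c ≤ 1) {m₀ : ℕ}
    (hm₀ : 1 ≤ m₀ ∨ ∃ c, r c = 1) :
    AdmissionChain P (fun ω => arrival fun j => τ j ω)
      (fun ω => csmaAdmitted κ r (arrival fun j => τ j ω)) (κ - 1) m₀ (csmaKernel κ lam) :=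
  hτ.isMarkedPoisson_unit.admissionChain hlam (isProtocol_csma r hκ hr) (isBlocking_csma hκ lam)
    fun _ hm q _ hz _ hs => dirac_csmaAccept r hκ hr (hm₀.imp_left hm.trans') q hz hs

lemma IsPoissonInterarrival.admissionChain_aloha {κ : ℕ} (hκ : 1 ≤ κ) (hlam : 0 < lam)
    (hτ : IsPoissonInterarrival P lam τ) {C : ℕ → Ω → Fin κ} (hC : IsUniformChoice P τ C)
    {r : Fin κ → ℝ} (hr : ∀ c, r c ≤ 1) {m₀ : ℕ} (hm₀ : 1 ≤ m₀ ∨ ∃ c, r c = 1) :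
    AdmissionChain P (fun ω => arrival fun j => τ j ω)
      (fun ω => alohaAdmitted κ r (arrival fun j => τ j ω) fun j => C j ω) (κ - 1) m₀
      (alohaKernel κ lam) := by
  have : NeZero κ := ⟨by omega⟩
  have : Inhabited (Fin κ) := ⟨0⟩
  exact (hτ.isMarkedPoisson_prodMk hC).admissionChain hlam (isProtocol_aloha r hr)
    (isBlocking_aloha hκ lam)
    fun _ hm q _ hz _ hs => uniformChannel_alohaAccept r hκ hr (hm₀.imp_left hm.trans') q hz hs

end Processes

end MultiChannel

end

theorem proposition1p2 (κ : ℕ) (hκ : 1 ≤ κ) (lam : ℝ) (hlam : 0 < lam) :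
    -- CSMA
    (IsMarkovKernel (MultiChannel.csmaKernel κ lam) ∧
      MultiChannel.ConditionU (MultiChannel.vectorKernel (MultiChannel.csmaKernel κ lam)) ∧
      ∀ (Ω : Type*) [MeasurableSpace Ω] (P : Measure Ω) [IsProbabilityMeasure P]
        (τ : ℕ → Ω → ℝ) (r : Fin κ → ℝ),
        MultiChannel.IsPoissonInterarrival P lam τ →
        (∀ c, r c ≤ 1) →
        ∀ m₀ : ℕ, (1 ≤ m₀ ∨ ∃ c, r c = 1) →
          MultiChannel.AdmissionChain P (fun ω => MultiChannel.arrival fun j => τ j ω)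
            (fun ω => MultiChannel.csmaAdmitted κ r (MultiChannel.arrival fun j => τ j ω))
            (κ - 1) m₀ (MultiChannel.csmaKernel κ lam)) ∧
    -- ALOHA
    (IsMarkovKernel (MultiChannel.alohaKernel κ lam) ∧
      MultiChannel.ConditionU (MultiChannel.vectorKernel (MultiChannel.alohaKernel κ lam)) ∧
      ∀ (Ω : Type*) [MeasurableSpace Ω] (P : Measure Ω) [IsProbabilityMeasure P]
        (τ : ℕ → Ω → ℝ) (C : ℕ → Ω → Fin κ) (r : Fin κ → ℝ),
        MultiChannel.IsPoissonInterarrival P lam τ →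
        MultiChannel.IsUniformChoice P τ C →
        (∀ c, r c ≤ 1) →
        ∀ m₀ : ℕ, (1 ≤ m₀ ∨ ∃ c, r c = 1) →
          MultiChannel.AdmissionChain P (fun ω => MultiChannel.arrival fun j => τ j ω)
            (fun ω => MultiChannel.alohaAdmitted κ r (MultiChannel.arrival fun j => τ j ω)
              (fun j => C j ω))
            (κ - 1) m₀ (MultiChannel.alohaKernel κ lam)) := by
  exact ⟨⟨(MultiChannel.isBlocking_csma hκ lam).isMarkovKernel hlam,
      MultiChannel.conditionU_csma hκ hlam,
      fun _ _ _ _ _ _ hτ hr _ hm₀ => hτ.admissionChain_csma hκ hlam hr hm₀⟩,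
    (MultiChannel.isBlocking_aloha hκ lam).isMarkovKernel hlam,
    MultiChannel.conditionU_aloha hκ hlam,
    fun _ _ _ _ _ _ _ hτ hC hr _ hm₀ => hτ.admissionChain_aloha hκ hlam hC hr hm₀⟩
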